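/- A \emph{linear group} is an infinite group $(D,+)$, not necessarily commutative, with a total order $\le$ that is invariant under left and right translations. A \emph{streaming register transducer} (SRT) over $D$ consists of finite sets $\Sigma,\Gamma$ of input and output labels, a finite set $Q$ of states with an initial state $q_0$, a number $k\in\mathbb{N}$ of registers, an arbitrary initial assignment $R_0\in D^k$, and a set of transitions $\Delta\subseteq Q\times\Sigma\times\{>,=,<\}^k\times\{\mathsf{old},\mathsf{new},\mathsf{add}\}^k\times\{1,\dots,k\}\times\Gamma\times Q$. A transition $(q,\sigma,l,m,u,\gamma,q')\in\Delta$ enables the step from $(q,R)$ to $(q',R')$ that reads $(\sigma,d)$ and writes $(\gamma,R'[u])$ if for every $i$ the value $d$ compares with $R[i]$ as $l[i]$ says, and $R'[i]$ is $R[i]$, $d$ or $R[i]+d$ according to whether $m[i]$ is $\mathsf{old}$, $\mathsf{new}$ or $\mathsf{add}$. A (finite) run starts in $(q_0,R_0)$. The SRT is \emph{add-free} if no transition uses $\mathsf{add}$, and \emph{functional} if for every finite input word $s\in(\Sigma\times D)^*$ there is at most one output word $t\in(\Gamma\times D)^*$ with $|t|=|s|$ such that some run reads $s$ and writes $t$.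 An SRT is given as a word that lists its components over a finite alphabet (numbers and names in binary), with each of the $k$ initial register values taking one cell; the length $n$ of this word is the size of the SRT. The machines considered are nondeterministic machines with a finite program, finitely many stacks whose cells hold letters or elements of $D$, and finitely many registers for elements of $D$. One step is a push, a pop, a binary nondeterministic choice, a comparison of two elements of $D$, a computation of $x+y$ or $-x$ in $D$, or loading $0$ or the least positive element of $D$ ($0$ if there is none); programs contain no other elements of $D$. A decision problem about SRTs is in $\mathsf{2NEXPTIME}$ if there are a polynomial $p$ and one such machine, independent of the linear group, which over every linear group and on every input SRT of the problem, of size $n$, halts on all branches within $2^{2^{p(n)}}$ steps, and has an accepting branch if and only if the answer is yes. \textbf{Theorem.} For add-free streaming register transducers with arbitrary initial register values, over arbitrary linear groups, the problem whether a given transducer is functional, and the complementary problem whether it is not functional, are both in $\mathsf{2NEXPTIME}$. -/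

import Mathlib

universe u

/-! ### Streaming register transducers -/

/-- What a transition does with a register: keep it, overwrite it with the input data value,
or add the input data value to it. -/
inductive Update
  | old
  | new
  | add

/-- The new content of a register that holds `r`, when the data value `d` is read. -/
def Update.apply {D : Type*} [Add D] : Update → D → D → D
  | .old, r, _ => r
  | .new, _, d => d
  | .add, r, d => r + d

/-- A transition `(q, σ, l, m, u, γ, q')`. In the guard `l`, the entry `l i` is the outcome of the
comparison of the input data value with register `i`. -/
structure Transition (Sig Gam Q : Type*) (k : ℕ) where
  src : Q
  inLabel : Sig
  guard : Fin k → Ordering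
  update : Fin k → Update
  out : Fin k
  outLabel : Gam
  tgt : Q

/-- A streaming register transducer with input labels `Sig`, output labels `Gam`, data domain `D`,
states `Q` and `k` registers: initial state, initial register contents, transitions. -/
structure SRT (Sig Gam D Q : Type*) (k : ℕ) where
  start : Q
  init : Fin k → D
  trans : Set (Transition Sig Gam Q k)

/-- The transition `τ` enables the step from configuration `c` to configuration `c'` that reads the
letter `a` and writes the letter `b`. The output value is taken from the updated registers. -/
def Transition.Enables {Sig Gam D Q : Type*} {k : ℕ} [Add D] [LinearOrder D]
    (τ : Transition Sig Gam Q k) (c : Q × (Fin k → D)) (a : Sig × D) (b : Gam × D)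
    (c' : Q × (Fin k → D)) : Prop :=
  τ.src = c.1 ∧ τ.inLabel = a.1 ∧ (∀ i, cmp a.2 (c.2 i) = τ.guard i) ∧
    (∀ i, c'.2 i = (τ.update i).apply (c.2 i) a.2) ∧
    b = (τ.outLabel, c'.2 τ.out) ∧ c'.1 = τ.tgt

namespace SRT

variable {Sig Gam D Q : Type*} {k : ℕ}

/-- `S.Run c V c'`: there is a sequence of transition steps from `c` to `c'` along the word `V` of
input-output pairs. -/
inductive Run [Add D] [LinearOrder D] (S : SRT Sig Gam D Q k) :
    Q × (Fin k → D) → List ((Sig × D) × (Gam × D)) → Q × (Fin k → D) → Prop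
  | nil (c) : Run S c [] c
  | cons {c c' c'' a b V} (τ : Transition Sig Gam Q k) (hτ : τ ∈ S.trans)
      (h : τ.Enables c a b c') (hV : Run S c' V c'') : Run S c ((a, b) :: V) c''

/-- The streaming transformation defined by `S`. -/
def transformation [Add D] [LinearOrder D] (S : SRT Sig Gam D Q k) :
    Set (List ((Sig × D) × (Gam × D))) :=
  {V | ∃ c, S.Run (S.start, S.init) V c}

/-- No transition uses `add`. -/
def AddFree (S : SRT Sig Gam D Q k) : Prop :=
  ∀ τ ∈ S.trans, ∀ i, τ.update i = .old ∨ τ.update i = .new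

end SRT

/-- A set of words of input-output pairs is functional if every input word has at most one output
word (of the same length). -/
def FunctionalTransformation {A B : Type*} (T : Set (List (A × B))) : Prop :=
  ∀ s : List A, {t : List B | t.length = s.length ∧ s.zip t ∈ T}.Subsingleton

/-! ### Transducers as inputs of machines -/

/-- The finite alphabet used to write down transducers. -/
inductive Letter
  | bit (b : Bool)
  | sep
  | cmp (o : Ordering)
  | upd (m : Update)

/-- A storage cell holds a letter or a single element of the data domain. -/
inductive Cell (D : Type*)
  | sym (a : Letter)
  | val (d : D)

/-- A transducer whose labels and states are numbered `0, 1, 2, …`. -/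
structure FinSRT (D : Type u) where
  nSig : ℕ
  nGam : ℕ
  nQ : ℕ
  k : ℕ
  srt : SRT (Fin nSig) (Fin nGam) D (Fin nQ) k

/-- A natural number in binary, least significant bit first, followed by a separator. -/
def encodeNat (D : Type*) (n : ℕ) : List (Cell D) :=
  n.bits.map (fun b => Cell.sym (Letter.bit b)) ++ [Cell.sym Letter.sep]

def encodeTransition (D : Type*) {nSig nGam nQ k : ℕ}
    (τ : Transition (Fin nSig) (Fin nGam) (Fin nQ) k) : List (Cell D) :=
  encodeNat D τ.src ++ encodeNat D τ.inLabel ++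
    List.ofFn (fun i => Cell.sym (Letter.cmp (τ.guard i))) ++
    List.ofFn (fun i => Cell.sym (Letter.upd (τ.update i))) ++
    encodeNat D τ.out ++ encodeNat D τ.outLabel ++ encodeNat D τ.tgt

/-- The word `w` describes the transducer `S`: it lists the numbers of input labels, of output
labels and of states, the initial state, the initial register contents (one cell each), and all
transitions in some order. -/
def FinSRT.Describes {D : Type u} (S : FinSRT D) (w : List (Cell D)) : Prop :=
  ∃ ts : List (Transition (Fin S.nSig) (Fin S.nGam) (Fin S.nQ) S.k),
    (∀ τ, τ ∈ ts ↔ τ ∈ S.srt.trans) ∧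
    w = encodeNat D S.nSig ++ encodeNat D S.nGam ++ encodeNat D S.nQ ++
      encodeNat D S.srt.start ++ List.ofFn (fun i => Cell.val (S.srt.init i)) ++
      ts.flatMap (encodeTransition D)

/-! ### Nondeterministic machines over a linear group

The storage of a machine consists of finitely many stacks of cells (two stacks are the two halves of
a Turing tape) and finitely many data registers, each of which holds one element of the data domain.
Every instruction is one step. A program contains no elements of the data domain; the only such
constants it can use are `0` and the least positive element (if there is one). -/

/-- Instructions of machines with stacks `K`, data registers `R` and labels `Λ`. -/
inductive Instr (K R Λ : Type)
  /-- push a letter onto a stack -/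
  | push (i : K) (a : Letter) (next : Λ)
  /-- push the content of a data register onto a stack -/
  | pushReg (i : K) (r : R) (next : Λ)
  /-- remove the top cell of a stack, if there is one, and branch; an element of the data domain is
  moved to the data register `r` -/
  | pop (i : K) (r : R) (onSym : Letter → Λ) (onVal onEmpty : Λ)
  /-- `r := 0` -/
  | setZero (r : R) (next : Λ)
  /-- `r := ` the least positive element (`0` if there is none) -/
  | setUnit (r : R) (next : Λ)
  /-- `r := x + y` -/
  | sum (r x y : R) (next : Λ)
  /-- `r := -x` -/
  | neg (r x : R) (next : Λ)
  /-- branch on the comparison of two data registers -/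
  | test (x y : R) (next : Ordering → Λ)
  /-- nondeterministic branch -/
  | guess (next next' : Λ)
  | accept
  | reject

/-- A nondeterministic machine: a finite program with finitely many stacks and data registers. -/
structure Machine where
  Stack : Type
  Reg : Type
  Label : Type
  [finStack : Finite Stack]
  [finReg : Finite Reg]
  [finLabel : Finite Label]
  [decStack : DecidableEq Stack]
  [decReg : DecidableEq Reg]
  /-- the stack that holds the input word at the beginning, first letter on top -/
  input : Stack
  start : Label
  prog : Label → Instr Stack Reg Label

attribute [instance] Machine.finStack Machine.finReg Machine.finLabel Machine.decStack
  Machine.decReg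

open Classical in
/-- The least positive element of `D`, or `0` if `D` has none. -/
noncomputable def unitElement (D : Type*) [Zero D] [Preorder D] : D :=
  if h : ∃ e : D, IsLeast {x | 0 < x} e then h.choose else 0

namespace Machine

/-- Configurations of a machine over the data domain `D`. -/
structure Conf (M : Machine) (D : Type u) where
  label : M.Label
  stack : M.Stack → List (Cell D)
  reg : M.Reg → D

variable (M : Machine) {D : Type u} [AddGroup D] [LinearOrder D]

/-- The possible successors of a configuration. -/
noncomputable def succs (c : M.Conf D) : List (M.Conf D) :=
  match M.prog c.label with
  | .push i a q => [⟨q, Function.update c.stack i (Cell.sym a :: c.stack i), c.reg⟩]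
  | .pushReg i r q => [⟨q, Function.update c.stack i (Cell.val (c.reg r) :: c.stack i), c.reg⟩]
  | .pop i r onSym onVal onEmpty =>
    match c.stack i with
    | [] => [⟨onEmpty, c.stack, c.reg⟩]
    | Cell.sym a :: l => [⟨onSym a, Function.update c.stack i l, c.reg⟩]
    | Cell.val d :: l => [⟨onVal, Function.update c.stack i l, Function.update c.reg r d⟩]
  | .setZero r q => [⟨q, c.stack, Function.update c.reg r 0⟩]
  | .setUnit r q => [⟨q, c.stack, Function.update c.reg r (unitElement D)⟩]
  | .sum r x y q => [⟨q, c.stack, Function.update c.reg r (c.reg x + c.reg y)⟩]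
  | .neg r x q => [⟨q, c.stack, Function.update c.reg r (-c.reg x)⟩]
  | .test x y q => [⟨q (_root_.cmp (c.reg x) (c.reg y)), c.stack, c.reg⟩]
  | .guess q q' => [⟨q, c.stack, c.reg⟩, ⟨q', c.stack, c.reg⟩]
  | .accept => []
  | .reject => []

/-- `M.Steps n c c'`: some computation leads from `c` to `c'` in exactly `n` steps. -/
inductive Steps : ℕ → M.Conf D → M.Conf D → Prop
  | refl (c) : Steps 0 c c
  | step {n c c' c''} (h : c' ∈ M.succs c) (h' : Steps n c' c'') : Steps (n + 1) c c''

/-- The initial configuration on the input word `w`. -/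
def initConf (w : List (Cell D)) : M.Conf D :=
  ⟨M.start, Function.update (fun _ => []) M.input w, fun _ => 0⟩

/-- Some computation on `w` ends in an `accept` instruction. -/
def Accepts (w : List (Cell D)) : Prop :=
  ∃ n c, M.Steps n (M.initConf w) c ∧ M.prog c.label = .accept

/-- No computation on `w` takes more than `T` steps. -/
def HaltsWithin (w : List (Cell D)) (T : ℕ) : Prop :=
  ∀ n c, M.Steps n (M.initConf w) c → n ≤ T

end Machine

/-- The problem whether a given transducer from the class `C` has the property `P` is in 2NEXPTIME:
one nondeterministic machine, working over every linear group (infinite linearly ordered group, not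
necessarily commutative), halts on every description `w` of a transducer in `C` on all computation
branches within `2 ^ 2 ^ p(|w|)` steps, for a fixed polynomial `p`, and has an accepting branch if and
only if the transducer has the property `P`. -/
def InTwoNEXPTIME (C P : (D : Type u) → [AddGroup D] → [LinearOrder D] → FinSRT D → Prop) : Prop :=
  ∃ (M : Machine) (p : Polynomial ℕ),
    ∀ (D : Type u) [AddGroup D] [LinearOrder D] [AddLeftMono D] [AddRightMono D] [Infinite D]
      (S : FinSRT D), C D S → ∀ w : List (Cell D), S.Describes w →
        M.HaltsWithin w (2 ^ 2 ^ p.eval w.length) ∧ (M.Accepts w ↔ P D S)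

/-! ### Extending strictly monotone maps -/

section Embedding

variable {X Y : Type*} [LinearOrder X] [LinearOrder Y]

/-! Without `add`, a register only ever holds an initial value or a value read earlier, and guards
only compare. A run therefore uses nothing of the group but its order. Two copies of the transducer
that read the same input form a system with 2k registers, `pairSys`, whose steps depend only on the
control states and on the order type of the registers and the input. The transducer fails to be
functional exactly if this system can reach a configuration that admits an input on which the two
output letters differ (`SRT.not_functional_iff`).

Short witnesses. Mark a finite set F of points containing the initial values, and forget everything
about a configuration except its states, the order type of its registers and their positions
relative to F. This leaves finitely many symbolic states, and a shortest symbolic path to a bad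
state repeats none. Such a path can be realized step by step over a dense order without endpoints,
here ℚ, with values that avoid the gaps of F that are empty in the original order
(`RegSys.badIn_of_pathTo`). It reads few values, so they can be moved back into the original order
by a strictly monotone map fixing the marks, provided that every gap between consecutive marks is
empty or has at least as many points as there are symbolic states
(`RegSys.BadIn.exists_lt_symCount`). If some gap is neither, mark all of its points as well: one
nonempty gap disappears and F grows by a controlled amount. There are at most |F|² gaps at the
beginning, so this ends, and the resulting bound on the length of a witness does not depend on the
initial values (`RegSys.BadIn.exists_lt_bound`). It is doubly exponential in the size of the
transducer.

From the group to numbers. A linear group is either densely ordered, or it has a least positive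
element e and x + e is the successor of every x (`unitElement_cases`). Comparing x + t • e with y
for t = 1, …, N therefore tells how many of at most N values fit between x and y. These truncated
gaps are all that matters about the initial values: a witness exists over the group if and only if
one exists over {0, …, N - 1}, from some initial numbers compatible with the gaps
(`RegSys.exists_badIn_iff`).

Deterministic search. Over {0, …, N - 1} there are at most N ^ (2k + 2) configurations, a doubly
exponential number M. A deterministic program computes N, M and the gaps, codes words and
configurations as numbers in unary, and iterates the set of reached configurations M times, in time
polynomial in the numbers involved (`FPred.reached`, `Cmd.runs_main`). Since the machine never
guesses, exchanging acceptance and rejection settles functionality and non-functionality alike. The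
program is written in a small structured language whose compilation to machines preserves the number
of steps. -/

theorem exists_split_of_le_encard (S : Set Y) (p q : ℕ) (h : ((p + q + 1 : ℕ) : ℕ∞) ≤ S.encard) :
    ∃ y ∈ S, (p : ℕ∞) ≤ (S ∩ Set.Iio y).encard ∧ (q : ℕ∞) ≤ (S ∩ Set.Ioi y).encard := by
  obtain ⟨T, hTS, hT⟩ := Set.exists_subset_encard_eq h
  have hfin : T.Finite := Set.finite_of_encard_eq_coe hT
  obtain ⟨T, rfl⟩ := hfin.exists_finset_coe
  rw [Set.encard_coe_eq_coe_finsetCard, Nat.cast_inj] at hT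
  have hinj := (T.orderEmbOfFin hT).injective
  refine ⟨T.orderEmbOfFin hT ⟨p, by omega⟩, hTS (T.orderEmbOfFin_mem hT _), ?_, ?_⟩
  · have hsub : (Finset.univ.filter (fun i : Fin (p + q + 1) => (i : ℕ) < p)).image
        (T.orderEmbOfFin hT) ⊆ T.filter (· < T.orderEmbOfFin hT ⟨p, by omega⟩) := by
      intro y hy
      simp only [Finset.mem_image, Finset.mem_filter, Finset.mem_univ, true_and] at hy
      obtain ⟨i, hi, rfl⟩ := hy
      exact Finset.mem_filter.2 ⟨T.orderEmbOfFin_mem hT _, (OrderEmbedding.lt_iff_lt _).2 hi⟩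
    have hc := Finset.card_le_card hsub
    rw [Finset.card_image_of_injective _ hinj, Fin.card_filter_val_lt,
      min_eq_right (by omega)] at hc
    calc (p : ℕ∞) ≤ ((T.filter (· < T.orderEmbOfFin hT ⟨p, by omega⟩)).card : ℕ∞) := by
          exact_mod_cast hc
      _ = ((T.filter (· < T.orderEmbOfFin hT ⟨p, by omega⟩) : Finset Y) : Set Y).encard :=
          (Set.encard_coe_eq_coe_finsetCard _).symm
      _ ≤ _ := Set.encard_le_encard fun y hy => by
          simp only [Finset.coe_filter, Set.mem_ofPred_eq] at hy
          exact ⟨hTS hy.1, hy.2⟩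
  · have hsub : (Finset.univ.filter (fun i : Fin (p + q + 1) => ¬ (i : ℕ) < p + 1)).image
        (T.orderEmbOfFin hT) ⊆ T.filter (T.orderEmbOfFin hT ⟨p, by omega⟩ < ·) := by
      intro y hy
      simp only [Finset.mem_image, Finset.mem_filter, Finset.mem_univ, true_and] at hy
      obtain ⟨i, hi, rfl⟩ := hy
      refine Finset.mem_filter.2 ⟨T.orderEmbOfFin_mem hT _, (OrderEmbedding.lt_iff_lt _).2 ?_⟩
      exact Fin.lt_def.2 (by simp; omega)
    have hc := Finset.card_le_card hsub
    have h1 := Finset.card_filter_add_card_filter_not (s := Finset.univ)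
      (fun i : Fin (p + q + 1) => (i : ℕ) < p + 1)
    rw [Fin.card_filter_val_lt, min_eq_right (by omega), Finset.card_univ, Fintype.card_fin] at h1
    rw [Finset.card_image_of_injective _ hinj] at hc
    have hq : q ≤ (T.filter (T.orderEmbOfFin hT ⟨p, by omega⟩ < ·)).card := by omega
    calc (q : ℕ∞) ≤ ((T.filter (T.orderEmbOfFin hT ⟨p, by omega⟩ < ·)).card : ℕ∞) := by
          exact_mod_cast hq
      _ = ((T.filter (T.orderEmbOfFin hT ⟨p, by omega⟩ < ·) : Finset Y) : Set Y).encard :=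
          (Set.encard_coe_eq_coe_finsetCard _).symm
      _ ≤ _ := Set.encard_le_encard fun y hy => by
          simp only [Finset.coe_filter, Set.mem_ofPred_eq] at hy
          exact ⟨hTS hy.1, hy.2⟩

/-- Between consecutive points of `C`, the target has room for the points of `V`. -/
def GapRoom (V C : Finset X) (h : X → Y) : Prop :=
  ∀ a ∈ C, ∀ b ∈ C, a < b → (∀ c ∈ C, ¬ (a < c ∧ c < b)) →
    ((V.filter (fun v => a < v ∧ v < b)).card : ℕ∞) ≤ (Set.Ioo (h a) (h b)).encard

/-- The new point `v` lies in one gap of `C`. The image of that gap has room for all points of `V`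
in it, so an image of `v` can be chosen that leaves enough room on both sides for the remaining
ones. Where the gap is unbounded, the absence of endpoints in `Y` supplies infinitely many
candidates. -/
theorem exists_room_of_notMem [NoMaxOrder Y] [NoMinOrder Y] [Nonempty Y] {V C : Finset X}
    {h : X → Y} (hmono : StrictMonoOn h C) (hroom : GapRoom V C h) {v : X} (hvV : v ∈ V)
    (hvC : v ∉ C) :
    ∃ y, (∀ c ∈ C, c < v → h c < y) ∧ (∀ c ∈ C, v < c → y < h c) ∧
      GapRoom V (insert v C) (Function.update h v y) := by
  -- `S` consists of the admissible images of `v`; `Lo` and `Hi` are the points of `V` that share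
  -- the gap of `v`, below and above it.
  let S : Set Y := {y | ∀ c ∈ C, (c < v → h c < y) ∧ (v < c → y < h c)}
  let Lo := V.filter (fun w => w < v ∧ ∀ c ∈ C, c < v → c < w)
  let Hi := V.filter (fun w => v < w ∧ ∀ c ∈ C, v < c → w < c)
  have hS : ((Lo.card + Hi.card + 1 : ℕ) : ℕ∞) ≤ S.encard := by
    have hlo : (C.filter (· < v)).Nonempty ∨ ∀ c ∈ C, v < c := by
      by_cases hne : (C.filter (· < v)).Nonempty
      · exact Or.inl hne
      · refine Or.inr fun c hc => ?_
        rw [Finset.not_nonempty_iff_eq_empty, Finset.filter_eq_empty_iff] at hne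
        exact lt_of_le_of_ne (not_lt.1 (hne hc)) (by rintro rfl; exact hvC hc)
    have hhi : (C.filter (v < ·)).Nonempty ∨ ∀ c ∈ C, c < v := by
      by_cases hne : (C.filter (v < ·)).Nonempty
      · exact Or.inl hne
      · refine Or.inr fun c hc => ?_
        rw [Finset.not_nonempty_iff_eq_empty, Finset.filter_eq_empty_iff] at hne
        exact lt_of_le_of_ne (not_lt.1 (hne hc)) (by rintro rfl; exact hvC hc)
    have hinf : ∀ s : Set Y, s.Infinite → s ⊆ S →
        ((Lo.card + Hi.card + 1 : ℕ) : ℕ∞) ≤ S.encard := fun s hs hsub => by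
      rw [(hs.mono hsub).encard_eq]; exact le_top
    rcases hlo with hlo | hlo
    · obtain ⟨a, ha, hamax⟩ := Finset.exists_max_image _ id hlo
      rw [Finset.mem_filter] at ha
      have hamax' : ∀ c ∈ C, c < v → c ≤ a := fun c hc hcv =>
        hamax c (Finset.mem_filter.2 ⟨hc, hcv⟩)
      rcases hhi with hhi | hhi
      · obtain ⟨b, hb, hbmin⟩ := Finset.exists_min_image _ id hhi
        rw [Finset.mem_filter] at hb
        have hbmin' : ∀ c ∈ C, v < c → b ≤ c := fun c hc hcv =>
          hbmin c (Finset.mem_filter.2 ⟨hc, hcv⟩)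
        have h1 := hroom a ha.1 b hb.1 (ha.2.trans hb.2) (by
          rintro c hc ⟨h1, h2⟩
          rcases lt_trichotomy c v with hcv | rfl | hcv
          · exact absurd (hamax' c hc hcv) (not_le.2 h1)
          · exact hvC hc
          · exact absurd (hbmin' c hc hcv) (not_le.2 h2))
        -- `Lo`, `Hi` and `v` itself are distinct points of `V` between the neighbours `a` and `b`,
        -- which explains the summand 1.
        refine le_trans ?_ (h1.trans (Set.encard_le_encard ?_))
        · have hdisj : Disjoint Lo Hi := Finset.disjoint_left.2 fun w h1 h2 =>
            lt_asymm (Finset.mem_filter.1 h1).2.1 (Finset.mem_filter.1 h2).2.1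
          have hv : v ∉ Lo ∪ Hi := by simp [Lo, Hi]
          rw [← Finset.card_union_of_disjoint hdisj, ← Finset.card_insert_of_notMem hv]
          refine Nat.cast_le.2 (Finset.card_le_card fun w hw => ?_)
          rw [Finset.mem_insert, Finset.mem_union] at hw
          rw [Finset.mem_filter]
          rcases hw with rfl | hw | hw
          · exact ⟨hvV, ha.2, hb.2⟩
          · have := Finset.mem_filter.1 hw
            exact ⟨this.1, this.2.2 a ha.1 ha.2, this.2.1.trans hb.2⟩
          · have := Finset.mem_filter.1 hw
            exact ⟨this.1, ha.2.trans this.2.1, this.2.2 b hb.1 hb.2⟩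
        · intro y hy c hc
          exact ⟨fun hcv => (hmono.le_iff_le hc ha.1 |>.2 (hamax' c hc hcv)).trans_lt hy.1,
            fun hcv => hy.2.trans_le (hmono.le_iff_le hb.1 hc |>.2 (hbmin' c hc hcv))⟩
      · refine hinf _ (Set.Ioi_infinite (h a)) fun y hy c hc => ?_
        exact ⟨fun hcv => (hmono.le_iff_le hc ha.1 |>.2 (hamax' c hc hcv)).trans_lt hy,
          fun hcv => absurd hcv (lt_asymm (hhi c hc))⟩
    · rcases hhi with hhi | hhi
      · obtain ⟨b, hb, hbmin⟩ := Finset.exists_min_image _ id hhi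
        rw [Finset.mem_filter] at hb
        have hbmin' : ∀ c ∈ C, v < c → b ≤ c := fun c hc hcv =>
          hbmin c (Finset.mem_filter.2 ⟨hc, hcv⟩)
        refine hinf _ (Set.Iio_infinite (h b)) fun y hy c hc => ?_
        exact ⟨fun hcv => absurd hcv (lt_asymm (hlo c hc)),
          fun hcv => lt_of_lt_of_le hy (hmono.le_iff_le hb.1 hc |>.2 (hbmin' c hc hcv))⟩
      · obtain ⟨y⟩ := ‹Nonempty Y›
        refine hinf _ (Set.Ioi_infinite y) fun y hy c hc => ?_
        exact absurd (hhi c hc) (lt_asymm (hlo c hc))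
  -- The chosen image has at least as many admissible values below it as `Lo` has points, and above
  -- it as `Hi` has.
  obtain ⟨y, hyS, hp, hq⟩ := exists_split_of_le_encard S _ _ hS
  have hup : ∀ c ∈ C, Function.update h v y c = h c := fun c hc =>
    Function.update_of_ne (by rintro rfl; exact hvC hc) _ _
  refine ⟨y, fun c hc => (hyS c hc).1, fun c hc => (hyS c hc).2, ?_⟩
  intro a ha b hb hab hcons
  rw [Finset.mem_insert] at ha hb
  rcases ha with rfl | ha <;> rcases hb with rfl | hb
  · exact absurd hab (lt_irrefl _)
  · rw [Function.update_self, hup b hb]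
    refine le_trans (Nat.cast_le.2 (Finset.card_le_card ?_))
      (hq.trans (Set.encard_le_encard fun z hz => ⟨hz.2, (hz.1 b hb).2 hab⟩))
    intro w hw
    rw [Finset.mem_filter] at hw ⊢
    refine ⟨hw.1, hw.2.1, fun c hc hac => hw.2.2.trans_le ?_⟩
    exact not_lt.1 fun hcb => hcons c (Finset.mem_insert_of_mem hc) ⟨hac, hcb⟩
  · rw [Function.update_self, hup a ha]
    refine le_trans (Nat.cast_le.2 (Finset.card_le_card ?_))
      (hp.trans (Set.encard_le_encard fun z hz => ⟨(hz.1 a ha).1 hab, hz.2⟩))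
    intro w hw
    rw [Finset.mem_filter] at hw ⊢
    refine ⟨hw.1, hw.2.2, fun c hc hac => lt_of_le_of_lt ?_ hw.2.1⟩
    exact not_lt.1 fun hcb => hcons c (Finset.mem_insert_of_mem hc) ⟨hcb, hac⟩
  · rw [hup a ha, hup b hb]
    exact hroom a ha b hb hab fun c hc => hcons c (Finset.mem_insert_of_mem hc)

/-- Points are added one at a time, with `GapRoom` as the invariant. Only bounded gaps carry a
condition, so for `C = ∅` every finite set embeds. -/
theorem exists_strictMonoOn_extend [NoMaxOrder Y] [NoMinOrder Y] [Nonempty Y] (V : Finset X) :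
    ∀ (n : ℕ) (C : Finset X), (V \ C).card = n → C ⊆ V → ∀ h : X → Y, StrictMonoOn h C →
      GapRoom V C h → ∃ h' : X → Y, StrictMonoOn h' V ∧ ∀ c ∈ C, h' c = h c := by
  intro n
  induction n with
  | zero =>
    intro C hn hCV h hm _
    have : C = V := hCV.antisymm (Finset.sdiff_eq_empty_iff_subset.1 (Finset.card_eq_zero.1 hn))
    subst this
    exact ⟨h, hm, fun _ _ => rfl⟩
  | succ n ih =>
    intro C hn hCV h hm hroom
    obtain ⟨v, hv⟩ : (V \ C).Nonempty := Finset.card_pos.1 (by omega)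
    obtain ⟨hvV, hvC⟩ := Finset.mem_sdiff.1 hv
    obtain ⟨y, hlo, hhi, hroom'⟩ := exists_room_of_notMem hm hroom hvV hvC
    have hup : ∀ c ∈ C, Function.update h v y c = h c := fun c hc =>
      Function.update_of_ne (by rintro rfl; exact hvC hc) _ _
    obtain ⟨h', hm', he⟩ := ih (insert v C) (by
        rw [Finset.sdiff_insert, Finset.card_erase_of_mem hv, hn]; rfl)
      (Finset.insert_subset hvV hCV) (Function.update h v y) (by
        intro a ha b hb hab
        rw [Finset.mem_coe, Finset.mem_insert] at ha hb
        rcases ha with rfl | ha <;> rcases hb with rfl | hb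
        · exact absurd hab (lt_irrefl _)
        · rw [Function.update_self, hup b hb]; exact hhi b hb hab
        · rw [Function.update_self, hup a ha]; exact hlo a ha hab
        · rw [hup a ha, hup b hb]; exact hm ha hb hab) hroom'
    exact ⟨h', hm', fun c hc => (he c (Finset.mem_insert_of_mem hc)).trans (hup c hc)⟩

end Embedding

/-! ### Register systems driven by order types -/

/-- The order type of a family. -/
def orderType {J X : Type*} [LinearOrder X] (f : J → X) : J → J → Ordering :=
  fun i j => cmp (f i) (f j)

/-- The registers together with the input value. -/
def withInput {I X : Type*} (R : I → X) (d : X) : Option I → X := fun o => o.elim d R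

/-- Write `d` into the registers selected by `w`. -/
def overwrite {I X : Type*} (w : I → Bool) (R : I → X) (d : X) : I → X :=
  fun i => if w i then d else R i

theorem orderType_comp {J X Y : Type*} [LinearOrder X] [LinearOrder Y] {A : Set X} {h : X → Y}
    (hm : StrictMonoOn h A) {f : J → X} (hf : ∀ j, f j ∈ A) :
    orderType (h ∘ f) = orderType f := by
  funext i j
  exact hm.cmp_map_eq (hf i) (hf j)

/-- A system with registers `I` and control states `P`, whose steps and bad inputs depend on the
order type of the registers and the input value. -/
structure RegSys (P I : Type*) where
  step : P → (Option I → Option I → Ordering) → (I → Bool) → P → Prop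
  bad : P → (Option I → Option I → Ordering) → Prop

namespace RegSys

variable {P I : Type*} (S : RegSys P I)

/-- After `n` steps, a bad input is possible; all inputs are taken from `A`. -/
inductive BadIn {X : Type*} [LinearOrder X] (A : Set X) : ℕ → P → (I → X) → Prop
  | bad {p R d} (hd : d ∈ A) (h : S.bad p (orderType (withInput R d))) : BadIn A 0 p R
  | step {n p R d w p'} (hd : d ∈ A) (h : S.step p (orderType (withInput R d)) w p')
      (hb : BadIn A n p' (overwrite w R d)) : BadIn A (n + 1) p R

variable {S}

theorem BadIn.mono {X : Type*} [LinearOrder X] {A B : Set X} (hAB : A ⊆ B) {n p R}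
    (h : S.BadIn A n p R) : S.BadIn B n p R := by
  induction h with
  | bad hd h => exact .bad (hAB hd) h
  | step hd h _ ih => exact .step (hAB hd) h ih

/-- Steps see only order types, and a map that is strictly monotone on all values in use preserves
these. -/
theorem BadIn.map {X Y : Type*} [LinearOrder X] [LinearOrder Y] {A : Set X} {B : Set Y} {h : X → Y}
    (hm : StrictMonoOn h A) (hB : Set.MapsTo h A B) {n p} {R : I → X} (hR : ∀ i, R i ∈ A)
    (hb : S.BadIn A n p R) : S.BadIn B n p (h ∘ R) := by
  have key : ∀ (R : I → X) (d : X), (∀ i, R i ∈ A) → d ∈ A →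
      orderType (withInput (h ∘ R) (h d)) = orderType (withInput R d) := fun R d hR hd => by
    have : withInput (h ∘ R) (h d) = h ∘ withInput R d := by
      funext o; cases o <;> rfl
    rw [this]
    exact orderType_comp hm (by rintro (_ | i); exacts [hd, hR i])
  induction hb with
  | @bad p R d hd hs => exact .bad (hB hd) (by rw [key R d hR hd]; exact hs)
  | @step n p R d w p' hd hs _ ih =>
    refine .step (d := h d) (w := w) (p' := p') (hB hd) (by rw [key R d hR hd]; exact hs) ?_
    have : overwrite w (h ∘ R) (h d) = h ∘ overwrite w R d := by
      funext i; simp only [overwrite, Function.comp]; split <;> rfl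
    rw [this]
    refine ih fun i => ?_
    simp only [overwrite]; split
    exacts [hd, hR i]

/-- One value is read in each of the `n` steps and one more by the final bad input. -/
theorem BadIn.exists_finset {X : Type*} [LinearOrder X] {A : Set X} {n p} {R : I → X}
    (hb : S.BadIn A n p R) :
    ∃ V : Finset X, V.card ≤ n + 1 ∧ (V : Set X) ⊆ A ∧ S.BadIn (V : Set X) n p R := by
  classical
  induction hb with
  | @bad p R d hd hs =>
    exact ⟨{d}, by simp, by simpa using hd, .bad (by simp) hs⟩
  | @step n p R d w p' hd hs _ ih =>
    obtain ⟨V, hc, hA, hb⟩ := ih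
    refine ⟨insert d V, (Finset.card_insert_le _ _).trans (by omega), ?_, ?_⟩
    · rw [Finset.coe_insert]; exact Set.insert_subset hd hA
    · exact .step (d := d) (by simp) hs (hb.mono (by simp))

end RegSys

/-! ### Short paths in finite graphs -/

/-- There is a path with `n` edges to a target. -/
inductive PathTo {α : Type*} (E : α → α → Prop) (B : α → Prop) : ℕ → α → Prop
  | zero {a} (h : B a) : PathTo E B 0 a
  | succ {n a b} (h : E a b) (hb : PathTo E B n b) : PathTo E B (n + 1) a

/-- The vertices on a shortest path have pairwise different distances to the target, so they are
distinct. -/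
theorem PathTo.exists_lt_card {α : Type*} [Fintype α] {E : α → α → Prop} {B : α → Prop} {n : ℕ}
    {a : α} (h : PathTo E B n a) : ∃ m < Fintype.card α, PathTo E B m a := by
  classical
  have hex : ∃ m, PathTo E B m a := ⟨n, h⟩
  refine ⟨Nat.find hex, ?_, Nat.find_spec hex⟩
  -- From a vertex at distance exactly `m`, every smaller distance is attained exactly by some
  -- vertex on the path.
  have key : ∀ m a, PathTo E B m a → (∀ l < m, ¬ PathTo E B l a) →
      ∀ j ≤ m, ∃ b, PathTo E B j b ∧ ∀ l < j, ¬ PathTo E B l b := by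
    intro m
    induction m with
    | zero => intro a h1 h2 j hj; obtain rfl : j = 0 := by omega
              exact ⟨a, h1, h2⟩
    | succ m ih =>
      intro a h1 h2 j hj
      rcases Nat.lt_or_ge m j with hjm | hjm
      · obtain rfl : j = m + 1 := by omega
        exact ⟨a, h1, h2⟩
      · cases h1 with
        | succ he hb =>
          exact ih _ hb (fun l hl hp => h2 (l + 1) (by omega) (.succ he hp)) j hjm
  have hk := key _ a (Nat.find_spec hex) (fun l hl => Nat.find_min hex hl)
  choose f hf1 hf2 using hk
  have hinj : Function.Injective (fun i : Fin (Nat.find hex + 1) => f i (Nat.lt_succ_iff.1 i.2)) := by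
    intro i j hij
    have hij : f i (Nat.lt_succ_iff.1 i.2) = f j (Nat.lt_succ_iff.1 j.2) := hij
    have hi := hf1 i (Nat.lt_succ_iff.1 i.2)
    have hj := hf1 j (Nat.lt_succ_iff.1 j.2)
    rcases lt_trichotomy (i : ℕ) j with h | h | h
    · exact absurd (hij ▸ hi) (hf2 j _ i h)
    · exact Fin.ext h
    · exact absurd (hij ▸ hj) (hf2 i _ j h)
  have := Fintype.card_le_of_injective _ hinj
  rw [Fintype.card_fin] at this
  omega

/-! ### The symbolic abstraction relative to finitely many marked points -/

section Abstraction

variable {X : Type*} [LinearOrder X]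

/-- The position of a point relative to the points of `F`. -/
def position (F : Finset X) (x : X) : Fin (2 * F.card + 1) :=
  ⟨(F.filter (· < x)).card + (F.filter (· ≤ x)).card, by
    have h1 := Finset.card_filter_le F (· < x)
    have h2 := Finset.card_filter_le F (· ≤ x)
    omega⟩

/-- The position is the sum of two counts, each monotone in the point. Equality of the sums
therefore forces equality of both counts, and hence of the two sets counted. -/
theorem cmp_eq_of_position_eq {F : Finset X} {x y : X} (h : position F x = position F y) {f : X}
    (hf : f ∈ F) : cmp x f = cmp y f := by
  wlog hxy : x ≤ y generalizing x y
  · exact (this h.symm (le_of_not_ge hxy)).symm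
  have hs1 : F.filter (· < x) ⊆ F.filter (· < y) := fun z hz => by
    rw [Finset.mem_filter] at hz ⊢; exact ⟨hz.1, hz.2.trans_le hxy⟩
  have hs2 : F.filter (· ≤ x) ⊆ F.filter (· ≤ y) := fun z hz => by
    rw [Finset.mem_filter] at hz ⊢; exact ⟨hz.1, hz.2.trans hxy⟩
  have hsum := congrArg Fin.val h
  simp only [position] at hsum
  have c1 := Finset.card_le_card hs1
  have c2 := Finset.card_le_card hs2
  have e1 := Finset.eq_of_subset_of_card_le hs1 (by omega)
  have e2 := Finset.eq_of_subset_of_card_le hs2 (by omega)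
  have i1 : f < x ↔ f < y := by
    have := Finset.ext_iff.1 e1 f
    simpa [hf] using this
  have i2 : f ≤ x ↔ f ≤ y := by
    have := Finset.ext_iff.1 e2 f
    simpa [hf] using this
  rcases lt_trichotomy x f with h | h | h
  · rw [(cmp_eq_lt_iff _ _).2 h, eq_comm, cmp_eq_lt_iff]
    exact not_le.1 fun hh => absurd (i2.2 hh) (not_le.2 h)
  · have hy : y = f := le_antisymm (not_lt.1 fun hh => absurd (i1.2 hh) (by rw [h]; exact lt_irrefl _))
      (i2.1 h.ge)
    rw [h, hy]
  · rw [(cmp_eq_gt_iff _ _).2 h, eq_comm, cmp_eq_gt_iff]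
    exact i1.1 h

/-- The one-point extension step of the back-and-forth argument for dense orders without endpoints.
-/
theorem exists_cmp_match {J : Type*} [Finite J] {Y : Type*} [LinearOrder Y] [DenselyOrdered Y]
    [NoMaxOrder Y] [NoMinOrder Y] [Nonempty Y] (g : J → X) (g' : J → Y)
    (hg : orderType g = orderType g') (d : X) : ∃ d', ∀ j, cmp d (g j) = cmp d' (g' j) := by
  classical
  have := Fintype.ofFinite J
  have hcmp : ∀ i j, cmp (g i) (g j) = cmp (g' i) (g' j) := fun i j => congrFun (congrFun hg i) j
  by_cases h : ∃ j, g j = d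
  · obtain ⟨j, rfl⟩ := h
    exact ⟨g' j, fun i => hcmp j i⟩
  · push Not at h
    obtain ⟨d', h1, h2⟩ := Order.exists_between_finsets
      ((Finset.univ.filter (fun j => g j < d)).image g')
      ((Finset.univ.filter (fun j => d < g j)).image g') (by
        intro x hx y hy
        simp only [Finset.mem_image, Finset.mem_filter, Finset.mem_univ, true_and] at hx hy
        obtain ⟨i, hi, rfl⟩ := hx
        obtain ⟨j, hj, rfl⟩ := hy
        rw [← cmp_eq_lt_iff, ← hcmp, cmp_eq_lt_iff]
        exact hi.trans hj)
    refine ⟨d', fun j => ?_⟩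
    rcases lt_trichotomy (g j) d with hj | hj | hj
    · rw [(cmp_eq_gt_iff _ _).2 hj, eq_comm, cmp_eq_gt_iff]
      exact h1 _ (Finset.mem_image.2 ⟨j, by simpa using hj, rfl⟩)
    · exact absurd hj (h j)
    · rw [(cmp_eq_lt_iff _ _).2 hj, eq_comm, cmp_eq_lt_iff]
      exact h2 _ (Finset.mem_image.2 ⟨j, by simpa using hj, rfl⟩)

variable {P I : Type*}

/-- The part of a configuration that is visible relative to the marked points. -/
def abstraction (F : Finset X) (p : P) (R : I → X) :
    P × (I → I → Ordering) × (I → Fin (2 * F.card + 1)) :=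
  (p, orderType R, fun i => position F (R i))

/-- The registers together with the marked points. -/
def withMarks {Y : Type*} (F : Finset X) (f : X → Y) (R : I → Y) : I ⊕ F → Y :=
  Sum.elim R (fun x => f x)

/-- Configurations with the same abstraction are indistinguishable even together with the marks, so
the witness of a symbolic step can replace the configuration at hand. -/
theorem orderType_withMarks_eq {F : Finset X} {p p' : P} {R R' : I → X}
    (h : abstraction F p R = abstraction F p' R') :
    orderType (withMarks F id R) = orderType (withMarks F id R') := by
  simp only [abstraction, Prod.mk.injEq] at h
  obtain ⟨-, h1, h2⟩ := h
  have key : ∀ (i : I) (f : X), f ∈ F → cmp (R i) f = cmp (R' i) f := fun i f hf =>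
    cmp_eq_of_position_eq (congrFun h2 i) hf
  funext i j
  rcases i with i | ⟨f, hf⟩ <;> rcases j with j | ⟨f', hf'⟩
  · exact congrFun (congrFun h1 i) j
  · exact key i f' hf'
  · change cmp f (R j) = cmp f (R' j)
    rw [← cmp_swap, key j f hf, cmp_swap]
  · rfl

namespace RegSys

variable (S : RegSys P I)

/-- The symbolic steps. -/
def SymStep (F : Finset X) (a b : P × (I → I → Ordering) × (I → Fin (2 * F.card + 1))) : Prop :=
  ∃ p R d w p', S.step p (orderType (withInput R d)) w p' ∧ abstraction F p R = a ∧
    abstraction F p' (overwrite w R d) = b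

/-- The symbolic states with a bad input. -/
def SymBad (F : Finset X) (a : P × (I → I → Ordering) × (I → Fin (2 * F.card + 1))) : Prop :=
  ∃ p R d, S.bad p (orderType (withInput R d)) ∧ abstraction F p R = a

variable {S}

theorem BadIn.pathTo (F : Finset X) {A : Set X} {n p R} (h : S.BadIn A n p R) :
    PathTo (S.SymStep F) (S.SymBad F) n (abstraction F p R) := by
  induction h with
  | bad _ h => exact .zero ⟨_, _, _, h, rfl⟩
  | step _ h _ ih => exact .succ ⟨_, _, _, _, _, h, rfl, rfl⟩ ih

/-- Values that respect the empty gaps between marked points. -/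
def avoiding {Y : Type*} [LinearOrder Y] (F : Finset X) (f : X → Y) : Set Y :=
  {y | ∀ a ∈ F, ∀ b ∈ F, Set.Ioo a b = ∅ → ¬ (f a < y ∧ y < f b)}

/-- The input `d` is a point of `X`, so it lies in no empty gap of `F`. Its counterpart `d'`
compares with the images of the marks in the same way and thus avoids the images of the empty gaps.
-/
theorem exists_input_match [Finite I] {Y : Type*} [LinearOrder Y] [DenselyOrdered Y]
    [NoMaxOrder Y] [NoMinOrder Y] [Nonempty Y] {F : Finset X} {f : X → Y} {R : I → X} {R' : I → Y}
    (h : orderType (withMarks F id R) = orderType (withMarks F f R')) (d : X) :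
    ∃ d' ∈ avoiding F f, orderType (withInput R d) = orderType (withInput R' d') ∧
      ∀ w, orderType (withMarks F id (overwrite w R d)) =
        orderType (withMarks F f (overwrite w R' d')) := by
  obtain ⟨d', hd⟩ := exists_cmp_match _ _ h d
  have hI : ∀ i, cmp d (R i) = cmp d' (R' i) := fun i => hd (Sum.inl i)
  have hF : ∀ x (hx : x ∈ F), cmp d x = cmp d' (f x) := fun x hx => hd (Sum.inr ⟨x, hx⟩)
  have hII : ∀ i j, cmp (R i) (R j) = cmp (R' i) (R' j) := fun i j =>
    congrFun (congrFun h (Sum.inl i)) (Sum.inl j)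
  have hIF : ∀ i x (hx : x ∈ F), cmp (R i) x = cmp (R' i) (f x) := fun i x hx =>
    congrFun (congrFun h (Sum.inl i)) (Sum.inr ⟨x, hx⟩)
  have hFF : ∀ x (hx : x ∈ F) y (hy : y ∈ F), cmp x y = cmp (f x) (f y) := fun x hx y hy =>
    congrFun (congrFun h (Sum.inr ⟨x, hx⟩)) (Sum.inr ⟨y, hy⟩)
  refine ⟨d', fun a ha b hb hab hh => ?_, ?_, fun w => ?_⟩
  · have h1 : a < d := by rw [← cmp_eq_gt_iff, hF a ha, cmp_eq_gt_iff]; exact hh.1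
    have h2 : d < b := by rw [← cmp_eq_lt_iff, hF b hb, cmp_eq_lt_iff]; exact hh.2
    exact (Set.ext_iff.1 hab d).1 ⟨h1, h2⟩
  · funext i j
    rcases i with _ | i <;> rcases j with _ | j
    · exact (cmp_self_eq_eq d).trans (cmp_self_eq_eq d').symm
    · exact hI j
    · change cmp (R i) d = cmp (R' i) d'
      rw [← cmp_swap, hI i, cmp_swap]
    · exact hII i j
  · have hIF' : ∀ i x (hx : x ∈ F), cmp (overwrite w R d i) x = cmp (overwrite w R' d' i) (f x) := by
      intro i x hx
      simp only [overwrite]; split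
      exacts [hF x hx, hIF i x hx]
    funext i j
    rcases i with i | ⟨x, hx⟩ <;> rcases j with j | ⟨y, hy⟩
    · change cmp (overwrite w R d i) (overwrite w R d j) =
        cmp (overwrite w R' d' i) (overwrite w R' d' j)
      simp only [overwrite]
      split <;> split
      · rw [cmp_self_eq_eq, cmp_self_eq_eq]
      · exact hI j
      · rw [← cmp_swap, hI i, cmp_swap]
      · exact hII i j
    · exact hIF' i y hy
    · change cmp x (overwrite w R d j) = cmp (f x) (overwrite w R' d' j)
      rw [← cmp_swap, hIF' j x hx, cmp_swap]
    · exact hFF x hx y hy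

/-- Consecutive symbolic steps may be witnessed by unrelated configurations over `X`. Density of `Y`
glues them into one run: the invariant is that the order type of registers and marks agrees with
that of the witness. -/
theorem badIn_of_pathTo [Finite I] {Y : Type*} [LinearOrder Y] [DenselyOrdered Y]
    [NoMaxOrder Y] [NoMinOrder Y] [Nonempty Y] {F : Finset X} {f : X → Y} {n a}
    (h : PathTo (S.SymStep F) (S.SymBad F) n a) :
    ∀ (p : P) (R : I → X) (R' : I → Y), abstraction F p R = a →
      orderType (withMarks F id R) = orderType (withMarks F f R') →
      S.BadIn (avoiding F f) n p R' := by
  induction h with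
  | zero h =>
    intro p R R' ha hR
    obtain ⟨q, T, d, hb, rfl⟩ := h
    have hT := orderType_withMarks_eq ha
    obtain rfl : p = q := congrArg Prod.fst ha
    obtain ⟨d', hd', he, -⟩ := exists_input_match (hT.symm.trans hR) d
    exact .bad hd' (he ▸ hb)
  | succ h _ ih =>
    intro p R R' ha hR
    obtain ⟨q, T, d, w, q', hs, rfl, hb⟩ := h
    have hT := orderType_withMarks_eq ha
    obtain rfl : p = q := congrArg Prod.fst ha
    obtain ⟨d', hd', he, hw⟩ := exists_input_match (hT.symm.trans hR) d
    exact .step hd' (he ▸ hs) (ih q' _ _ hb (hw w))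

end RegSys

end Abstraction

namespace RegSys

/-! ### A bound on the length of shortest bad runs -/

section Bound

variable {P I : Type*} [Fintype P] [Fintype I] {S : RegSys P I}

/-- The number of symbolic states relative to `s` marked points. -/
def symCount (P I : Type*) [Fintype P] [Fintype I] (s : ℕ) : ℕ :=
  Fintype.card P * (3 ^ Fintype.card I ^ 2 * (2 * s + 1) ^ Fintype.card I)

/-- Repeatedly adding the points of a small gap. -/
def fillBound (P I : Type*) [Fintype P] [Fintype I] : ℕ → ℕ → ℕ
  | 0, s => symCount P I s
  | j + 1, s => fillBound P I j (s + symCount P I s)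

theorem symCount_mono {s t : ℕ} (h : s ≤ t) : symCount P I s ≤ symCount P I t := by
  unfold symCount; gcongr

theorem fillBound_mono (j : ℕ) : ∀ {s t : ℕ}, s ≤ t → fillBound P I j s ≤ fillBound P I j t := by
  induction j with
  | zero => exact fun h => symCount_mono h
  | succ j ih => exact fun h => ih (add_le_add h (symCount_mono h))

theorem symCount_le_fillBound (j s : ℕ) : symCount P I s ≤ fillBound P I j s := by
  induction j generalizing s with
  | zero => exact le_rfl
  | succ j ih => exact (symCount_mono (Nat.le_add_right _ _)).trans (ih _)

theorem card_symbolic {X : Type*} (F : Finset X) [DecidableEq I] :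
    Fintype.card (P × (I → I → Ordering) × (I → Fin (2 * F.card + 1))) = symCount P I F.card := by
  have h3 : Fintype.card Ordering = 3 := rfl
  simp only [Fintype.card_prod, Fintype.card_fun, Fintype.card_fin, symCount, h3]
  rw [← pow_mul, ← sq]

variable {X : Type*} [LinearOrder X] [NoMaxOrder X] [NoMinOrder X] [Nonempty X]

/-- The run is abstracted, shortened to a symbolic path without repetitions, realized over ℚ, and
pulled back to `X`. The gap condition is exactly what the pullback needs: the realization avoids
empty gaps and uses at most `symCount` values, so large gaps have room for them. -/
theorem BadIn.exists_lt_symCount {F : Finset X} {p : P} {R : I → X} (hR : ∀ i, R i ∈ F)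
    (hgap : ∀ a ∈ F, ∀ b ∈ F, a < b → (∀ c ∈ F, ¬ (a < c ∧ c < b)) →
      Set.Ioo a b = ∅ ∨ (symCount P I F.card : ℕ∞) ≤ (Set.Ioo a b).encard)
    {n : ℕ} (hb : S.BadIn (Set.univ : Set X) n p R) :
    ∃ m < symCount P I F.card, S.BadIn (Set.univ : Set X) m p R := by
  classical
  -- With no points prescribed, the extension theorem just embeds the marks into ℚ.
  obtain ⟨f, hf, -⟩ := exists_strictMonoOn_extend (Y := ℚ) F _ ∅ rfl (by simp) (fun _ => 0)
    (by intro a ha; simp at ha) (by simp [GapRoom])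
  obtain ⟨m, hm, hpath⟩ := (hb.pathTo F).exists_lt_card
  rw [card_symbolic] at hm
  refine ⟨m, hm, ?_⟩
  have hmarks : withMarks F f (f ∘ R) = f ∘ withMarks F id R := by
    funext j; rcases j with j | j <;> rfl
  have hQ := badIn_of_pathTo (Y := ℚ) (f := f) hpath p R (f ∘ R) rfl (by
    rw [hmarks]
    refine (orderType_comp hf ?_).symm
    rintro (i | x)
    exacts [hR i, x.2])
  obtain ⟨V, hVc, hVA, hV⟩ := hQ.exists_finset
  -- The way back is fixed on the images of the marks by the inverse of `f` and is then extended to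
  -- the values `V` of the run.
  let g := Function.invFunOn f (F : Set X)
  have hg : ∀ x ∈ F, g (f x) = x := fun x hx => hf.injOn.leftInvOn_invFunOn hx
  have hmem : ∀ y ∈ F.image f, ∃ x ∈ F, f x = y := fun y hy => by simpa using hy
  obtain ⟨h, hh, he⟩ := exists_strictMonoOn_extend (V ∪ F.image f) _ (F.image f) rfl
    Finset.subset_union_right g (by
      intro a ha b hb hab
      obtain ⟨x, hx, rfl⟩ := hmem a ha
      obtain ⟨y, hy, rfl⟩ := hmem b hb
      rw [hg x hx, hg y hy]
      exact (hf.lt_iff_lt hx hy).1 hab) (by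
      intro a ha b hb hab hcons
      obtain ⟨x, hx, rfl⟩ := hmem a ha
      obtain ⟨y, hy, rfl⟩ := hmem b hb
      rw [hg x hx, hg y hy]
      have hsub : (V ∪ F.image f).filter (fun v => f x < v ∧ v < f y) ⊆
          V.filter (fun v => f x < v ∧ v < f y) := fun v hv => by
        rw [Finset.mem_filter, Finset.mem_union] at hv
        rcases hv.1 with h | h
        · exact Finset.mem_filter.2 ⟨h, hv.2⟩
        · exact absurd hv.2 (hcons v h)
      refine le_trans (Nat.cast_le.2 (Finset.card_le_card hsub)) ?_
      rcases hgap x hx y hy ((hf.lt_iff_lt hx hy).1 hab) (fun c hc hh =>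
        hcons (f c) (Finset.mem_image_of_mem _ hc)
          ⟨(hf.lt_iff_lt hx hc).2 hh.1, (hf.lt_iff_lt hc hy).2 hh.2⟩) with h0 | h0
      -- An empty gap needs no room, because the run over ℚ avoids its image.
      · have : V.filter (fun v => f x < v ∧ v < f y) = ∅ :=
          Finset.filter_eq_empty_iff.2 fun v hv => hVA hv x hx y hy h0
        rw [this]; simp
      · refine le_trans (Nat.cast_le.2 ?_) h0
        exact (Finset.card_filter_le _ _).trans (by omega))
  have hfin := (hV.mono (B := ((V ∪ F.image f : Finset ℚ) : Set ℚ)) (by simp)).map (h := h)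
    (B := Set.univ) hh (fun _ _ => trivial) (fun i => by
      simp only [Finset.coe_union, Set.mem_union]
      exact Or.inr (Finset.mem_image_of_mem f (hR i)))
  have : h ∘ f ∘ R = R := by
    funext i
    exact (he _ (Finset.mem_image_of_mem f (hR i))).trans (hg _ (hR i))
  rwa [this] at hfin

open Classical in
/-- The pairs of consecutive marked points with a point in between. -/
noncomputable def openGaps (F : Finset X) : Finset (X × X) :=
  (F ×ˢ F).filter fun q => q.1 < q.2 ∧ (∀ c ∈ F, ¬ (q.1 < c ∧ c < q.2)) ∧
    (Set.Ioo q.1 q.2).Nonempty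

/-- Induction on the number of nonempty gaps. If every gap is empty or large, the previous bound
applies. Otherwise a nonempty gap with fewer than `symCount` points exists; marking all its points
splits it into empty gaps and leaves the other gaps alone. -/
theorem BadIn.exists_lt_fillBound (j : ℕ) : ∀ {F : Finset X} {p : P} {R : I → X},
    (∀ i, R i ∈ F) → (openGaps F).card ≤ j → ∀ {n : ℕ}, S.BadIn (Set.univ : Set X) n p R →
    ∃ m < fillBound P I j F.card, S.BadIn (Set.univ : Set X) m p R := by
  classical
  induction j with
  | zero =>
    intro F p R hR hj n hb
    refine BadIn.exists_lt_symCount hR (fun a ha b hb hab hc => Or.inl ?_) hb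
    by_contra hne
    have : (a, b) ∈ openGaps F := by
      simp only [openGaps, Finset.mem_filter, Finset.mem_product]
      exact ⟨⟨ha, hb⟩, hab, hc, Set.nonempty_iff_ne_empty.2 hne⟩
    have := Finset.card_pos.2 ⟨_, this⟩
    omega
  | succ j ih =>
    intro F p R hR hj n hb
    by_cases hgap : ∀ a ∈ F, ∀ b ∈ F, a < b → (∀ c ∈ F, ¬ (a < c ∧ c < b)) →
      Set.Ioo a b = ∅ ∨ (symCount P I F.card : ℕ∞) ≤ (Set.Ioo a b).encard
    · obtain ⟨m, hm, h⟩ := BadIn.exists_lt_symCount hR hgap hb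
      exact ⟨m, hm.trans_le (symCount_le_fillBound _ _), h⟩
    · push Not at hgap
      obtain ⟨a, ha, b, hb', hab, hc, hne, hlt⟩ := hgap
      have hfin : (Set.Ioo a b).Finite := Set.finite_of_encard_le_coe hlt.le
      obtain ⟨G, hG⟩ := hfin.exists_finset_coe
      have hGm : ∀ x, x ∈ G ↔ a < x ∧ x < b := fun x => by
        rw [← Finset.mem_coe, hG]; rfl
      rw [← hG, Set.encard_coe_eq_coe_finsetCard, Nat.cast_lt] at hlt
      -- A nonempty gap of the larger set has no endpoint in `G`: the other end would still lie
      -- between `a` and `b` inclusive, so a point inside the gap would belong to `G` and be marked.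
      have hgaps : openGaps (F ∪ G) ⊆ (openGaps F).erase (a, b) := by
        rintro ⟨x, y⟩ hxy
        simp only [openGaps, Finset.mem_filter, Finset.mem_product, Finset.mem_union] at hxy
        obtain ⟨⟨hx, hy⟩, hlt, hcons, z, hz⟩ := hxy
        have hzG : z ∉ G := fun h => hcons z (Or.inr h) hz
        have hxF : x ∈ F := by
          rcases hx with hx | hx
          · exact hx
          · exfalso
            have hx' := (hGm x).1 hx
            have : y ≤ b := not_lt.1 fun h => hcons b (Or.inl hb') ⟨hx'.2, h⟩
            exact hzG ((hGm z).2 ⟨hx'.1.trans hz.1, hz.2.trans_le this⟩)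
        have hyF : y ∈ F := by
          rcases hy with hy | hy
          · exact hy
          · exfalso
            have hy' := (hGm y).1 hy
            have : a ≤ x := not_lt.1 fun h => hcons a (Or.inl ha) ⟨h, hy'.1⟩
            exact hzG ((hGm z).2 ⟨this.trans_lt hz.1, hz.2.trans hy'.2⟩)
        rw [Finset.mem_erase]
        refine ⟨?_, ?_⟩
        · rintro ⟨⟩
          exact hzG ((hGm z).2 hz)
        · simp only [openGaps, Finset.mem_filter, Finset.mem_product]
          exact ⟨⟨hxF, hyF⟩, hlt, fun c hc => hcons c (Or.inl hc), z, hz⟩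
      have hmem : (a, b) ∈ openGaps F := by
        simp only [openGaps, Finset.mem_filter, Finset.mem_product]
        exact ⟨⟨ha, hb'⟩, hab, fun c hcF h => absurd h.2 (not_lt.2 (hc c hcF h.1)), hne⟩
      have hcard := Finset.card_le_card hgaps
      rw [Finset.card_erase_of_mem hmem] at hcard
      obtain ⟨m, hm, h⟩ := ih (F := F ∪ G) (fun i => Finset.mem_union_left _ (hR i)) (by omega) hb
      refine ⟨m, hm.trans_le (fillBound_mono j ?_), h⟩
      exact (Finset.card_union_le _ _).trans (by omega)

/-- A reachable bad input can be reached within a number of steps that does not depend on the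
initial values. -/
theorem BadIn.exists_lt_bound {p : P} {R : I → X} {n : ℕ}
    (hb : S.BadIn (Set.univ : Set X) n p R) :
    ∃ m < fillBound P I (Fintype.card I ^ 2) (Fintype.card I),
      S.BadIn (Set.univ : Set X) m p R := by
  classical
  have hc : (Finset.univ.image R).card ≤ Fintype.card I := Finset.card_image_le
  -- The marks are the initial values, at most |I| of them, so there are at most |I|² pairs that can
  -- form a gap.
  obtain ⟨m, hm, h⟩ := BadIn.exists_lt_fillBound (Fintype.card I ^ 2) (F := Finset.univ.image R)
    (fun i => Finset.mem_image_of_mem _ (Finset.mem_univ i)) (by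
      refine (Finset.card_filter_le _ _).trans ?_
      rw [Finset.card_product, ← sq]
      exact Nat.pow_le_pow_left hc 2) hb
  exact ⟨m, hm.trans_le (fillBound_mono _ hc), h⟩

end Bound

end RegSys

/-! ### The numerical size of the step bound -/

namespace RegSys

/-- Bounds are kept as powers of one base `Z`. If 2s + 1 ≤ Z ^ e, then one round of filling
multiplies the exponent `e` by at most |I| + 3, since `symCount` is at most Z · (Z ^ e) ^ |I|. -/
theorem fillBound_le_pow (P I : Type*) [Fintype P] [Fintype I] {Z : ℕ} (hZ : 3 ≤ Z)
    (hP : Fintype.card P * 3 ^ Fintype.card I ^ 2 ≤ Z) (j : ℕ) : ∀ (s e : ℕ), 1 ≤ e →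
    2 * s + 1 ≤ Z ^ e → fillBound P I j s ≤ Z ^ (e * (Fintype.card I + 3) ^ (j + 1)) := by
  have hZ1 : 1 ≤ Z := by omega
  have hsym : ∀ s e, 2 * s + 1 ≤ Z ^ e → symCount P I s ≤ Z ^ (1 + e * Fintype.card I) := by
    intro s e hs
    rw [symCount, ← mul_assoc, pow_add, pow_one, pow_mul]
    exact Nat.mul_le_mul hP (Nat.pow_le_pow_left hs _)
  induction j with
  | zero =>
    intro s e he hs
    refine (hsym s e hs).trans (Nat.pow_le_pow_right hZ1 ?_)
    rw [zero_add, pow_one]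
    nlinarith
  | succ j ih =>
    intro s e he hs
    have h := ih (s + symCount P I s) (e * (Fintype.card I + 3)) (by nlinarith) (by
      have h1 := hsym s e hs
      have h2 : Z ^ (1 + e * Fintype.card I) ≤ Z ^ (1 + e * Fintype.card I + e) :=
        Nat.pow_le_pow_right hZ1 (by omega)
      have h3 : Z ^ e ≤ Z ^ (1 + e * Fintype.card I + e) :=
        Nat.pow_le_pow_right hZ1 (by omega)
      calc 2 * (s + symCount P I s) + 1 ≤ 3 * Z ^ (1 + e * Fintype.card I + e) := by omega
        _ ≤ Z * Z ^ (1 + e * Fintype.card I + e) := Nat.mul_le_mul_right _ hZ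
        _ = Z ^ (1 + (1 + e * Fintype.card I + e)) := by rw [pow_add Z 1, pow_one]
        _ ≤ _ := Nat.pow_le_pow_right hZ1 (by nlinarith))
    refine h.trans_eq ?_
    rw [mul_assoc, ← pow_succ']

end RegSys

/-- The number of values that suffices for transducers of size `n`. -/
def valueBound (n : ℕ) : ℕ := 2 ^ 2 ^ (n + 3) ^ 6

/-- With a = n + 3, the base is Z = 2 ^ a ^ 4, and at most 4k² + 1 rounds give an exponent below 2 ^
a ^ 5. The summand k + 1, which makes room for the initial values, is absorbed in the passage from a
^ 5 to a ^ 6. -/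
theorem fillBound_add_le_valueBound {n q k : ℕ} (hq : q ≤ 2 ^ n) (hk : k ≤ n) :
    RegSys.fillBound (Fin q × Fin q) (Fin k ⊕ Fin k) (Fintype.card (Fin k ⊕ Fin k) ^ 2)
      (Fintype.card (Fin k ⊕ Fin k)) + k + 1 ≤ valueBound n := by
  have hI : Fintype.card (Fin k ⊕ Fin k) = 2 * k := by simp; ring
  have hPc : Fintype.card (Fin q × Fin q) = q * q := by simp
  obtain ⟨a, rfl⟩ : ∃ a, a = n + 3 := ⟨_, rfl⟩
  set a := n + 3 with ha
  have ha3 : 3 ≤ a := by omega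
  have two : 1 ≤ 2 := by norm_num
  have hexp : 2 * n + 2 * (2 * n) ^ 2 + 2 * n + 3 ≤ a ^ 4 := by
    rw [ha]; ring_nf; nlinarith [sq_nonneg n]
  have hPZ : (q * q) * 3 ^ (2 * k) ^ 2 ≤ 2 ^ a ^ 4 := by
    calc (q * q) * 3 ^ (2 * k) ^ 2 ≤ (2 ^ n * 2 ^ n) * (2 ^ 2) ^ (2 * n) ^ 2 := by
          refine Nat.mul_le_mul (Nat.mul_le_mul hq hq) ?_
          refine (Nat.pow_le_pow_left (by norm_num) _).trans (Nat.pow_le_pow_right (by norm_num) ?_)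
          exact Nat.pow_le_pow_left (by omega) _
      _ = 2 ^ (2 * n + 2 * (2 * n) ^ 2) := by rw [← pow_mul, ← pow_add, ← pow_add]; ring_nf
      _ ≤ _ := Nat.pow_le_pow_right two (by omega)
  have hsZ : 2 * (2 * k) + 1 ≤ (2 ^ a ^ 4) ^ 1 := by
    rw [pow_one]
    have h1 : 2 * n + 2 < 2 ^ (2 * n + 2) := Nat.lt_two_pow_self
    have h2 : 2 ^ (2 * n + 2) * 2 ≤ 2 ^ a ^ 4 := by
      rw [← pow_succ]; exact Nat.pow_le_pow_right two (by omega)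
    omega
  have hZ3 : 3 ≤ 2 ^ a ^ 4 := by
    calc 3 ≤ 2 ^ 2 := by norm_num
      _ ≤ _ := Nat.pow_le_pow_right two (by omega)
  have h := RegSys.fillBound_le_pow (Fin q × Fin q) (Fin k ⊕ Fin k) hZ3
    (by rw [hI, hPc]; exact hPZ) ((2 * k) ^ 2) (2 * k) 1 le_rfl hsZ
  rw [hI] at h ⊢
  -- The exponent is at most 2 ^ (4a + 8a³), and 4a + 8a³ ≤ a ^ 5 because a ≥ 3.
  have h5 : a ^ 4 * (1 * (2 * k + 3) ^ ((2 * k) ^ 2 + 1)) ≤ 2 ^ (a ^ 5) := by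
    have e1 : a ^ 4 ≤ 2 ^ (4 * a) := by
      rw [mul_comm, pow_mul]; exact Nat.pow_le_pow_left Nat.lt_two_pow_self.le _
    have e2 : (2 * k + 3) ^ ((2 * k) ^ 2 + 1) ≤ 2 ^ ((2 * a) * (4 * a ^ 2)) := by
      rw [pow_mul]
      refine (Nat.pow_le_pow_left (m := 2 ^ (2 * a)) ?_ _).trans
        (Nat.pow_le_pow_right Nat.one_le_two_pow ?_)
      · exact (by omega : 2 * k + 3 ≤ 2 * a).trans Nat.lt_two_pow_self.le
      · have : k ≤ a := by omega
        have h1 : (2 * k) ^ 2 + 1 ≤ (2 * n) ^ 2 + 1 :=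
          Nat.add_le_add_right (Nat.pow_le_pow_left (by omega) 2) 1
        have h2 : (2 * n) ^ 2 + 1 ≤ 4 * a ^ 2 := by rw [ha]; ring_nf; omega
        exact h1.trans h2
    calc _ ≤ 2 ^ (4 * a) * 2 ^ ((2 * a) * (4 * a ^ 2)) := by
          rw [one_mul]; exact Nat.mul_le_mul e1 e2
      _ = 2 ^ (4 * a + (2 * a) * (4 * a ^ 2)) := (pow_add _ _ _).symm
      _ ≤ _ := Nat.pow_le_pow_right two (by
        have s1 : 9 ≤ a ^ 2 := by nlinarith
        have s2 : 9 * a ^ 3 ≤ a ^ 5 := by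
          calc 9 * a ^ 3 ≤ a ^ 2 * a ^ 3 := Nat.mul_le_mul_right _ s1
            _ = a ^ 5 := by ring
        have s3 : 9 * a ≤ a ^ 3 := by
          calc 9 * a ≤ a ^ 2 * a := Nat.mul_le_mul_right _ s1
            _ = a ^ 3 := by ring
        nlinarith)
  have h6 : RegSys.fillBound (Fin q × Fin q) (Fin k ⊕ Fin k) ((2 * k) ^ 2) (2 * k) ≤
      2 ^ 2 ^ a ^ 5 := by
    refine h.trans ?_
    rw [← pow_mul]
    exact Nat.pow_le_pow_right two h5
  have h7 : k + 1 ≤ 2 ^ 2 ^ a ^ 5 := by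
    have h1 : k + 1 ≤ a ^ 5 := (by omega : k + 1 ≤ a).trans (Nat.le_self_pow (by norm_num) a)
    exact h1.trans (Nat.lt_two_pow_self.le.trans Nat.lt_two_pow_self.le)
  have h8 : 2 ^ 2 ^ a ^ 5 * 2 ≤ valueBound n := by
    rw [valueBound, ← ha, ← pow_succ]
    refine Nat.pow_le_pow_right two ?_
    have : 2 ^ a ^ 5 * 2 ≤ 2 ^ a ^ 6 := by
      rw [← pow_succ]
      refine Nat.pow_le_pow_right two ?_
      have : 1 ≤ a ^ 5 := Nat.one_le_pow _ _ (by omega)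
      calc a ^ 5 + 1 ≤ a ^ 5 * 3 := by omega
        _ ≤ a ^ 5 * a := Nat.mul_le_mul_left _ ha3
        _ = a ^ 6 := by ring
    have := Nat.one_le_two_pow (n := a ^ 5)
    omega
  omega

/-! ### Pairs of runs on the same input -/

section Pair

variable {Sig Gam Q : Type*} {k : ℕ}

/-- The place from which the output value of `τ` is taken. -/
def Transition.outPlace {J : Type*} (τ : Transition Sig Gam Q k) (emb : Fin k → J) : Option J :=
  match τ.update τ.out with
  | .new => none
  | _ => some (emb τ.out)

/-- The guards of `τ₁` and `τ₂` hold, in states `p`, for the same input. -/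
def Enabled₂ (τ₁ τ₂ : Transition Sig Gam Q k) (p : Q × Q)
    (ty : Option (Fin k ⊕ Fin k) → Option (Fin k ⊕ Fin k) → Ordering) : Prop :=
  τ₁.inLabel = τ₂.inLabel ∧ τ₁.src = p.1 ∧ τ₂.src = p.2 ∧
    (∀ i, ty none (some (.inl i)) = τ₁.guard i) ∧ (∀ i, ty none (some (.inr i)) = τ₂.guard i)

/-- The register system of two copies of a transducer that read the same input. -/
def pairSys (T : Set (Transition Sig Gam Q k)) : RegSys (Q × Q) (Fin k ⊕ Fin k) where
  step p ty w p' := ∃ τ₁ ∈ T, ∃ τ₂ ∈ T, Enabled₂ τ₁ τ₂ p ty ∧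
    (∀ i, w (.inl i) = true ↔ τ₁.update i = .new) ∧
    (∀ i, w (.inr i) = true ↔ τ₂.update i = .new) ∧ p' = (τ₁.tgt, τ₂.tgt)
  bad p ty := ∃ τ₁ ∈ T, ∃ τ₂ ∈ T, Enabled₂ τ₁ τ₂ p ty ∧
    (τ₁.outLabel ≠ τ₂.outLabel ∨ ty (τ₁.outPlace .inl) (τ₂.outPlace .inr) ≠ .eq)

variable {D : Type*}

/-- This is where the absence of `add` enters: an update is then merely a choice of the registers to
overwrite. -/
theorem Transition.apply_eq_overwrite [Add D] {τ : Transition Sig Gam Q k}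
    (h : ∀ i, τ.update i = .old ∨ τ.update i = .new) {J : Type*} {w : J → Bool} {emb : Fin k → J}
    (hw : ∀ i, w (emb i) = true ↔ τ.update i = .new) (R : J → D) (d : D) (i : Fin k) :
    (τ.update i).apply (R (emb i)) d = overwrite w R d (emb i) := by
  rcases h i with h | h
  · have h' : ¬ w (emb i) = true := by rw [hw, h]; nofun
    simp [overwrite, h, h', Update.apply]
  · have h' : w (emb i) = true := by rw [hw, h]
    simp [overwrite, h, h', Update.apply]

theorem Transition.apply_eq_outPlace [Add D] {τ : Transition Sig Gam Q k}
    (h : ∀ i, τ.update i = .old ∨ τ.update i = .new) {J : Type*} (emb : Fin k → J)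
    (R : J → D) (d : D) :
    (τ.update τ.out).apply (R (emb τ.out)) d = withInput R d (τ.outPlace emb) := by
  rcases h τ.out with h | h <;> simp [h, Update.apply, outPlace, withInput]

variable [LinearOrder D] [Add D] {S : SRT Sig Gam D Q k}

/-- While the output letters agree, the two runs make one joint step. At the first letter where they
differ, the input is bad for the pair. -/
theorem SRT.Run.exists_badIn (hS : S.AddFree) {s : List (Sig × D)} :
    ∀ {t t' : List (Gam × D)}, t.length = s.length → t'.length = s.length → t ≠ t' →
    ∀ {q q' : Q} {R R' : Fin k → D} {c c'}, S.Run (q, R) (s.zip t) c → S.Run (q', R') (s.zip t') c' →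
    ∃ n, (pairSys S.trans).BadIn (Set.univ : Set D) n (q, q') (Sum.elim R R') := by
  classical
  induction s with
  | nil => intro t t' h h' hne; simp_all
  | cons a s ih =>
    intro t t' h h' hne q q' R R' c c' hr hr'
    obtain ⟨b, t, rfl⟩ := List.exists_cons_of_ne_nil (List.ne_nil_of_length_eq_add_one h)
    obtain ⟨b', t', rfl⟩ := List.exists_cons_of_ne_nil (List.ne_nil_of_length_eq_add_one h')
    rw [List.zip_cons_cons] at hr hr'
    cases hr with
    | @cons _ c₁ _ _ _ _ τ hτ he hV =>
    cases hr' with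
    | @cons _ c₁' _ _ _ _ τ' hτ' he' hV' =>
    obtain ⟨e1, e2, e3, e4, e5, e6⟩ := he
    obtain ⟨e1', e2', e3', e4', e5', e6'⟩ := he'
    have hen : Enabled₂ τ τ' (q, q') (orderType (withInput (Sum.elim R R') a.2)) :=
      ⟨e2.trans e2'.symm, e1, e1', e3, e3'⟩
    by_cases hb : b = b'
    · subst hb
      let w : Fin k ⊕ Fin k → Bool := Sum.elim (fun i => decide (τ.update i = .new))
        (fun i => decide (τ'.update i = .new))
      have hw : overwrite w (Sum.elim R R') a.2 = Sum.elim c₁.2 c₁'.2 := by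
        funext j
        rcases j with i | i
        · rw [Sum.elim_inl, e4 i]
          exact (Transition.apply_eq_overwrite (hS τ hτ) (w := w) (emb := Sum.inl) (by simp [w])
            (Sum.elim R R') a.2 i).symm
        · rw [Sum.elim_inr, e4' i]
          exact (Transition.apply_eq_overwrite (hS τ' hτ') (w := w) (emb := Sum.inr) (by simp [w])
            (Sum.elim R R') a.2 i).symm
      obtain ⟨n, hn⟩ := ih (t := t) (t' := t') (by simpa using h) (by simpa using h')
        (by rintro rfl; exact hne rfl) (q := c₁.1) (q' := c₁'.1) (R := c₁.2) (R' := c₁'.2) hV hV'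
      exact ⟨n + 1, .step (d := a.2) (w := w) trivial
        ⟨τ, hτ, τ', hτ', hen, by simp [w], by simp [w], rfl⟩ (by rw [hw, ← e6, ← e6']; exact hn)⟩
    · refine ⟨0, .bad (d := a.2) trivial ⟨τ, hτ, τ', hτ', hen, ?_⟩⟩
      rw [e5, e5', Prod.mk.injEq, not_and_or] at hb
      refine hb.imp id fun hb => ?_
      rw [e4, e4'] at hb
      intro heq
      refine hb ?_
      have h1 := Transition.apply_eq_outPlace (hS τ hτ) Sum.inl (Sum.elim R R') a.2
      have h2 := Transition.apply_eq_outPlace (hS τ' hτ') Sum.inr (Sum.elim R R') a.2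
      rw [Sum.elim_inl] at h1
      rw [Sum.elim_inr] at h2
      rw [h1, h2]
      exact (cmp_eq_eq_iff _ _).1 heq

/-- The control component and the two halves of the registers are unzipped into two runs on the same
input word. -/
theorem RegSys.BadIn.exists_run (hS : S.AddFree) {n : ℕ} {p : Q × Q} {T : Fin k ⊕ Fin k → D}
    (h : (pairSys S.trans).BadIn (Set.univ : Set D) n p T) :
    ∃ (s : List (Sig × D)) (t t' : List (Gam × D)), t.length = s.length ∧ t'.length = s.length ∧
      t ≠ t' ∧ (∃ c, S.Run (p.1, T ∘ .inl) (s.zip t) c) ∧ ∃ c, S.Run (p.2, T ∘ .inr) (s.zip t') c := by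
  induction h with
  | @bad p T d _ hb =>
    obtain ⟨τ, hτ, τ', hτ', ⟨h1, h2, h3, h4, h5⟩, hne⟩ := hb
    refine ⟨[(τ.inLabel, d)], [(τ.outLabel, (τ.update τ.out).apply (T (.inl τ.out)) d)],
      [(τ'.outLabel, (τ'.update τ'.out).apply (T (.inr τ'.out)) d)], rfl, rfl, ?_,
      ⟨(τ.tgt, fun i => (τ.update i).apply (T (.inl i)) d),
        .cons τ hτ ⟨h2, rfl, h4, fun _ => rfl, rfl, rfl⟩ (.nil _)⟩,
      ⟨(τ'.tgt, fun i => (τ'.update i).apply (T (.inr i)) d),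
        .cons τ' hτ' ⟨h3, h1.symm, h5, fun _ => rfl, rfl, rfl⟩ (.nil _)⟩⟩
    intro heq
    rw [List.cons.injEq, Prod.mk.injEq] at heq
    rcases hne with hne | hne
    · exact hne heq.1.1
    · refine hne ((cmp_eq_eq_iff _ _).2 ?_)
      rw [← Transition.apply_eq_outPlace (hS τ hτ), ← Transition.apply_eq_outPlace (hS τ' hτ')]
      exact heq.1.2
  | @step n p T d w p' _ hst _ ih =>
    obtain ⟨s, t, t', hl, hl', hne, ⟨c, hr⟩, c', hr'⟩ := ih
    obtain ⟨τ, hτ, τ', hτ', ⟨h1, h2, h3, h4, h5⟩, hw, hw', rfl⟩ := hst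
    -- The output words differ because their tails do; whether the new first letters agree is
    -- irrelevant.
    refine ⟨(τ.inLabel, d) :: s, (τ.outLabel, overwrite w T d (.inl τ.out)) :: t,
      (τ'.outLabel, overwrite w T d (.inr τ'.out)) :: t', by simp [hl], by simp [hl'],
      fun heq => hne (List.cons.inj heq).2,
      ⟨c, .cons τ hτ ⟨h2, rfl, h4, fun i => ?_, rfl, rfl⟩ hr⟩,
      ⟨c', .cons τ' hτ' ⟨h3, h1.symm, h5, fun i => ?_, rfl, rfl⟩ hr'⟩⟩
    · exact (Transition.apply_eq_overwrite (hS τ hτ) hw T d i).symm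
    · exact (Transition.apply_eq_overwrite (hS τ' hτ') hw' T d i).symm

theorem SRT.not_functional_iff (hS : S.AddFree) :
    ¬ FunctionalTransformation S.transformation ↔
      ∃ n, (pairSys S.trans).BadIn (Set.univ : Set D) n (S.start, S.start)
        (Sum.elim S.init S.init) := by
  constructor
  · intro h
    simp only [FunctionalTransformation, Set.Subsingleton, not_forall] at h
    obtain ⟨s, t, ⟨h1, c, h2⟩, t', ⟨h1', c', h2'⟩, hne⟩ := h
    exact Run.exists_badIn hS h1 h1' hne h2 h2'
  · rintro ⟨n, h⟩ hf
    obtain ⟨s, t, t', h1, h1', hne, hr, hr'⟩ := h.exists_run hS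
    exact hne (hf s ⟨h1, hr⟩ ⟨h1', hr'⟩)

end Pair

/-! ### Linear groups and their gaps -/

section LinearGroup

variable {D : Type*} [AddGroup D] [LinearOrder D]

/-- The number of multiples of the least positive element, at most `N`, that fit between
`x` and `y`. -/
noncomputable def gap (N : ℕ) (x y : D) : ℕ :=
  if x < y then ((Finset.range N).filter fun t => x + (t + 1) • unitElement D ≤ y).card else 0

/-- The numbers `a` and `b` can stand for two values whose gaps are `g` and `g'`. -/
def GapCompatible (g a b : ℕ) : Prop := (g = 0 → b ≤ a) ∧ (0 < g → a < b ∧ b ≤ a + g)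

theorem lt_of_gap_pos {N : ℕ} {x y : D} (h : 0 < gap N x y) : x < y := by
  by_contra hn
  rw [gap, if_neg hn] at h
  exact absurd h (lt_irrefl _)

variable [AddLeftMono D]

/-- If x < y, then -x + y is positive. When a least positive element exists, it is at most -x + y,
and translating back gives x + e ≤ y. When nothing lies between x and y, translation shows that -x +
y is itself the least positive element. -/
theorem unitElement_cases :
    (0 < unitElement D ∧ ∀ x y : D, x < y → x + unitElement D ≤ y) ∨
      (unitElement D = 0 ∧ ∀ x y : D, x < y → ∃ z, x < z ∧ z < y) := by
  have hpos : ∀ x y : D, x < y → 0 < -x + y := fun x y h => by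
    have := add_lt_add_right h (-x)
    rwa [neg_add_cancel] at this
  by_cases h : ∃ e : D, IsLeast {x | 0 < x} e
  · left
    have he : IsLeast {x : D | 0 < x} (unitElement D) := by
      rw [unitElement, dif_pos h]; exact h.choose_spec
    refine ⟨he.1, fun x y hxy => ?_⟩
    have := add_le_add_right (he.2 (hpos x y hxy)) x
    rwa [add_neg_cancel_left] at this
  · right
    refine ⟨by rw [unitElement, dif_neg h], fun x y hxy => ?_⟩
    by_contra hno
    push Not at hno
    refine h ⟨-x + y, hpos x y hxy, fun z hz => ?_⟩
    have h1 := hno (x + z) (by simpa using add_lt_add_right (show (0 : D) < z from hz) x)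
    have := add_le_add_right h1 (-x)
    rwa [neg_add_cancel_left] at this

theorem unitElement_nonneg : (0 : D) ≤ unitElement D := by
  rcases unitElement_cases (D := D) with h | h
  exacts [h.1.le, h.1.ge]

theorem add_nsmul_unitElement_mono (x : D) : Monotone fun t : ℕ => x + t • unitElement D := by
  refine monotone_nat_of_le_succ fun t => ?_
  rw [succ_nsmul, ← add_assoc]
  simpa using add_le_add_right (unitElement_nonneg (D := D)) (x + t • unitElement D)

/-- The multiples of a nonnegative element increase, so the indices counted in `gap` form an initial
segment. Together with `le_of_le_gap` this says that, up to `N`, the gap is the largest number of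
units that fit. -/
theorem le_gap_of_le {N s : ℕ} {x y : D} (hxy : x < y) (hs : s ≤ N)
    (h : x + s • unitElement D ≤ y) : s ≤ gap N x y := by
  rw [gap, if_pos hxy]
  calc s = (Finset.range s).card := (Finset.card_range s).symm
    _ ≤ _ := Finset.card_le_card fun t ht => by
      rw [Finset.mem_range] at ht
      rw [Finset.mem_filter, Finset.mem_range]
      exact ⟨by omega, (add_nsmul_unitElement_mono x (show t + 1 ≤ s by omega)).trans h⟩

theorem le_of_le_gap {N s : ℕ} {x y : D} (hxy : x < y) (h : s ≤ gap N x y) :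
    x + s • unitElement D ≤ y := by
  rcases s with _ | s
  · simpa using hxy.le
  · rw [gap, if_pos hxy] at h
    by_contra hn
    have hsub : (Finset.range N).filter (fun t => x + (t + 1) • unitElement D ≤ y) ⊆
        Finset.range s := fun t ht => by
      rw [Finset.mem_filter] at ht
      rw [Finset.mem_range]
      by_contra hts
      exact hn ((add_nsmul_unitElement_mono x (show s + 1 ≤ t + 1 by omega)).trans ht.2)
    have := Finset.card_le_card hsub
    rw [Finset.card_range] at this
    omega

/-- In the dense case the unit is 0, all `N` multiples fit, and the gap takes its largest value `N`.
-/
theorem gap_pos {N : ℕ} (hN : 0 < N) {x y : D} (hxy : x < y) : 0 < gap N x y := by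
  refine le_gap_of_le hxy hN ?_
  rcases unitElement_cases (D := D) with h | h
  · simpa using h.2 x y hxy
  · simpa [h.1] using hxy.le

/-- Each point of `T` accounts for one unit: removing the largest point `z` leaves points in [x, z),
and z + e ≤ y. In the dense case the claim is x ≤ y. -/
theorem add_card_nsmul_unitElement_le (T : Finset D) : ∀ {x y : D}, x ≤ y →
    (∀ z ∈ T, x ≤ z ∧ z < y) → x + T.card • unitElement D ≤ y := by
  induction T using Finset.induction_on_max with
  | empty => intro x y hxy _; simpa using hxy
  | insert z T hz ih =>
    intro x y hxy h
    have hzT : z ∉ T := fun hh => lt_irrefl _ (hz z hh)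
    have hz' := h z (Finset.mem_insert_self _ _)
    have h1 := ih hz'.1 fun w hw => ⟨(h w (Finset.mem_insert_of_mem hw)).1, hz w hw⟩
    rcases unitElement_cases (D := D) with hu | hu
    · rw [Finset.card_insert_of_notMem hzT, succ_nsmul, ← add_assoc]
      have h2 := hu.2 _ _ hz'.2
      rcases h1.lt_or_eq with h3 | h3
      · exact ((hu.2 _ _ h3).trans hz'.2.le)
      · rwa [h3]
    · simpa [hu.1] using hxy

/-! ### Natural numbers in place of group elements -/

variable {k N : ℕ} {r : Fin k → D}

/-- The ranks of two initial values differ by the number of points of `V` in the half-open interval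
between them, and the gap bounds how many can be there. -/
theorem gapCompatible_rank {V : Finset D} (hV : V.card ≤ N) (hr : ∀ i, r i ∈ V) (i j : Fin k) :
    GapCompatible (gap N (r i) (r j)) (V.filter (· < r i)).card (V.filter (· < r j)).card := by
  constructor
  · intro h
    have hN : 0 < N := (Finset.card_pos.2 ⟨_, hr i⟩).trans_le hV
    have hle : r j ≤ r i := not_lt.1 fun hlt => (gap_pos hN hlt).ne' h
    exact Finset.card_le_card fun z hz => by
      rw [Finset.mem_filter] at hz ⊢; exact ⟨hz.1, hz.2.trans_le hle⟩
  · intro h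
    have hlt := lt_of_gap_pos h
    have hunion : V.filter (· < r j) = V.filter (· < r i) ∪ V.filter (fun z => r i ≤ z ∧ z < r j) := by
      ext z
      simp only [Finset.mem_union, Finset.mem_filter]
      constructor
      · rintro ⟨h1, h2⟩
        rcases lt_or_ge z (r i) with h3 | h3
        exacts [Or.inl ⟨h1, h3⟩, Or.inr ⟨h1, h3, h2⟩]
      · rintro (⟨h1, h2⟩ | ⟨h1, -, h2⟩)
        exacts [⟨h1, h2.trans hlt⟩, ⟨h1, h2⟩]
    have hdisj : Disjoint (V.filter (· < r i)) (V.filter (fun z => r i ≤ z ∧ z < r j)) :=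
      Finset.disjoint_left.2 fun z h1 h2 =>
        absurd (Finset.mem_filter.1 h1).2 (not_lt.2 (Finset.mem_filter.1 h2).2.1)
    rw [hunion, Finset.card_union_of_disjoint hdisj]
    have hpos : 0 < (V.filter (fun z => r i ≤ z ∧ z < r j)).card :=
      Finset.card_pos.2 ⟨r i, Finset.mem_filter.2 ⟨hr i, le_rfl, hlt⟩⟩
    refine ⟨by omega, Nat.add_le_add_left ?_ _⟩
    refine le_gap_of_le hlt ((Finset.card_filter_le _ _).trans hV) ?_
    exact add_card_nsmul_unitElement_le _ hlt.le fun z hz => (Finset.mem_filter.1 hz).2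

theorem lt_iff_of_gapCompatible (hN : 0 < N) {f : Fin k → ℕ}
    (h : ∀ i j, GapCompatible (gap N (r i) (r j)) (f i) (f j)) (i j : Fin k) :
    r i < r j ↔ f i < f j := by
  constructor
  · exact fun hlt => ((h i j).2 (gap_pos hN hlt)).1
  · intro hlt
    by_contra hn
    have : gap N (r i) (r j) = 0 := by rw [gap, if_neg hn]
    exact absurd ((h i j).1 this) (not_le.2 hlt)

variable [Infinite D]

theorem exists_pos : ∃ x : D, 0 < x := by
  obtain ⟨x, hx⟩ := exists_ne (0 : D)
  rcases lt_or_gt_of_ne hx with h | h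
  · refine ⟨-x, ?_⟩
    have := add_lt_add_right h (-x)
    simpa using this
  · exact ⟨x, h⟩

theorem noMaxOrder_of_infinite : NoMaxOrder D := ⟨fun a => by
  obtain ⟨x, hx⟩ := exists_pos (D := D)
  exact ⟨a + x, by simpa using add_lt_add_right hx a⟩⟩

theorem noMinOrder_of_infinite : NoMinOrder D := ⟨fun a => by
  obtain ⟨x, hx⟩ := exists_pos (D := D)
  refine ⟨a + -x, ?_⟩
  have : -x < 0 := by simpa using add_lt_add_right hx (-x)
  simpa using add_lt_add_right this a⟩

/-- Compatibility makes f i ↦ r i well defined and strictly monotone, and it guarantees room for the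
intermediate numbers. Hence the map extends to all numbers below `N`. -/
theorem exists_strictMonoOn_of_gapCompatible [AddRightMono D] (hN : 0 < N) {f : Fin k → ℕ}
    (hf : ∀ i, f i < N) (h : ∀ i j, GapCompatible (gap N (r i) (r j)) (f i) (f j)) :
    ∃ g : ℕ → D, StrictMonoOn g (Set.Iio N) ∧ ∀ i, g (f i) = r i := by
  classical
  have := noMaxOrder_of_infinite (D := D)
  have := noMinOrder_of_infinite (D := D)
  have hlt := lt_iff_of_gapCompatible hN h
  have hinj : ∀ i j, f i = f j → r i = r j := fun i j hij =>
    le_antisymm (not_lt.1 fun hh => ((hlt j i).1 hh).ne' hij)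
      (not_lt.1 fun hh => ((hlt i j).1 hh).ne hij)
  let g₀ : ℕ → D := fun m => if hm : ∃ i, f i = m then r hm.choose else 0
  have hg₀ : ∀ i, g₀ (f i) = r i := fun i => by
    have hm : ∃ j, f j = f i := ⟨i, rfl⟩
    simp only [g₀, dif_pos hm]
    exact hinj _ _ hm.choose_spec
  have hmem : ∀ m ∈ Finset.univ.image f, ∃ i, f i = m := fun m hm => by simpa using hm
  obtain ⟨g, hg, he⟩ := exists_strictMonoOn_extend (Finset.range N) _ (Finset.univ.image f) rfl
    (fun m hm => by obtain ⟨i, rfl⟩ := hmem m hm; exact Finset.mem_range.2 (hf i)) g₀ (by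
      intro a ha b hb hab
      obtain ⟨i, rfl⟩ := hmem a ha
      obtain ⟨j, rfl⟩ := hmem b hb
      rw [hg₀, hg₀]
      exact (hlt i j).2 hab) (by
      intro a ha b hb hab _
      obtain ⟨i, rfl⟩ := hmem a ha
      obtain ⟨j, rfl⟩ := hmem b hb
      rw [hg₀, hg₀]
      have hr := (hlt i j).2 hab
      have hgap := ((h i j).2 (gap_pos hN hr)).2
      have hle : r i + (f j - f i) • unitElement D ≤ r j := le_of_le_gap hr (N := N) (by omega)
      rcases unitElement_cases (D := D) with hu | hu
      · have hmono : StrictMono fun t : ℕ => r i + t • unitElement D := strictMono_nat_of_lt_succ fun t => by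
          rw [succ_nsmul, ← add_assoc]
          simpa using add_lt_add_right hu.1 (r i + t • unitElement D)
        -- The inner multiples, with 0 < t < f j - f i, lie strictly between the endpoints and are
        -- as many as the numbers strictly between `f i` and `f j`.
        have hsub : (fun t : ℕ => r i + t • unitElement D) '' ((Finset.Ioo 0 (f j - f i) : Finset ℕ) : Set ℕ) ⊆
            Set.Ioo (r i) (r j) := by
          rintro _ ⟨t, ht, rfl⟩
          simp only [Finset.coe_Ioo, Set.mem_Ioo] at ht
          exact ⟨by simpa using hmono ht.1, (hmono ht.2).trans_le hle⟩
        refine le_trans ?_ (Set.encard_le_encard hsub)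
        rw [hmono.injective.encard_image, Set.encard_coe_eq_coe_finsetCard]
        refine Nat.cast_le.2 ?_
        have : (Finset.range N).filter (fun v => f i < v ∧ v < f j) ⊆ Finset.Ioo (f i) (f j) :=
          fun v hv => by
            rw [Finset.mem_filter] at hv
            exact Finset.mem_Ioo.2 hv.2
        refine (Finset.card_le_card this).trans ?_
        simp
      · have hinf : (Set.Ioo (r i) (r j)).Infinite := by
          have : DenselyOrdered D := ⟨hu.2⟩
          exact Set.Ioo_infinite hr
        rw [hinf.encard_eq]; exact le_top)
  refine ⟨g, ?_, fun i => ?_⟩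
  · simpa using hg
  · exact (he _ (Finset.mem_image_of_mem f (Finset.mem_univ i))).trans (hg₀ i)

/-- From left to right, a short witness is renumbered by the ranks of its values. From right to
left, numbers are mapped into the group by the embedding just constructed. The step bound `K` costs
nothing, because a short witness already respects it. -/
theorem RegSys.exists_badIn_iff [AddRightMono D] {P : Type*} [Fintype P]
    (S : RegSys P (Fin k ⊕ Fin k)) (p : P) {K : ℕ} (hK : N ≤ K)
    (hN : fillBound P (Fin k ⊕ Fin k) (Fintype.card (Fin k ⊕ Fin k) ^ 2)
      (Fintype.card (Fin k ⊕ Fin k)) + k + 1 ≤ N) :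
    (∃ n, S.BadIn (Set.univ : Set D) n p (Sum.elim r r)) ↔
      ∃ f : Fin k → ℕ, (∀ i, f i < N) ∧ (∀ i j, GapCompatible (gap N (r i) (r j)) (f i) (f j)) ∧
        ∃ n ≤ K, S.BadIn (Set.Iio N) n p (Sum.elim f f) := by
  classical
  have := noMaxOrder_of_infinite (D := D)
  have := noMinOrder_of_infinite (D := D)
  constructor
  · rintro ⟨n, hn⟩
    obtain ⟨m, hm, hb⟩ := hn.exists_lt_bound
    obtain ⟨V, hVc, -, hV⟩ := hb.exists_finset
    -- The initial values belong to the ranked set even if the witness never reads them, since the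
    -- registers must be mapped too.
    let W := V ∪ Finset.univ.image r
    have hr : ∀ i, r i ∈ W := fun i =>
      Finset.mem_union_right _ (Finset.mem_image_of_mem _ (Finset.mem_univ i))
    have hWc : W.card ≤ N := by
      have h1 : W.card ≤ V.card + (Finset.univ.image r).card := Finset.card_union_le _ _
      have h2 : (Finset.univ.image r).card ≤ k :=
        Finset.card_image_le.trans (by simp)
      omega
    have hmono : StrictMonoOn (fun x => (W.filter (· < x)).card) (W : Set D) :=
      fun x hx y hy hxy => Finset.card_lt_card (by
        refine Finset.ssubset_iff_subset_ne.2 ⟨fun z hz => ?_, fun he => ?_⟩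
        · rw [Finset.mem_filter] at hz ⊢; exact ⟨hz.1, hz.2.trans hxy⟩
        · have : x ∈ W.filter (· < y) := Finset.mem_filter.2 ⟨hx, hxy⟩
          rw [← he, Finset.mem_filter] at this
          exact lt_irrefl _ this.2)
    have hlt : ∀ x ∈ W, (W.filter (· < x)).card < N := fun x hx =>
      (Finset.card_lt_card (s := W.filter (· < x)) (t := W)
        (Finset.filter_ssubset.2 ⟨x, hx, lt_irrefl x⟩)).trans_le hWc
    refine ⟨fun i => (W.filter (· < r i)).card, fun i => hlt _ (hr i),
      gapCompatible_rank hWc hr, m, by omega, ?_⟩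
    have := (hV.mono (B := (W : Set D)) (by simp [W])).map hmono (B := Set.Iio N)
      (fun x hx => hlt x hx) (by rintro (i | i) <;> exact hr i)
    convert this using 1
    funext j
    rcases j with i | i <;> rfl
  · rintro ⟨f, hf, hc, n, -, hb⟩
    obtain ⟨g, hg, he⟩ := exists_strictMonoOn_of_gapCompatible (by omega) hf hc
    refine ⟨n, ?_⟩
    have := hb.map hg (B := Set.univ) (fun _ _ => trivial) (by rintro (i | i) <;> exact hf i)
    convert this using 1
    funext j
    rcases j with i | i <;> exact (he i).symm

end LinearGroup

/-! ### A structured programming language for deterministic machines -/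

/-- Programs over stacks that are numbered by `ℕ` and four data registers. -/
inductive Cmd
  | skip
  | push (i : ℕ) (a : Letter)
  | pushReg (i : ℕ) (r : Fin 4)
  | setZero (r : Fin 4)
  | setUnit (r : Fin 4)
  | sum (r x y : Fin 4)
  | test (x y : Fin 4) (f : Ordering → Cmd)
  | seq (c d : Cmd)
  /-- pop the cells of stack `i` until it is empty; for each letter `a` run `f a`, for each element
  of the data domain move it to register `r` and run `g` -/
  | loop (i : ℕ) (r : Fin 4) (f : Letter → Cmd) (g : Cmd)

/-- The storage of a program. -/
structure Store (D : Type u) where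
  stack : ℕ → List (Cell D)
  reg : Fin 4 → D

namespace Store

variable {D : Type u}

/-- Replace the content of stack `i`. -/
def set (s : Store D) (i : ℕ) (l : List (Cell D)) : Store D := ⟨Function.update s.stack i l, s.reg⟩

/-- Replace the content of register `r`. -/
def setReg (s : Store D) (r : Fin 4) (d : D) : Store D := ⟨s.stack, Function.update s.reg r d⟩

end Store

namespace Cmd

/-- `Exec c s n s'`: program `c` leads from `s` to `s'` in `n` steps. -/
inductive Exec {D : Type u} [AddGroup D] [LinearOrder D] : Cmd → Store D → ℕ → Store D → Prop
  | skip (s) : Exec skip s 1 s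
  | push (i a s) : Exec (push i a) s 1 (s.set i (Cell.sym a :: s.stack i))
  | pushReg (i r s) : Exec (pushReg i r) s 1 (s.set i (Cell.val (s.reg r) :: s.stack i))
  | setZero (r s) : Exec (setZero r) s 1 (s.setReg r 0)
  | setUnit (r s) : Exec (setUnit r) s 1 (s.setReg r (unitElement D))
  | sum (r x y s) : Exec (sum r x y) s 1 (s.setReg r (s.reg x + s.reg y))
  | test {x y f s n s'} (h : Exec (f (_root_.cmp (s.reg x) (s.reg y))) s n s') :
      Exec (test x y f) s (n + 1) s'
  | seq {c d s n s' n' s''} (h : Exec c s n s') (h' : Exec d s' n' s'') :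
      Exec (seq c d) s (n + n') s''
  | loop_nil {i r f g s} (h : s.stack i = []) : Exec (loop i r f g) s 1 s
  | loop_sym {i r f g s a l n s' n' s''} (h : s.stack i = Cell.sym a :: l)
      (h1 : Exec (f a) (s.set i l) n s') (h2 : Exec (loop i r f g) s' n' s'') :
      Exec (loop i r f g) s (n + n' + 1) s''
  | loop_val {i r f g s d l n s' n' s''} (h : s.stack i = Cell.val d :: l)
      (h1 : Exec g ((s.set i l).setReg r d) n s') (h2 : Exec (loop i r f g) s' n' s'') :
      Exec (loop i r f g) s (n + n' + 1) s''

/-- All stacks that occur in the program have numbers below `m`. -/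
def Below (m : ℕ) : Cmd → Prop
  | skip => True
  | push i _ => i < m
  | pushReg i _ => i < m
  | setZero _ => True
  | setUnit _ => True
  | sum _ _ _ => True
  | test _ _ f => ∀ o, Below m (f o)
  | seq c d => Below m c ∧ Below m d
  | loop i _ f g => i < m ∧ (∀ a, Below m (f a)) ∧ Below m g

theorem Below.mono {m m' : ℕ} (h : m ≤ m') : ∀ {c : Cmd}, c.Below m → c.Below m'
  | skip, _ => trivial
  | push _ _, hc => lt_of_lt_of_le hc h
  | pushReg _ _, hc => lt_of_lt_of_le hc h
  | setZero _, _ => trivial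
  | setUnit _, _ => trivial
  | sum _ _ _, _ => trivial
  | test _ _ _, hc => fun o => Below.mono h (hc o)
  | seq _ _, hc => ⟨Below.mono h hc.1, Below.mono h hc.2⟩
  | loop _ _ _ _, hc => ⟨lt_of_lt_of_le hc.1 h, fun a => Below.mono h (hc.2.1 a), Below.mono h hc.2.2⟩

/-- Loops branch on the letter read, so finiteness of the alphabet is what keeps the compiled
program finite. -/
instance : Finite Letter := by
  let f : Letter → Bool ⊕ Unit ⊕ Ordering ⊕ Fin 3 := fun a => match a with
    | .bit b => .inl b
    | .sep => .inr (.inl ())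
    | .cmp o => .inr (.inr (.inl o))
    | .upd .old => .inr (.inr (.inr 0))
    | .upd .new => .inr (.inr (.inr 1))
    | .upd .add => .inr (.inr (.inr 2))
  refine Finite.of_injective f fun a b h => ?_
  rcases a with a | _ | a | (_ | _ | _) <;> rcases b with b | _ | b | (_ | _ | _) <;> simp_all [f]

/-- All branchings are finite, so a maximum over the branches exists. A machine with finitely many
stacks can therefore run the program. -/
theorem exists_below (c : Cmd) : ∃ m, c.Below m := by
  have fin : ∀ {α : Type} [Finite α] (f : α → Cmd), (∀ a, ∃ m, (f a).Below m) →
      ∃ m, ∀ a, (f a).Below m := by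
    intro α _ f h
    choose m hm using h
    obtain ⟨b, hb⟩ := (Set.finite_range m).bddAbove
    exact ⟨b, fun a => (hm a).mono (hb ⟨a, rfl⟩)⟩
  induction c with
  | skip => exact ⟨0, trivial⟩
  | push i _ => exact ⟨i + 1, Nat.lt_succ_self i⟩
  | pushReg i _ => exact ⟨i + 1, Nat.lt_succ_self i⟩
  | setZero _ => exact ⟨0, trivial⟩
  | setUnit _ => exact ⟨0, trivial⟩
  | sum _ _ _ => exact ⟨0, trivial⟩
  | test _ _ f ih => exact fin f ih
  | seq c d hc hd =>
    obtain ⟨m, hm⟩ := hc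
    obtain ⟨m', hm'⟩ := hd
    exact ⟨max m m', hm.mono (le_max_left _ _), hm'.mono (le_max_right _ _)⟩
  | loop i _ f g hf hg =>
    obtain ⟨m, hm⟩ := fin f hf
    obtain ⟨m', hm'⟩ := hg
    exact ⟨max (i + 1) (max m m'), by simp, fun a => (hm a).mono (by simp), hm'.mono (by simp)⟩

/-! ### Compilation -/

/-- The labels of the compiled program. -/
def Lbl : Cmd → Type
  | test _ _ f => Option (Σ o : Ordering, Lbl (f o))
  | seq c d => Lbl c ⊕ Lbl d
  | loop _ _ f g => Option ((Σ a : Letter, Lbl (f a)) ⊕ Lbl g)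
  | _ => Unit

/-- The first label of the compiled program. -/
def entry : (c : Cmd) → Lbl c
  | test _ _ _ => none
  | seq c _ => Sum.inl (entry c)
  | loop _ _ _ _ => none
  | skip => ()
  | push _ _ => ()
  | pushReg _ _ => ()
  | setZero _ => ()
  | setUnit _ => ()
  | sum _ _ _ => ()

instance finite_lbl : (c : Cmd) → Finite (Lbl c)
  | test _ _ f => by
    have := fun o => finite_lbl (f o)
    exact inferInstanceAs (Finite (Option (Σ o : Ordering, Lbl (f o))))
  | seq c d => by
    have := finite_lbl c
    have := finite_lbl d
    exact inferInstanceAs (Finite (Lbl c ⊕ Lbl d))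
  | loop _ _ f g => by
    have := fun o => finite_lbl (f o)
    have := finite_lbl g
    exact inferInstanceAs (Finite (Option ((Σ a : Letter, Lbl (f a)) ⊕ Lbl g)))
  | skip => inferInstanceAs (Finite Unit)
  | push _ _ => inferInstanceAs (Finite Unit)
  | pushReg _ _ => inferInstanceAs (Finite Unit)
  | setZero _ => inferInstanceAs (Finite Unit)
  | setUnit _ => inferInstanceAs (Finite Unit)
  | sum _ _ _ => inferInstanceAs (Finite Unit)

/-- The instruction at a label, when labels are embedded by `emb` and the program is left through
`exit`. -/
def instr {K Λ : Type} (κ : ℕ → K) : (c : Cmd) → (Lbl c → Λ) → Λ → Lbl c → Instr K (Fin 4) Λ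
  | skip, _, exit, _ => .test 0 0 fun _ => exit
  | push i a, _, exit, _ => .push (κ i) a exit
  | pushReg i r, _, exit, _ => .pushReg (κ i) r exit
  | setZero r, _, exit, _ => .setZero r exit
  | setUnit r, _, exit, _ => .setUnit r exit
  | sum r x y, _, exit, _ => .sum r x y exit
  | test x y f, emb, _, none => .test x y fun o => emb (some ⟨o, entry (f o)⟩)
  | test _ _ f, emb, exit, some ⟨o, l⟩ => instr κ (f o) (fun l => emb (some ⟨o, l⟩)) exit l
  | seq c d, emb, _, .inl l =>
    instr κ c (fun l => emb (.inl l)) (emb (.inr (entry d))) l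
  | seq _ d, emb, exit, .inr l => instr κ d (fun l => emb (.inr l)) exit l
  | loop i r f g, emb, exit, none =>
    .pop (κ i) r (fun a => emb (some (.inl ⟨a, entry (f a)⟩))) (emb (some (.inr (entry g)))) exit
  | loop _ _ f _, emb, _, some (.inl ⟨a, l⟩) =>
    instr κ (f a) (fun l => emb (some (.inl ⟨a, l⟩))) (emb none) l
  | loop _ _ _ g, emb, _, some (.inr l) =>
    instr κ g (fun l => emb (some (.inr l))) (emb none) l

/-- Compiled programs are deterministic; this is what lets one program serve a problem and its
complement. -/
theorem instr_ne_guess {K Λ : Type} (κ : ℕ → K) (q q' : Λ) : ∀ (c : Cmd) (emb : Lbl c → Λ) (exit : Λ)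
    (l : Lbl c), instr κ c emb exit l ≠ .guess q q'
  | skip, _, _, _ => nofun
  | push _ _, _, _, _ => nofun
  | pushReg _ _, _, _, _ => nofun
  | setZero _, _, _, _ => nofun
  | setUnit _, _, _, _ => nofun
  | sum _ _ _, _, _, _ => nofun
  | test _ _ _, _, _, none => nofun
  | test _ _ f, _, _, some ⟨o, l⟩ => instr_ne_guess κ q q' (f o) _ _ l
  | seq c _, _, _, .inl l => instr_ne_guess κ q q' c _ _ l
  | seq _ d, _, _, .inr l => instr_ne_guess κ q q' d _ _ l
  | loop _ _ _ _, _, _, none => nofun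
  | loop _ _ f _, _, _, some (.inl ⟨a, l⟩) => instr_ne_guess κ q q' (f a) _ _ l
  | loop _ _ _ g, _, _, some (.inr l) => instr_ne_guess κ q q' g _ _ l

/-- The machine that runs `c` on the input in stack `0` and then accepts if stack `o` is nonempty
(if `b` holds) or empty (if `b` does not hold). -/
def machine (c : Cmd) (m o : ℕ) (b : Bool) : Machine where
  Stack := Fin (m + 1)
  Reg := Fin 4
  Label := Lbl c ⊕ Fin 3
  input := 0
  start := .inl (entry c)
  prog
    | .inl l => instr (Fin.ofNat (m + 1)) c .inl (.inr 0) l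
    | .inr 0 => .pop (Fin.ofNat (m + 1) o) 0 (fun _ => .inr 1) (.inr 1) (.inr 2)
    | .inr 1 => if b then .accept else .reject
    | .inr 2 => if b then .reject else .accept

end Cmd

/-! ### Deterministic computations -/

namespace Machine

variable {M : Machine} {D : Type u} [AddGroup D] [LinearOrder D]

theorem Steps.trans {n n' : ℕ} {c c' c'' : M.Conf D} (h : M.Steps n c c') (h' : M.Steps n' c' c'') :
    M.Steps (n + n') c c'' := by
  induction h with
  | refl => simpa using h'
  | @step n _ _ _ hs _ ih =>
    rw [Nat.add_right_comm]
    exact .step hs (ih h')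

theorem Steps.one {c c' : M.Conf D} (h : M.succs c = [c']) : M.Steps 1 c c' :=
  .step (by rw [h]; exact List.mem_singleton_self _) (.refl _)

theorem succs_subsingleton (hM : ∀ l q q', M.prog l ≠ .guess q q') (c : M.Conf D) {c₁ c₂ : M.Conf D}
    (h₁ : c₁ ∈ M.succs c) (h₂ : c₂ ∈ M.succs c) : c₁ = c₂ := by
  unfold succs at h₁ h₂
  cases hp : M.prog c.label with
  | guess q q' => exact absurd hp (hM _ _ _)
  | pop i r f v e =>
    rw [hp] at h₁ h₂
    rcases hs : c.stack i with _ | ⟨a | d, l⟩ <;> simp_all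
  | _ => rw [hp] at h₁ h₂; simp_all

/-- Without guesses, every computation from the same configuration is an initial part of the halting
one. One halting run thus bounds all branches and determines acceptance. -/
theorem Steps.le_of_deterministic (hM : ∀ l q q', M.prog l ≠ .guess q q') {n : ℕ}
    {c c' : M.Conf D} (h : M.Steps n c c') (hc' : M.succs c' = []) {n' : ℕ} {c'' : M.Conf D}
    (h' : M.Steps n' c c'') : n' ≤ n ∧ (M.succs c'' = [] → c'' = c') := by
  induction h generalizing n' c'' with
  | refl =>
    cases h' with
    | refl => exact ⟨le_rfl, fun _ => rfl⟩
    | step hs _ => rw [hc'] at hs; simp at hs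
  | step hs _ ih =>
    cases h' with
    | refl => exact ⟨Nat.zero_le _, fun h => by rw [h] at hs; simp at hs⟩
    | step hs' h' =>
      obtain rfl := succs_subsingleton hM _ hs hs'
      obtain ⟨h1, h2⟩ := ih hc' h'
      exact ⟨by omega, h2⟩

end Machine

/-! ### Correctness of the compilation -/

namespace Cmd

theorem update_restrict {D : Type u} {m i : ℕ} (h : i < m + 1) (f : ℕ → List (Cell D)) (l : List (Cell D)) :
    (fun j : Fin (m + 1) => Function.update f i l j) =
      Function.update (fun j : Fin (m + 1) => f j) (Fin.ofNat (m + 1) i) l := by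
  funext j
  simp only [Function.update_apply, Fin.ext_iff, Fin.val_ofNat, Nat.mod_eq_of_lt h]

variable {D : Type u} [AddGroup D] [LinearOrder D]

/-- The configuration of the compiled machine at a label. -/
def conf (c : Cmd) (m o : ℕ) (b : Bool) (l : Lbl c ⊕ Fin 3) (s : Store D) :
    (machine c m o b).Conf D := ⟨l, fun i : Fin (m + 1) => s.stack i, s.reg⟩

/-- The subprogram `c` sits inside a fixed program `c₀`. Keeping the embedding of its labels and its
exit arbitrary lets the induction descend into sequences and loop bodies, whose exit is the next
command or the head of the loop. -/
theorem steps_of_exec {c₀ : Cmd} {m o : ℕ} {b : Bool} {c : Cmd} {s s' : Store D} {n : ℕ}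
    (h : Exec c s n s') (hc : c.Below (m + 1)) (emb : Lbl c → Lbl c₀ ⊕ Fin 3)
    (exit : Lbl c₀ ⊕ Fin 3)
    (hemb : ∀ l, (machine c₀ m o b).prog (emb l) = instr (Fin.ofNat (m + 1)) c emb exit l) :
    (machine c₀ m o b).Steps n (conf c₀ m o b (emb (entry c)) s) (conf c₀ m o b exit s') := by
  induction h generalizing exit with
  | skip s =>
    refine .one ?_
    have := hemb (entry skip)
    simp only [Machine.succs, conf, this]
    rfl
  | push i a s =>
    refine .one ?_
    have := hemb (entry (push i a))
    have hi : (s.stack ((Fin.ofNat (m + 1) i : Fin (m + 1)) : ℕ)) = s.stack i := by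
      rw [Fin.val_ofNat, Nat.mod_eq_of_lt hc]
    simp only [Machine.succs, conf, this, instr, Store.set, update_restrict (D := D) hc]
    rw [hi]
    rfl
  | pushReg i r s =>
    refine .one ?_
    have := hemb (entry (pushReg i r))
    have hi : (s.stack ((Fin.ofNat (m + 1) i : Fin (m + 1)) : ℕ)) = s.stack i := by
      rw [Fin.val_ofNat, Nat.mod_eq_of_lt hc]
    simp only [Machine.succs, conf, this, instr, Store.set, update_restrict (D := D) hc]
    rw [hi]
    rfl
  | setZero r s =>
    refine .one ?_
    have := hemb (entry (setZero r))
    simp only [Machine.succs, conf, this]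
    rfl
  | setUnit r s =>
    refine .one ?_
    have := hemb (entry (setUnit r))
    simp only [Machine.succs, conf, this]
    rfl
  | sum r x y s =>
    refine .one ?_
    have := hemb (entry (sum r x y))
    simp only [Machine.succs, conf, this]
    rfl
  | @test x y f s n s' _ ih =>
    have hstep : (machine c₀ m o b).Steps 1 (conf c₀ m o b (emb (entry (test x y f))) s)
        (conf c₀ m o b (emb (some ⟨_root_.cmp (s.reg x) (s.reg y), entry (f _)⟩)) s) := by
      refine .one ?_
      have := hemb (entry (test x y f))
      simp only [Machine.succs, conf, this]
      rfl
    rw [Nat.add_comm]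
    exact hstep.trans (ih (hc _) (fun l => emb (some ⟨_, l⟩)) exit fun l => hemb (some ⟨_, l⟩))
  | @seq c d s n s' n' s'' _ _ ih ih' =>
    exact (ih hc.1 (fun l => emb (.inl l)) (emb (.inr (entry d))) fun l => hemb (.inl l)).trans
      (ih' hc.2 (fun l => emb (.inr l)) exit fun l => hemb (.inr l))
  | @loop_nil i r f g s hs =>
    refine .one ?_
    have : (machine c₀ m o b).prog (emb (entry (loop i r f g))) =
          .pop (Fin.ofNat (m + 1) i) r (fun a => emb (some (.inl ⟨a, entry (f a)⟩)))
            (emb (some (.inr (entry g)))) exit := hemb (entry (loop i r f g))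
    have hi : (s.stack ((Fin.ofNat (m + 1) i : Fin (m + 1)) : ℕ)) = [] := by
      rw [Fin.val_ofNat, Nat.mod_eq_of_lt hc.1, hs]
    simp only [Machine.succs, conf, this]
    rw [hi]
  | @loop_sym i r f g s a l n s' n' s'' hs _ _ ih ih' =>
    have hstep : (machine c₀ m o b).Steps 1 (conf c₀ m o b (emb (entry (loop i r f g))) s)
        (conf c₀ m o b (emb (some (.inl ⟨a, entry (f a)⟩))) (s.set i l)) := by
      refine .one ?_
      have : (machine c₀ m o b).prog (emb (entry (loop i r f g))) =
          .pop (Fin.ofNat (m + 1) i) r (fun a => emb (some (.inl ⟨a, entry (f a)⟩)))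
            (emb (some (.inr (entry g)))) exit := hemb (entry (loop i r f g))
      have hi : (s.stack ((Fin.ofNat (m + 1) i : Fin (m + 1)) : ℕ)) = Cell.sym a :: l := by
        rw [Fin.val_ofNat, Nat.mod_eq_of_lt hc.1, hs]
      simp only [Machine.succs, conf, this, Store.set, update_restrict (D := D) hc.1]
      rw [hi]
      rfl
    have h1 := ih (hc.2.1 a) (fun l => emb (some (.inl ⟨a, l⟩))) (emb none)
      fun l => hemb (some (.inl ⟨a, l⟩))
    have h2 := ih' hc emb exit hemb
    rw [Nat.add_comm]
    exact hstep.trans (h1.trans h2)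
  | @loop_val i r f g s d l n s' n' s'' hs _ _ ih ih' =>
    have hstep : (machine c₀ m o b).Steps 1 (conf c₀ m o b (emb (entry (loop i r f g))) s)
        (conf c₀ m o b (emb (some (.inr (entry g)))) ((s.set i l).setReg r d)) := by
      refine .one ?_
      have : (machine c₀ m o b).prog (emb (entry (loop i r f g))) =
          .pop (Fin.ofNat (m + 1) i) r (fun a => emb (some (.inl ⟨a, entry (f a)⟩)))
            (emb (some (.inr (entry g)))) exit := hemb (entry (loop i r f g))
      have hi : (s.stack ((Fin.ofNat (m + 1) i : Fin (m + 1)) : ℕ)) = Cell.val d :: l := by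
        rw [Fin.val_ofNat, Nat.mod_eq_of_lt hc.1, hs]
      simp only [Machine.succs, conf, this, Store.set, Store.setReg,
        update_restrict (D := D) hc.1]
      rw [hi]
      rfl
    have h1 := ih hc.2.2 (fun l => emb (some (.inr l))) (emb none) fun l => hemb (some (.inr l))
    have h2 := ih' hc emb exit hemb
    rw [Nat.add_comm]
    exact hstep.trans (h1.trans h2)

/-- The store on the input word `w`. -/
def initStore (w : List (Cell D)) : Store D := ⟨Function.update (fun _ => []) 0 w, fun _ => 0⟩

/-- The extra step is the final pop that inspects stack `o`; it leads to a halting label. -/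
theorem machine_spec {c : Cmd} {m o : ℕ} (hc : c.Below (m + 1)) (ho : o < m + 1) (b : Bool)
    {w : List (Cell D)} {n : ℕ} {s : Store D} (h : Exec c (initStore w) n s) :
    (machine c m o b).HaltsWithin w (n + 1) ∧
      ((machine c m o b).Accepts w ↔ (s.stack o ≠ [] ↔ b = true)) := by
  have h1 := steps_of_exec h (c₀ := c) (m := m) (o := o) (b := b) hc .inl (.inr 0) fun l => rfl
  have hinit : conf c m o b (.inl (entry c)) (initStore w) = (machine c m o b).initConf w := by
    refine congrArg (fun f => Machine.Conf.mk _ f _) ?_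
    exact update_restrict (D := D) (Nat.succ_pos m) (fun _ => []) w
  rw [hinit] at h1
  have hg : ∀ l q q', (machine c m o b).prog l ≠ .guess q q' := by
    rintro (l | l) q q'
    · exact instr_ne_guess _ _ _ c _ _ l
    · fin_cases l
      · nofun
      · cases b <;> nofun
      · cases b <;> nofun
  have hi : (s.stack ((Fin.ofNat (m + 1) o : Fin (m + 1)) : ℕ)) = s.stack o := by
    rw [Fin.val_ofNat, Nat.mod_eq_of_lt ho]
  obtain ⟨s', h2⟩ : ∃ s' : (machine c m o b).Conf D,
      (machine c m o b).succs (conf c m o b (.inr 0) s) = [s'] ∧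
      s'.label = (if s.stack o ≠ [] then .inr 1 else .inr 2 : Lbl c ⊕ Fin 3) := by
    have hpop : (machine c m o b).prog (.inr 0) =
        .pop (Fin.ofNat (m + 1) o) (0 : Fin 4) (fun _ => .inr 1) (.inr 1) (.inr 2) := rfl
    rcases hs : s.stack o with _ | ⟨a | d, l⟩ <;> rw [hs] at hi
    · refine ⟨conf c m o b (.inr 2) s, ?_, rfl⟩
      simp only [Machine.succs, conf, hpop]
      rw [hi]
    · refine ⟨⟨.inr 1, Function.update (fun i : Fin (m + 1) => s.stack i) (Fin.ofNat (m + 1) o) l,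
        s.reg⟩, ?_, rfl⟩
      simp only [Machine.succs, conf, hpop]
      rw [hi]
    · refine ⟨⟨.inr 1, Function.update (fun i : Fin (m + 1) => s.stack i) (Fin.ofNat (m + 1) o) l,
        Function.update s.reg (0 : Fin 4) d⟩, ?_, rfl⟩
      simp only [Machine.succs, conf, hpop]
      rw [hi]
  obtain ⟨h2, h3⟩ := h2
  have hsteps := h1.trans (.one h2)
  have hp1 : (machine c m o b).prog (.inr 1) = if b then .accept else .reject := rfl
  have hp2 : (machine c m o b).prog (.inr 2) = if b then .reject else .accept := rfl
  have hfin : (machine c m o b).succs s' = [] := by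
    unfold Machine.succs
    rw [h3]
    by_cases hs : s.stack o = []
    · rw [if_neg (by simpa using hs), hp2]; cases b <;> rfl
    · rw [if_pos (by simpa using hs), hp1]; cases b <;> rfl
  refine ⟨fun n' c' h' => (hsteps.le_of_deterministic hg hfin h').1, ?_⟩
  have hacc : (machine c m o b).prog s'.label = .accept ↔ (s.stack o ≠ [] ↔ b = true) := by
    rw [h3]
    by_cases hs : s.stack o = []
    · rw [if_neg (by simpa using hs), hp2]; cases b <;> simp [hs]
    · rw [if_pos (by simpa using hs), hp1]; cases b <;> simp [hs]
  rw [← hacc]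
  constructor
  · rintro ⟨n', c', h', ha⟩
    have hc' : (machine c m o b).succs c' = [] := by unfold Machine.succs; rw [ha]
    rw [← (hsteps.le_of_deterministic hg hfin h').2 hc']
    exact ha
  · exact fun ha => ⟨_, _, hsteps, ha⟩

end Cmd

/-! ### Running programs on unary numbers -/

/-- The number `n` in unary. -/
def unary (D : Type u) (n : ℕ) : List (Cell D) := List.replicate n (Cell.sym .sep)

@[simp] theorem unary_zero (D : Type u) : unary D 0 = [] := rfl

theorem unary_succ (D : Type u) (n : ℕ) : unary D (n + 1) = Cell.sym .sep :: unary D n := rfl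

namespace Store

variable {D : Type u}

theorem ext {s s' : Store D} (h : ∀ j, s.stack j = s'.stack j) (hr : s.reg = s'.reg) : s = s' := by
  cases s; cases s'
  simp only [Store.mk.injEq]
  exact ⟨funext h, hr⟩

theorem set_stack (s : Store D) (i : ℕ) (l : List (Cell D)) (j : ℕ) :
    (s.set i l).stack j = if j = i then l else s.stack j := by
  simp only [set, Function.update_apply]

@[simp] theorem set_stack_self (s : Store D) (i : ℕ) (l : List (Cell D)) :
    (s.set i l).stack i = l := by simp [set_stack]

theorem set_stack_of_ne (s : Store D) {i j : ℕ} (l : List (Cell D)) (h : j ≠ i) :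
    (s.set i l).stack j = s.stack j := by simp [set_stack, h]

end Store

namespace Cmd

variable {D : Type u} [AddGroup D] [LinearOrder D]

/-- Program `c` leads from `s` to `s'` in at most `T` steps. -/
def Runs (c : Cmd) (s : Store D) (T : ℕ) (s' : Store D) : Prop := ∃ n ≤ T, Exec c s n s'

theorem Runs.mono {c : Cmd} {s s' : Store D} {T T' : ℕ} (h : Runs c s T s') (hT : T ≤ T') :
    Runs c s T' s' := by
  obtain ⟨n, hn, he⟩ := h
  exact ⟨n, hn.trans hT, he⟩

theorem Runs.congr {c : Cmd} {s s₁ s₂ : Store D} {T : ℕ} (h : Runs c s T s₁) (hs : s₁ = s₂) :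
    Runs c s T s₂ := hs ▸ h

theorem Runs.congr_left {c : Cmd} {s s₁ s₂ : Store D} {T : ℕ} (h : Runs c s₁ T s₂) (hs : s = s₁) :
    Runs c s T s₂ := hs ▸ h

theorem Runs.seq {c d : Cmd} {s s' s'' : Store D} {T T' : ℕ} (h : Runs c s T s')
    (h' : Runs d s' T' s'') : Runs (.seq c d) s (T + T') s'' := by
  obtain ⟨n, hn, he⟩ := h
  obtain ⟨n', hn', he'⟩ := h'
  exact ⟨n + n', by omega, .seq he he'⟩

theorem runs_skip (s : Store D) : Runs skip s 1 s := ⟨1, le_rfl, .skip s⟩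

theorem runs_push (i : ℕ) (a : Letter) (s : Store D) :
    Runs (push i a) s 1 (s.set i (Cell.sym a :: s.stack i)) := ⟨1, le_rfl, .push i a s⟩

/-- Run `c` once for every cell of stack `i`, while emptying it. -/
def each (i : ℕ) (c : Cmd) : Cmd := loop i 0 (fun _ => c) skip

/-- `I m` is the loop invariant with `m` cells left. Every round costs one step for the pop, and so
does noticing the empty stack. -/
theorem runs_each {i : ℕ} {c : Cmd} (I : ℕ → Store D) {n T : ℕ}
    (hI : ∀ m ≤ n, (I m).stack i = unary D m)
    (hc : ∀ m < n, Runs c ((I (m + 1)).set i (unary D m)) T (I m)) :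
    Runs (each i c) (I n) (n * (T + 1) + 1) (I 0) := by
  induction n with
  | zero => exact ⟨1, by omega, .loop_nil (hI 0 le_rfl)⟩
  | succ n ih =>
    obtain ⟨m, hm, he⟩ := hc n (Nat.lt_succ_self n)
    obtain ⟨m', hm', he'⟩ := ih (fun m h => hI m (by omega)) fun m h => hc m (by omega)
    refine ⟨m + m' + 1, ?_, .loop_sym (hI (n + 1) le_rfl) he he'⟩
    rw [Nat.succ_mul]; omega

/-- Empty stack `i`. -/
def clear (i : ℕ) : Cmd := each i skip

theorem runs_clear {i n : ℕ} {s : Store D} (h : s.stack i = unary D n) :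
    Runs (clear i) s (2 * n + 1) (s.set i []) := by
  have := runs_each (c := skip) (i := i) (fun m => s.set i (unary D m)) (n := n) (T := 1)
    (fun m _ => by simp) (fun m _ => (runs_skip _).congr
      (Store.ext (fun j => by simp only [Store.set_stack]; split <;> rfl) rfl))
  refine (this.mono (by omega)).congr_left ?_
  exact Store.ext (fun j => by simp only [Store.set_stack]; split <;> simp_all) rfl

/-- Move a unary number from stack `i` to the top of stack `j`. -/
def move (i j : ℕ) : Cmd := each i (push j .sep)

theorem runs_move {i j n m : ℕ} {s : Store D} (hij : i ≠ j) (h : s.stack i = unary D n)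
    (hj : s.stack j = unary D m) :
    Runs (move i j) s (2 * n + 1) ((s.set i []).set j (unary D (n + m))) := by
  have := runs_each (c := push j .sep) (i := i)
    (fun l => (s.set i (unary D l)).set j (unary D (n - l + m))) (n := n) (T := 1)
    (fun l _ => by simp [Store.set_stack, hij]) (fun l hl => (runs_push _ _ _).congr
      (Store.ext (fun k => by
        simp only [Store.set_stack, ← unary_succ, hij.symm, if_false, if_true]
        have : n - (l + 1) + m + 1 = n - l + m := by omega
        rw [this]
        grind) rfl))
  refine (this.mono (by omega)).congr_left ?_
  exact Store.ext (fun k => by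
    rw [Nat.sub_self, Nat.zero_add]
    simp only [Store.set_stack]; grind) rfl

/-- Copy a unary number from stack `i` to stack `j`, by means of the empty stack `t`. -/
def copy (i j t : ℕ) : Cmd := seq (each i (seq (push t .sep) (push j .sep))) (move t i)

theorem runs_copy {i j t n : ℕ} {s : Store D} (hij : i ≠ j) (hit : i ≠ t) (hjt : j ≠ t)
    (h : s.stack i = unary D n) (hj : s.stack j = []) (ht : s.stack t = []) :
    Runs (copy i j t) s (5 * n + 2) (s.set j (unary D n)) := by
  have h1 := runs_each (c := seq (push t .sep) (push j .sep)) (i := i)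
    (fun l => ((s.set i (unary D l)).set t (unary D (n - l))).set j (unary D (n - l)))
    (n := n) (T := 2)
    (fun l _ => by simp [Store.set_stack, hij, hit]) (fun l hl =>
      ((runs_push _ _ _).seq (runs_push _ _ _)).congr
      (Store.ext (fun k => by
        have : n - l = n - (l + 1) + 1 := by omega
        rw [this]
        simp only [Store.set_stack, unary_succ]
        grind) rfl))
  have h2 := runs_move (i := t) (j := i) (n := n) (m := 0)
    (s := ((s.set i []).set t (unary D n)).set j (unary D n)) hit.symm
    (by simp [Store.set_stack, hjt.symm]) (by simp [Store.set_stack, hij, hit])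
  refine Runs.mono (T := n * (2 + 1) + 1 + (2 * n + 1)) ?_ (by omega)
  refine Runs.seq (s' := ((s.set i []).set t (unary D n)).set j (unary D n)) ?_ (h2.congr ?_)
  · refine h1.congr_left ?_
    exact Store.ext (fun k => by
      rw [Nat.sub_self]
      simp only [Store.set_stack]; grind [unary_zero]) rfl
  · exact Store.ext (fun k => by simp only [Store.set_stack]; grind [unary_zero]) rfl

end Cmd

/-! ### Computable functions with time bounds -/

/-- Tuples of natural numbers. -/
class Ctx (α : Type) where
  arity : ℕ
  vec : α → ℕ → ℕ

namespace Ctx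

instance : Ctx ℕ := ⟨1, fun n _ => n⟩

instance {α : Type} [Ctx α] : Ctx (α × ℕ) :=
  ⟨arity α + 1, fun p j => if j = arity α then p.2 else vec p.1 j⟩

variable {α β : Type} [Ctx α] [Ctx β]

/-- The sum of the entries of a tuple. -/
def size (x : α) : ℕ := (Finset.range (arity α)).sum (vec x)

theorem vec_le_size (x : α) {j : ℕ} (hj : j < arity α) : vec x j ≤ size x :=
  Finset.single_le_sum (f := vec x) (fun _ _ => Nat.zero_le _) (Finset.mem_range.2 hj)

theorem arity_nat : arity ℕ = 1 := rfl

theorem arity_prod : arity (α × ℕ) = arity α + 1 := rfl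

theorem vec_nat (n j : ℕ) : vec n j = n := rfl

theorem vec_prod_self (p : α × ℕ) : vec p (arity α) = p.2 := if_pos rfl

theorem vec_prod_of_ne (p : α × ℕ) {j : ℕ} (hj : j ≠ arity α) : vec p j = vec p.1 j := if_neg hj

theorem size_nat (n : ℕ) : size n = n := by simp [size, arity_nat, vec_nat]

theorem size_prod (p : α × ℕ) : size p = size p.1 + p.2 := by
  unfold size
  rw [arity_prod, Finset.sum_range_succ, vec_prod_self]
  congr 1
  exact Finset.sum_congr rfl fun j hj => vec_prod_of_ne p (Finset.mem_range.1 hj).ne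

end Ctx

open Ctx in
/-- Functions that are bounded by a polynomial. -/
def PolyBounded {α : Type} [Ctx α] (t : α → ℕ) : Prop := ∃ c, ∀ x, t x ≤ (size x + 2) ^ c

namespace PolyBounded

open Ctx

variable {α β : Type} [Ctx α] [Ctx β] {f g : α → ℕ}

theorem mono (hg : PolyBounded g) (h : ∀ x, f x ≤ g x) : PolyBounded f := by
  obtain ⟨c, hc⟩ := hg
  exact ⟨c, fun x => (h x).trans (hc x)⟩

/-- The base of the bounding power is at least 2, so n ≤ 2 ^ n absorbs any constant. -/
theorem const (n : ℕ) : PolyBounded fun _ : α => n :=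
  ⟨n, fun x => Nat.lt_two_pow_self.le.trans (Nat.pow_le_pow_left (by omega) _)⟩

theorem size : PolyBounded (Ctx.size : α → ℕ) := ⟨1, fun x => by rw [pow_one]; omega⟩

theorem add (hf : PolyBounded f) (hg : PolyBounded g) : PolyBounded fun x => f x + g x := by
  obtain ⟨c, hc⟩ := hf
  obtain ⟨d, hd⟩ := hg
  refine ⟨max c d + 1, fun x => ?_⟩
  have h1 : (Ctx.size x + 2) ^ c ≤ (Ctx.size x + 2) ^ max c d :=
    Nat.pow_le_pow_right (by omega) (le_max_left _ _)
  have h2 : (Ctx.size x + 2) ^ d ≤ (Ctx.size x + 2) ^ max c d :=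
    Nat.pow_le_pow_right (by omega) (le_max_right _ _)
  calc f x + g x ≤ (Ctx.size x + 2) ^ max c d * 2 := by have := hc x; have := hd x; omega
    _ ≤ (Ctx.size x + 2) ^ max c d * (Ctx.size x + 2) := Nat.mul_le_mul_left _ (by omega)
    _ = _ := (pow_succ _ _).symm

theorem mul (hf : PolyBounded f) (hg : PolyBounded g) : PolyBounded fun x => f x * g x := by
  obtain ⟨c, hc⟩ := hf
  obtain ⟨d, hd⟩ := hg
  exact ⟨c + d, fun x => by rw [pow_add]; exact Nat.mul_le_mul (hc x) (hd x)⟩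

theorem pow (hf : PolyBounded f) (n : ℕ) : PolyBounded fun x => f x ^ n := by
  obtain ⟨c, hc⟩ := hf
  exact ⟨c * n, fun x => by rw [pow_mul]; exact Nat.pow_le_pow_left (hc x) _⟩

theorem comp {g : β → ℕ} (hg : PolyBounded g) {h : α → β}
    (hh : PolyBounded fun x => Ctx.size (h x)) : PolyBounded fun x => g (h x) := by
  obtain ⟨c, hc⟩ := hg
  exact ((hh.add (const 2)).pow c).mono fun x => hc (h x)

theorem sum (n : ℕ) {f : ℕ → α → ℕ} (h : ∀ j < n, PolyBounded (f j)) :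
    PolyBounded fun x => (Finset.range n).sum fun j => f j x := by
  induction n with
  | zero => simpa using const 0
  | succ n ih =>
    simp only [Finset.sum_range_succ]
    exact (ih fun j hj => h j (by omega)).add (h n (Nat.lt_succ_self n))

theorem fst {f : α → ℕ} (hf : PolyBounded f) : PolyBounded fun p : α × ℕ => f p.1 :=
  hf.comp (size.mono fun p => by rw [size_prod]; omega)

end PolyBounded

namespace Cmd

open Ctx

variable {D : Type u} [AddGroup D] [LinearOrder D]

instance : Inhabited Cmd := ⟨skip⟩

/-- Run the programs `c 0, …, c (m - 1)`. -/
def seqRange (c : ℕ → Cmd) : ℕ → Cmd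
  | 0 => skip
  | m + 1 => seq (seqRange c m) (c m)

theorem runs_seqRange {c : ℕ → Cmd} {T : ℕ} (I : ℕ → Store D) {m : ℕ}
    (h : ∀ j < m, Runs (c j) (I j) T (I (j + 1))) : Runs (seqRange c m) (I 0) (m * T + 1) (I m) := by
  induction m with
  | zero => exact (runs_skip _).mono (by omega)
  | succ m ih =>
    refine ((ih fun j hj => h j (by omega)).seq (h m (Nat.lt_succ_self m))).mono ?_
    rw [Nat.succ_mul]; omega

end Cmd

namespace Store

/-- Write unary numbers to the stacks `b, …, b + m - 1`. -/
def setBlock {D : Type u} (s : Store D) (b m : ℕ) (v : ℕ → ℕ) : Store D :=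
  ⟨fun i => if b ≤ i ∧ i < b + m then unary D (v (i - b)) else s.stack i, s.reg⟩

end Store

open Ctx Cmd

/-- The tuple `x` is stored in the stacks `ins`. -/
def Holds {α : Type} [Ctx α] {D : Type u} (s : Store D) (ins : ℕ → ℕ) (x : α) : Prop :=
  ∀ j < arity α, s.stack (ins j) = unary D (vec x j)

/-- The program `prog ins out fresh` writes `f x` to stack `out`, where `x` is stored in the stacks
`ins`, within `t x` steps. It needs empty stacks from `fresh` on and leaves them empty. -/
def Computes {α : Type} [Ctx α] (prog : (ℕ → ℕ) → ℕ → ℕ → Cmd) (f t : α → ℕ) : Prop :=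
  ∀ (ins : ℕ → ℕ) (out fresh : ℕ), (∀ j < arity α, ins j < fresh ∧ ins j ≠ out) → out < fresh →
    ∀ (D : Type u) [AddGroup D] [LinearOrder D] (s : Store D) (x : α), Holds s ins x →
      s.stack out = [] → (∀ i ≥ fresh, s.stack i = []) →
      Runs (prog ins out fresh) s (t x) (s.set out (unary D (f x)))

/-- The function `f` is computable in time `t`. -/
def Comp {α : Type} [Ctx α] (f t : α → ℕ) : Prop := ∃ prog, Computes.{u} prog f t

/-! ### Composition and primitive recursion of timed programs -/

namespace Comp

variable {α β : Type} [Ctx α] [Ctx β] {f t : α → ℕ}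

theorem mono (h : Comp.{u} f t) {t' : α → ℕ} (ht : ∀ x, t x ≤ t' x) : Comp.{u} f t' := by
  obtain ⟨prog, hp⟩ := h
  exact ⟨prog, fun ins out fresh h1 h2 D _ _ s x h3 h4 h5 =>
    (hp ins out fresh h1 h2 D s x h3 h4 h5).mono (ht x)⟩

theorem zero : Comp.{u} (fun _ : α => 0) fun _ => 1 :=
  ⟨fun _ _ _ => skip, fun _ _ _ _ _ _ _ _ s _ _ h4 _ => (runs_skip s).congr
    (Store.ext (fun j => by rw [Store.set_stack]; grind [unary_zero]) rfl)⟩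

theorem succ (h : Comp.{u} f t) : Comp.{u} (fun x => f x + 1) fun x => t x + 1 := by
  obtain ⟨prog, hp⟩ := h
  refine ⟨fun ins out fresh => seq (prog ins out fresh) (push out .sep),
    fun ins out fresh h1 h2 D _ _ s x h3 h4 h5 => ?_⟩
  refine ((hp ins out fresh h1 h2 D s x h3 h4 h5).seq (runs_push _ _ _)).congr ?_
  exact Store.ext (fun j => by simp only [Store.set_stack, unary_succ]; grind) rfl

theorem var {j : ℕ} (hj : j < arity α) : Comp.{u} (fun x : α => vec x j) fun x => 5 * vec x j + 2 :=
  ⟨fun ins out fresh => copy (ins j) out fresh, fun _ _ fresh h1 h2 _ _ _ _ _ h3 h4 h5 =>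
    runs_copy (h1 j hj).2 (h1 j hj).1.ne h2.ne (h3 j hj) h4 (h5 fresh le_rfl)⟩

/-- The components of `h x` are written to a block of fresh stacks, `g` is run on that block, and
the block is cleared again to restore the convention on fresh stacks. -/
theorem comp {g tg : β → ℕ} (hg : Comp.{u} g tg) {h : α → β}
    (hh : ∀ j < arity β, Comp.{u} (fun x => vec (h x) j) t) :
    Comp.{u} (fun x => g (h x)) fun x =>
      arity β * t x + tg (h x) + arity β * (2 * size (h x) + 1) + 2 := by
  obtain ⟨G, hG⟩ := hg
  choose! H hH using hh
  set m := arity β with hm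
  refine ⟨fun ins out fresh => seq (seq
    (seqRange (fun j => H j ins (fresh + j) (fresh + m)) m)
    (G (fun j => fresh + j) out (fresh + m)))
    (seqRange (fun j => clear (fresh + j)) m), fun ins out fresh h1 h2 D _ _ s x h3 h4 h5 => ?_⟩
  have r1 := runs_seqRange (D := D) (c := fun j => H j ins (fresh + j) (fresh + m)) (T := t x)
    (m := m) (fun j => s.setBlock fresh j (vec (h x))) fun j hj => by
      refine (hH j hj ins (fresh + j) (fresh + m) (fun i hi => ?_) (by omega) D _ x
        (fun i hi => ?_) ?_ fun i hi => ?_).congr (Store.ext (fun i => ?_) rfl)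
      · have := (h1 i hi).1; omega
      · have := (h1 i hi).1
        simp only [Store.setBlock]
        rw [if_neg (by omega), h3 i hi]
      · simp only [Store.setBlock]
        rw [if_neg (by omega), h5 _ (by omega)]
      · simp only [Store.setBlock]
        rw [if_neg (by omega), h5 _ (by omega)]
      · simp only [Store.set_stack, Store.setBlock]
        by_cases hi : i = fresh + j
        · subst hi
          rw [if_pos rfl, if_pos (by omega), Nat.add_sub_cancel_left]
        · rw [if_neg hi]
          by_cases hi' : fresh ≤ i ∧ i < fresh + j
          · rw [if_pos hi', if_pos (by omega)]
          · rw [if_neg hi', if_neg (by omega)]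
  have r2 := hG (fun j => fresh + j) out (fresh + m) (fun j hj => by omega) (by omega) D
    (s.setBlock fresh m (vec (h x))) (h x) (fun j hj => by
      simp only [Store.setBlock]
      rw [if_pos (by omega), Nat.add_sub_cancel_left])
    (by simp only [Store.setBlock]; rw [if_neg (by omega), h4])
    (fun i hi => by simp only [Store.setBlock]; rw [if_neg (by omega), h5 i (by omega)])
  -- After `j` clearings, the block that remains begins at `fresh + j` and holds the last `m - j`
  -- arguments; the shifted index in `vec` accounts for this.
  have r3 := runs_seqRange (D := D) (c := fun j => clear (fresh + j)) (T := 2 * size (h x) + 1)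
    (m := m) (fun j => (s.set out (unary D (g (h x)))).setBlock (fresh + j) (m - j)
      (fun i => vec (h x) (i + j))) fun j hj => by
      have hc := runs_clear (i := fresh + j) (n := vec (h x) j)
        (s := (s.set out (unary D (g (h x)))).setBlock (fresh + j) (m - j)
          (fun i => vec (h x) (i + j))) (by
        simp only [Store.setBlock]
        rw [if_pos (by omega), Nat.sub_self, Nat.zero_add])
      have := vec_le_size (h x) hj
      refine (hc.mono (by omega)).congr (Store.ext (fun i => ?_) rfl)
      simp only [Store.set_stack, Store.setBlock]
      by_cases hi : i = fresh + j
      · subst hi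
        rw [if_pos rfl, if_neg (by omega), if_neg (by omega), h5 _ (by omega)]
      · rw [if_neg hi]
        by_cases hi' : fresh + j ≤ i ∧ i < fresh + j + (m - j)
        · rw [if_pos hi', if_pos (by omega)]
          congr 2; omega
        · rw [if_neg hi', if_neg (c := _ ∧ _) (by omega)]
  have e1 : s.setBlock fresh 0 (vec (h x)) = s := Store.ext (fun i => by
    simp only [Store.setBlock]; rw [if_neg (by omega)]) rfl
  have e2 : (s.setBlock fresh m (vec (h x))).set out (unary D (g (h x))) =
      (s.set out (unary D (g (h x)))).setBlock (fresh + 0) (m - 0) (fun i => vec (h x) (i + 0)) :=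
    Store.ext (fun i => by
      simp only [Store.set_stack, Store.setBlock, Nat.add_zero, Nat.sub_zero]
      by_cases hi : i = out
      · rw [if_pos hi, if_neg (by omega), if_pos hi]
      · rw [if_neg hi, if_neg hi]) rfl
  have e3 : (s.set out (unary D (g (h x)))).setBlock (fresh + m) (m - m)
      (fun i => vec (h x) (i + m)) = s.set out (unary D (g (h x))) := Store.ext (fun i => by
    simp only [Store.setBlock]; rw [if_neg (by omega)]) rfl
  rw [e1] at r1
  rw [e2] at r2
  rw [e3] at r3
  exact ((r1.seq r2).seq r3).mono (by dsimp only; omega)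

/-- The values of a primitive recursion. -/
def recValue (g : α → ℕ) (h : (α × ℕ) × ℕ → ℕ) (x : α) (n : ℕ) : ℕ :=
  Nat.rec (g x) (fun i r => h ((x, i), r)) n

/-- The current value is kept in `fresh`, the index in `fresh + 1`, the next value in `fresh + 2`
and the remaining rounds in `fresh + 3`. The function `b` bounds both the values along the recursion
and the time of each step. -/
theorem primrec {g tg : α → ℕ} (hg : Comp.{u} g tg) {h th : (α × ℕ) × ℕ → ℕ}
    (hh : Comp.{u} h th) {b : α × ℕ → ℕ}
    (hth : ∀ x n i, i < n → th ((x, i), recValue g h x i) ≤ b (x, n))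
    (hb : ∀ x n i, i ≤ n → recValue g h x i ≤ b (x, n)) :
    Comp.{u} (fun p : α × ℕ => recValue g h p.1 p.2)
      fun p => tg p.1 + 7 * p.2 + p.2 * (5 * b p + 4) + 2 * b p + 10 := by
  obtain ⟨G, hG⟩ := hg
  obtain ⟨H, hH⟩ := hh
  set a := arity α with ha
  -- For the step function, the last two arguments are the index and the current value; the others
  -- stay where they were.
  let loc : (ℕ → ℕ) → ℕ → ℕ → ℕ := fun ins fresh j =>
    if j = a + 1 then fresh else if j = a then fresh + 1 else ins j
  refine ⟨fun ins out fresh => seq (seq (seq (seq (G ins fresh (fresh + 4))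
    (copy (ins a) (fresh + 3) (fresh + 4)))
    (each (fresh + 3) (seq (seq (seq (H (loc ins fresh) (fresh + 2) (fresh + 4)) (clear fresh))
      (move (fresh + 2) fresh)) (push (fresh + 1) .sep))))
    (move fresh out)) (clear (fresh + 1)), ?_⟩
  rintro ins out fresh h1 h2 D _ _ s ⟨x, n⟩ h3 h4 h5
  have ha1 : arity (α × ℕ) = a + 1 := rfl
  have hins : ∀ j < a, ins j < fresh ∧ ins j ≠ out := fun j hj => h1 j (by omega)
  have hx : ∀ j < a, s.stack (ins j) = unary D (vec x j) := fun j hj => by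
    rw [h3 j (by omega), vec_prod_of_ne _ hj.ne]
  have hn : s.stack (ins a) = unary D n := by rw [h3 a (by omega), vec_prod_self]
  have hia := h1 a (by omega)
  have r1 := hG ins fresh (fresh + 4) (fun j hj => by have := hins j hj; omega) (by omega) D s x hx
    (h5 _ le_rfl) (fun i hi => h5 i (by omega))
  have r2 := runs_copy (D := D) (i := ins a) (j := fresh + 3) (t := fresh + 4) (n := n)
    (s := s.set fresh (unary D (g x))) (by omega) (by omega) (by omega)
    (by rw [Store.set_stack_of_ne _ _ (by omega), hn])
    (by rw [Store.set_stack_of_ne _ _ (by omega), h5 _ (by omega)])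
    (by rw [Store.set_stack_of_ne _ _ (by omega), h5 _ (by omega)])
  -- The store when `m` rounds remain, hence after `n - m` rounds.
  let I : ℕ → Store D := fun m => ((s.set fresh (unary D (recValue g h x (n - m)))).set (fresh + 1)
    (unary D (n - m))).set (fresh + 3) (unary D m)
  have r3 := runs_each (i := fresh + 3) (c := seq (seq (seq (H (loc ins fresh) (fresh + 2) (fresh + 4))
      (clear fresh)) (move (fresh + 2) fresh)) (push (fresh + 1) .sep)) I (n := n)
    (T := 5 * b (x, n) + 3) (fun m _ => by simp [I]) fun m hm => by
      set i := n - (m + 1) with hi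
      have hval : recValue g h x (n - m) = h ((x, i), recValue g h x i) := by
        have : n - m = i + 1 := by omega
        rw [this]; rfl
      have q1 := hH (loc ins fresh) (fresh + 2) (fresh + 4) (fun j hj => by
          have : j < a + 1 + 1 := hj
          simp only [loc]
          split
          · omega
          · split
            · omega
            · have := hins j (by omega); omega) (by omega) D
        ((I (m + 1)).set (fresh + 3) (unary D m)) ((x, i), recValue g h x i) (fun j hj => by
          have hj' : j < a + 1 + 1 := hj
          by_cases e1 : j = a + 1
          · subst e1
            have : vec ((x, i), recValue g h x i) (a + 1) = recValue g h x i := vec_prod_self _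
            rw [this]
            simp [I, loc, Store.set_stack, ← hi]
          · have v1 : vec ((x, i), recValue g h x i) j = vec (x, i) j := vec_prod_of_ne _ e1
            rw [v1]
            by_cases e2 : j = a
            · subst e2
              rw [vec_prod_self]
              simp [I, loc, Store.set_stack, ← hi]
            · have := hins j (by omega)
              rw [vec_prod_of_ne _ e2, ← hx j (by omega)]
              simp only [loc, if_neg e1, if_neg e2, I, Store.set_stack]
              rw [if_neg (by omega), if_neg (by omega), if_neg (by omega), if_neg (by omega)])
        (by
          simp only [I, Store.set_stack]
          rw [if_neg (by omega), if_neg (by omega), if_neg (by omega), if_neg (by omega),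
            h5 _ (by omega)])
        (fun k hk => by
          simp only [I, Store.set_stack]
          rw [if_neg (by omega), if_neg (by omega), if_neg (by omega), if_neg (by omega),
            h5 _ (by omega)])
      rw [← hval] at q1
      set s1 := ((I (m + 1)).set (fresh + 3) (unary D m)).set (fresh + 2)
        (unary D (recValue g h x (n - m))) with hs1
      have q2 := runs_clear (i := fresh) (n := recValue g h x i) (s := s1) (by
        simp [hs1, I, Store.set_stack, ← hi])
      have q3 := runs_move (i := fresh + 2) (j := fresh) (n := recValue g h x (n - m)) (m := 0)
        (s := s1.set fresh []) (by omega) (by simp [hs1, Store.set_stack]) (by simp)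
      have q4 := runs_push (D := D) (fresh + 1) .sep
        (((s1.set fresh []).set (fresh + 2) []).set fresh (unary D (recValue g h x (n - m) + 0)))
      have b1 := hth x n i (by omega)
      have b2 := hb x n i (by omega)
      have b3 := hb x n (n - m) (by omega)
      refine ((((q1.seq q2).seq q3).seq q4).mono (by omega)).congr (Store.ext (fun k => ?_) rfl)
      have hsucc : unary D (n - m) = Cell.sym .sep :: unary D i := by
        rw [← unary_succ]; congr 1; omega
      have hfr : s.stack (fresh + 2) = [] := h5 _ (by omega)
      simp only [hs1, I, Store.set_stack, Nat.add_zero, ← hi, hsucc]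
      grind
  have r4 := runs_move (i := fresh) (j := out) (n := recValue g h x n) (m := 0) (s := I 0)
    (by omega) (by simp [I, Store.set_stack]) (by
      simp only [I, Store.set_stack]
      rw [if_neg (by omega), if_neg (by omega), if_neg (by omega), h4]; rfl)
  have r5 := runs_clear (i := fresh + 1) (n := n)
    (s := ((I 0).set fresh []).set out (unary D (recValue g h x n + 0))) (by
      simp only [I, Store.set_stack]
      rw [if_neg (by omega), if_neg (by omega), if_neg (by omega), if_true, Nat.sub_zero])
  have b4 := hb x n n le_rfl
  have r3' := r3.congr_left (s := (s.set fresh (unary D (g x))).set (fresh + 3) (unary D n))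
    (Store.ext (fun k => by
      have : s.stack (fresh + 1) = [] := h5 _ (by omega)
      have e : recValue g h x 0 = g x := rfl
      simp only [I, Store.set_stack, Nat.sub_self, unary_zero, e]
      grind) rfl)
  refine (((((r1.seq r2).seq r3').seq r4).seq r5).mono ?_).congr (Store.ext (fun k => ?_) rfl)
  · dsimp only
    rw [show 5 * b (x, n) + 3 + 1 = 5 * b (x, n) + 4 from rfl]
    omega
  · have f0 : s.stack fresh = [] := h5 _ (by omega)
    have f1 : s.stack (fresh + 1) = [] := h5 _ (by omega)
    have f3 : s.stack (fresh + 3) = [] := h5 _ (by omega)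
    simp only [I, Store.set_stack, Nat.add_zero, unary_zero]
    grind

end Comp

/-! ### Functions computable in polynomial time on unary numbers -/

/-- The function `f` is computable in polynomial time and polynomially bounded. -/
def FP {α : Type} [Ctx α] (f : α → ℕ) : Prop :=
  PolyBounded f ∧ ∃ t, PolyBounded t ∧ Comp.{u} f t

/-- All components of `h` are computable in polynomial time. -/
def FPs {α β : Type} [Ctx α] [Ctx β] (h : α → β) : Prop :=
  ∀ j < arity β, FP.{u} fun x => vec (h x) j

namespace FPs

variable {α β : Type} [Ctx α] [Ctx β]

theorem polyBounded_size {h : α → β} (hh : FPs.{u} h) : PolyBounded fun x => size (h x) :=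
  PolyBounded.sum (f := fun j x => vec (h x) j) _ fun j hj => (hh j hj).1

end FPs

namespace FP

variable {α β : Type} [Ctx α] [Ctx β] {f g : α → ℕ}

theorem congr (hf : FP.{u} f) (h : ∀ x, f x = g x) : FP.{u} g := by
  rwa [← (funext h : f = g)]

theorem succ (hf : FP.{u} f) : FP.{u} fun x => f x + 1 := by
  obtain ⟨h1, t, h2, h3⟩ := hf
  exact ⟨h1.add (.const 1), _, h2.add (.const 1), h3.succ⟩

theorem const (n : ℕ) : FP.{u} fun _ : α => n := by
  induction n with
  | zero => exact ⟨.const 0, _, .const 1, .zero⟩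
  | succ n ih => exact ih.succ

theorem var {j : ℕ} (hj : j < arity α) : FP.{u} fun x : α => vec x j := by
  have hb : PolyBounded fun x : α => vec x j := PolyBounded.size.mono fun x => vec_le_size x hj
  exact ⟨hb, _, ((PolyBounded.const 5).mul hb).add (.const 2), .var hj⟩

theorem comp {g : β → ℕ} (hg : FP.{u} g) {h : α → β} (hh : FPs.{u} h) :
    FP.{u} fun x => g (h x) := by
  have hs := hh.polyBounded_size
  obtain ⟨h1, tg, h2, h3⟩ := hg
  refine ⟨h1.comp hs, ?_⟩
  have hh2 := fun j hj => (hh j hj).2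
  choose! t ht1 ht2 using hh2
  -- The sum of the times of the components bounds each of them and is still polynomial.
  have hT : PolyBounded fun x => (Finset.range (arity β)).sum fun j => t j x :=
    PolyBounded.sum _ ht1
  refine ⟨_, ?_, h3.comp (t := fun x => (Finset.range (arity β)).sum fun j => t j x) fun j hj =>
    (ht2 j hj).mono fun x => Finset.single_le_sum (f := fun j => t j x)
      (fun _ _ => Nat.zero_le _) (Finset.mem_range.2 hj)⟩
  exact ((((PolyBounded.const _).mul hT).add (h2.comp hs)).add
    ((PolyBounded.const _).mul (((PolyBounded.const 2).mul hs).add (.const 1)))).add (.const 2)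

theorem snd : FP.{u} fun p : α × ℕ => p.2 :=
  (var (α := α × ℕ) (Nat.lt_succ_self (arity α))).congr vec_prod_self

theorem id : FP.{u} fun n : ℕ => n := var (α := ℕ) (j := 0) Nat.one_pos

end FP

namespace FPs

variable {α β : Type} [Ctx α] [Ctx β]

theorem fst : FPs.{u} fun p : α × ℕ => p.1 := fun _ hj =>
  (FP.var (α := α × ℕ) (Nat.lt_succ_of_lt hj)).congr fun p => vec_prod_of_ne p hj.ne

theorem id : FPs.{u} fun x : α => x := fun _ hj => FP.var hj

theorem of_fp {f : α → ℕ} (hf : FP.{u} f) : FPs.{u} f := fun _ _ => hf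

theorem pair {h : α → β} {k : α → ℕ} (hh : FPs.{u} h) (hk : FP.{u} k) :
    FPs.{u} fun x => (h x, k x) := fun j hj => by
  by_cases e : j = arity β
  · subst e
    exact hk.congr fun x => (vec_prod_self (h x, k x)).symm
  · have : j < arity β + 1 := hj
    exact (hh j (by omega)).congr fun x => (vec_prod_of_ne (h x, k x) e).symm

end FPs

namespace FP

variable {α β : Type} [Ctx α] [Ctx β] {f g : α → ℕ}

theorem comp₂ {op : ℕ → ℕ → ℕ} (h : FP.{u} fun p : ℕ × ℕ => op p.1 p.2) (hf : FP.{u} f)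
    (hg : FP.{u} g) : FP.{u} fun x => op (f x) (g x) :=
  h.comp (h := fun x => (f x, g x)) (.pair (.of_fp hf) hg)

theorem weaken (hf : FP.{u} f) : FP.{u} fun p : α × ℕ => f p.1 := hf.comp .fst

theorem _root_.FPs.weaken {h : α → β} (hh : FPs.{u} h) : FPs.{u} fun p : α × ℕ => h p.1 :=
  fun j hj => (hh j hj).weaken

/-- Iteration may leave the polynomial range, so a polynomial bound on the values has to be assumed.
Given it, every round works on arguments of polynomial size and takes polynomial time. -/
theorem primrec {g : α → ℕ} {h : (α × ℕ) × ℕ → ℕ} (hg : FP.{u} g) (hh : FP.{u} h)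
    (F : α → ℕ → ℕ) (h0 : ∀ x, F x 0 = g x) (h1 : ∀ x n, F x (n + 1) = h ((x, n), F x n))
    (hF : PolyBounded fun p : α × ℕ => F p.1 p.2) : FP.{u} fun p : α × ℕ => F p.1 p.2 := by
  have hrec : ∀ x n, Comp.recValue g h x n = F x n := by
    intro x n
    induction n with
    | zero => exact (h0 x).symm
    | succ n ih => rw [h1, ← ih]; rfl
  refine ⟨hF, ?_⟩
  obtain ⟨-, tg, hg1, hg2⟩ := hg
  obtain ⟨-, th, ⟨c, hc⟩, hh2⟩ := hh
  obtain ⟨d, hd⟩ := hF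
  -- The first summand bounds the time of a step, whose argument consists of `x`, the index and a
  -- value of size at most (size + 2) ^ d. The second bounds the values.
  have hb : PolyBounded fun p : α × ℕ =>
      (size p + (size p + 2) ^ d + 2) ^ c + (size p + 2) ^ d :=
    (((PolyBounded.size.add ((PolyBounded.size.add (.const 2)).pow d)).add (.const 2)).pow c).add
      ((PolyBounded.size.add (.const 2)).pow d)
  have hval : ∀ x n i, i ≤ n → F x i ≤ (size (x, n) + 2) ^ d := fun x n i hi => by
    refine (hd (x, i)).trans (Nat.pow_le_pow_left ?_ d)
    rw [size_prod, size_prod]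
    exact Nat.add_le_add_right (Nat.add_le_add_left hi _) _
  have hcomp := hg2.primrec hh2 (b := fun p : α × ℕ =>
      (size p + (size p + 2) ^ d + 2) ^ c + (size p + 2) ^ d) (fun x n i hi => by
      refine (hc _).trans ((Nat.pow_le_pow_left ?_ c).trans (Nat.le_add_right _ _))
      rw [hrec, size_prod, size_prod]
      have := hval x n i hi.le
      have e : size (x, n) = size x + n := size_prod (x, n)
      dsimp only
      omega) (fun x n i hi => by rw [hrec]; exact (hval x n i hi).trans (Nat.le_add_left _ _))
  simp only [hrec] at hcomp
  have hn : PolyBounded fun p : α × ℕ => p.2 :=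
    PolyBounded.size.mono fun p => by rw [size_prod]; omega
  exact ⟨_, ((((hg1.fst.add ((PolyBounded.const 7).mul hn)).add (hn.mul (((PolyBounded.const 5).mul
    hb).add (.const 4)))).add ((PolyBounded.const 2).mul hb)).add (.const 10)), hcomp⟩

theorem polyBounded_snd : PolyBounded fun p : α × ℕ => p.2 :=
  PolyBounded.size.mono fun p => by rw [size_prod]; omega

theorem add (hf : FP.{u} f) (hg : FP.{u} g) : FP.{u} fun x => f x + g x := by
  refine comp₂ (op := fun a b => a + b) ?_ hf hg
  refine primrec (g := fun x => x) (h := fun p => p.2 + 1) id snd.succ (fun a b => a + b)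
    (fun _ => rfl) (fun _ _ => rfl) (PolyBounded.size.mono fun p => ?_)
  rw [size_prod, size_nat]

theorem mul (hf : FP.{u} f) (hg : FP.{u} g) : FP.{u} fun x => f x * g x := by
  refine comp₂ (op := fun a b => a * b) ?_ hf hg
  refine primrec (g := fun x => 0) (h := fun p => p.2 + p.1.1) (const 0)
    (snd.add id.weaken.weaken) (fun a b => a * b) (fun _ => rfl) (fun _ _ => rfl) ?_
  exact (PolyBounded.size.mono fun p => by rw [size_prod, size_nat]; omega :
    PolyBounded fun p : ℕ × ℕ => p.1).mul polyBounded_snd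

theorem pred (hf : FP.{u} f) : FP.{u} fun x => f x - 1 := by
  have h : FP.{u} fun p : ℕ × ℕ => p.2 - 1 :=
    primrec (g := fun _ => 0) (h := fun p => p.1.2) (const 0) snd.weaken (fun _ b => b - 1)
      (fun _ => rfl) (fun _ _ => rfl) (polyBounded_snd.mono fun p => Nat.sub_le _ _)
  exact h.comp (h := fun x => (f x, f x)) (.pair (.of_fp hf) hf)

theorem sub (hf : FP.{u} f) (hg : FP.{u} g) : FP.{u} fun x => f x - g x := by
  refine comp₂ (op := fun a b => a - b) ?_ hf hg
  refine primrec (g := fun x => x) (h := fun p => p.2 - 1) id snd.pred (fun a b => a - b)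
    (fun _ => rfl) (fun _ _ => rfl) (PolyBounded.size.mono fun p => ?_)
  rw [size_prod, size_nat]; omega

end FP

/-! ### Predicates -/

open Classical in
/-- The truth value of a proposition. -/
noncomputable def truth (p : Prop) : ℕ := if p then 1 else 0

theorem truth_of {p : Prop} (h : p) : truth p = 1 := if_pos h

theorem truth_of_not {p : Prop} (h : ¬ p) : truth p = 0 := if_neg h

theorem truth_le_one (p : Prop) : truth p ≤ 1 := by
  by_cases h : p
  · rw [truth_of h]
  · rw [truth_of_not h]; omega

theorem truth_eq_one {p : Prop} : truth p = 1 ↔ p := by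
  by_cases h : p <;> simp [truth, h]

/-- The predicate `p` is decidable in polynomial time. -/
def FPred {α : Type} [Ctx α] (p : α → Prop) : Prop := FP.{u} fun x => truth (p x)

namespace FPred

variable {α β : Type} [Ctx α] [Ctx β] {p q : α → Prop} {f g : α → ℕ}

theorem congr (hp : FPred.{u} p) (h : ∀ x, p x ↔ q x) : FPred.{u} q := by
  rwa [← (funext fun x => propext (h x) : p = q)]

theorem comp {q : β → Prop} (hq : FPred.{u} q) {h : α → β} (hh : FPs.{u} h) :
    FPred.{u} fun x => q (h x) := FP.comp (g := fun x => truth (q x)) hq hh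

theorem weaken (hp : FPred.{u} p) : FPred.{u} fun x : α × ℕ => p x.1 := hp.comp .fst

theorem not (hp : FPred.{u} p) : FPred.{u} fun x => ¬ p x :=
  ((FP.const 1).sub hp).congr fun x => by
    by_cases h : p x
    · rw [truth_of h, truth_of_not (not_not.2 h)]
    · rw [truth_of h, truth_of_not h]

theorem and (hp : FPred.{u} p) (hq : FPred.{u} q) : FPred.{u} fun x => p x ∧ q x :=
  (FP.mul hp hq).congr fun x => by
    by_cases h : p x <;> by_cases h' : q x <;> simp [truth, h, h']

theorem or (hp : FPred.{u} p) (hq : FPred.{u} q) : FPred.{u} fun x => p x ∨ q x :=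
  (hp.not.and hq.not).not.congr fun x => by tauto

theorem imp (hp : FPred.{u} p) (hq : FPred.{u} q) : FPred.{u} fun x => p x → q x :=
  (hp.not.or hq).congr fun x => by tauto

theorem le (hf : FP.{u} f) (hg : FP.{u} g) : FPred.{u} fun x => f x ≤ g x :=
  ((FP.const 1).sub (hf.sub hg)).congr fun x => by
    by_cases h : f x ≤ g x
    · rw [truth_of h, Nat.sub_eq_zero_of_le h]
    · rw [truth_of_not h]; omega

theorem lt (hf : FP.{u} f) (hg : FP.{u} g) : FPred.{u} fun x => f x < g x := le hf.succ hg

theorem eq (hf : FP.{u} f) (hg : FP.{u} g) : FPred.{u} fun x => f x = g x :=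
  ((le hf hg).and (le hg hf)).congr fun _ => le_antisymm_iff.symm

/-- Primitive recursion on the bound, with the truth value found so far as the value of the
recursion. -/
theorem exists_lt {q : α × ℕ → Prop} (hq : FPred.{u} q) (hf : FP.{u} f) :
    FPred.{u} fun x => ∃ i < f x, q (x, i) := by
  have h : FP.{u} fun p : α × ℕ => truth (∃ i < p.2, q (p.1, i)) := by
    refine FP.primrec (g := fun _ => 0) (h := fun p => truth (p.2 = 1 ∨ q p.1)) (FP.const 0)
      ((eq FP.snd (FP.const 1)).or hq.weaken) (fun x n => truth (∃ i < n, q (x, i)))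
      (fun x => truth_of_not (by simp)) (fun x n => ?_) ((PolyBounded.const 1).mono fun p => truth_le_one _)
    congr 1
    rw [truth_eq_one, eq_iff_iff]
    constructor
    · rintro ⟨i, hi, h⟩
      rcases Nat.lt_succ_iff_lt_or_eq.1 hi with h' | rfl
      exacts [Or.inl ⟨i, h', h⟩, Or.inr h]
    · rintro (⟨i, hi, h⟩ | h)
      exacts [⟨i, by omega, h⟩, ⟨n, by omega, h⟩]
  exact h.comp (h := fun x => (x, f x)) (.pair .id hf)

theorem forall_lt {q : α × ℕ → Prop} (hq : FPred.{u} q) (hf : FP.{u} f) :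
    FPred.{u} fun x => ∀ i < f x, q (x, i) :=
  (hq.not.exists_lt hf).not.congr fun x => by push Not; rfl

end FPred

namespace FP

variable {α β : Type} [Ctx α] [Ctx β] {p : α → Prop} {f g : α → ℕ}

open Classical in
theorem ite (hp : FPred.{u} p) (hf : FP.{u} f) (hg : FP.{u} g) :
    FP.{u} fun x => if p x then f x else g x :=
  ((hp.mul hf).add (hp.not.mul hg)).congr fun x => by
    by_cases h : p x <;> simp [truth, h]

/-- The least number below `n` with the property `p`, or `n` if there is none. -/
noncomputable def search (p : ℕ → Prop) (n : ℕ) : ℕ := sInf {i | i = n ∨ p i}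

theorem search_le (p : ℕ → Prop) (n : ℕ) : search p n ≤ n := Nat.sInf_le (Or.inl rfl)

theorem search_eq {p : ℕ → Prop} {n i : ℕ} (hi : i ≤ n) (h : p i ∨ i = n) (hl : ∀ j < i, ¬ p j) :
    search p n = i := by
  refine le_antisymm (Nat.sInf_le h.symm) ?_
  by_contra hlt
  rw [not_le] at hlt
  rcases Nat.sInf_mem (s := {i | i = n ∨ p i}) ⟨n, Or.inl rfl⟩ with h | h
  · change search p n = n at h; omega
  · exact hl _ hlt h

theorem search_spec (p : ℕ → Prop) (n : ℕ) : search p n = n ∨ p (search p n) :=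
  Nat.sInf_mem (s := {i | i = n ∨ p i}) ⟨n, Or.inl rfl⟩

theorem not_of_lt_search {p : ℕ → Prop} {n i : ℕ} (h : i < search p n) : ¬ p i := fun hp =>
  absurd (Nat.sInf_le (s := {i | i = n ∨ p i}) (Or.inr hp)) (not_le.2 h)

open Classical in
-- The recursion needs no flag. A search up to `n` that failed returns `n` itself, so testing `q` at
-- the returned value either confirms an earlier success or tests the new candidate `n`.
theorem search_lt {q : α × ℕ → Prop} (hq : FPred.{u} q) (hf : FP.{u} f) :
    FP.{u} fun x => search (fun i => q (x, i)) (f x) := by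
  have h : FP.{u} fun p : α × ℕ => search (fun i => q (p.1, i)) p.2 := by
    refine primrec (g := fun _ => 0) (h := fun p => if q (p.1.1, p.2) then p.2 else p.1.2 + 1)
      (const 0) (ite (hq.comp (.pair FPs.fst.weaken snd)) snd snd.weaken.succ)
      (fun x n => search (fun i => q (x, i)) n)
      (fun x => Nat.le_zero.1 (search_le _ _)) (fun x n => ?_)
      (polyBounded_snd.mono fun p => search_le _ _)
    dsimp only
    split
    · next h =>
      exact search_eq (p := fun i => q (x, i)) ((search_le _ _).trans (Nat.le_succ n)) (Or.inl h)
        fun j hj => not_of_lt_search hj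
    · next h =>
      have hn := (search_spec (fun i => q (x, i)) n).resolve_right h
      refine search_eq le_rfl (Or.inr rfl) fun j hj => ?_
      rcases Nat.lt_succ_iff_lt_or_eq.1 hj with h' | rfl
      · exact not_of_lt_search (n := n) (p := fun i => q (x, i)) (by rw [hn]; exact h')
      · rwa [hn] at h
  exact h.comp (h := fun x => (x, f x)) (.pair .id hf)

theorem div (hf : FP.{u} f) (hg : FP.{u} g) : FP.{u} fun x => f x / g x := by
  classical
  -- The quotient is the least j with f x < (j + 1) * g x; a zero divisor is treated separately, to
  -- agree with division by zero in ℕ.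
  refine (ite (FPred.eq hg (const 0)) (const 0) (search_lt (q := fun p : α × ℕ => f p.1 < (p.2 + 1) * g p.1)
    (FPred.lt hf.weaken (snd.succ.mul hg.weaken)) hf)).congr fun x => ?_
  split
  · next h => rw [h, Nat.div_zero]
  · next h =>
    have hpos : 0 < g x := Nat.pos_of_ne_zero h
    refine search_eq (Nat.div_le_self _ _) (Or.inl ?_) fun j hj => ?_
    · have := Nat.lt_succ_iff.2 (le_refl (f x / g x))
      exact (Nat.div_lt_iff_lt_mul hpos).1 this
    · rw [not_lt, ← Nat.le_div_iff_mul_le hpos]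
      exact hj

theorem mod (hf : FP.{u} f) (hg : FP.{u} g) : FP.{u} fun x => f x % g x :=
  (hf.sub (hg.mul (hf.div hg))).congr fun x => by
    have := Nat.div_add_mod (f x) (g x); omega

/-- The digit of `m` in base `b` at position `i`. -/
def _root_.digit (b m i : ℕ) : ℕ := m / b ^ i % b

theorem digit {h : α → ℕ} (hf : FP.{u} f) (hg : FP.{u} g) (hh : FP.{u} h) :
    FP.{u} fun x => _root_.digit (f x) (g x) (h x) := by
  -- The power of the base need not be polynomially bounded, so it is never computed. Repeated
  -- division gives the same result and only decreases.
  have key : FP.{u} fun p : (ℕ × ℕ) × ℕ => p.1.2 / p.1.1 ^ p.2 := by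
    refine primrec (g := fun p : ℕ × ℕ => p.2) (h := fun p => p.2 / p.1.1.1) snd
      (snd.div id.weaken.weaken.weaken) (fun x n => x.2 / x.1 ^ n) (fun x => by simp)
      (fun x n => by rw [pow_succ, Nat.div_div_eq_div_mul]) (PolyBounded.size.mono fun p => ?_)
    rw [size_prod, size_prod]
    have := Nat.div_le_self p.1.2 (p.1.1 ^ p.2)
    omega
  exact (key.comp (h := fun x => ((f x, g x), h x)) (.pair (.pair (.of_fp hf) hg) hh)).mod hf

end FP

/-! ### Arrays of letters on stacks -/

/-- The letters `L k, …, L (k + n - 1)`, the first one on top. -/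
def letterSegment (D : Type u) (L : ℕ → Letter) : ℕ → ℕ → List (Cell D)
  | _, 0 => []
  | k, n + 1 => Cell.sym (L k) :: letterSegment D L (k + 1) n

/-- The letters `L 0, …, L (n - 1)`, the last one on top. -/
def revSegment (D : Type u) (L : ℕ → Letter) : ℕ → List (Cell D)
  | 0 => []
  | n + 1 => Cell.sym (L n) :: revSegment D L n

namespace Cmd

variable {D : Type u} [AddGroup D] [LinearOrder D]

theorem runs_loop_segment {i n T : ℕ} {r : Fin 4} {f : Letter → Cmd} {g : Cmd} {L : ℕ → Letter}
    (I : ℕ → Store D) (hI : ∀ k ≤ n, (I k).stack i = letterSegment D L k (n - k))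
    (hf : ∀ k < n, Runs (f (L k)) ((I k).set i (letterSegment D L (k + 1) (n - (k + 1)))) T (I (k + 1))) :
    Runs (loop i r f g) (I 0) (n * (T + 1) + 1) (I n) := by
  have key : ∀ m ≤ n, Runs (loop i r f g) (I (n - m)) (m * (T + 1) + 1) (I n) := by
    intro m
    induction m with
    | zero =>
      intro _
      have := hI n le_rfl
      rw [Nat.sub_self] at this
      exact ⟨1, by omega, .loop_nil this⟩
    | succ m ih =>
      intro hm
      obtain ⟨a, ha, he⟩ := hf (n - (m + 1)) (by omega)
      obtain ⟨b, hb, he'⟩ := ih (by omega)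
      have e1 : n - (m + 1) + 1 = n - m := by omega
      have h := hI (n - (m + 1)) (by omega)
      have e2 : n - (n - (m + 1)) = n - (n - (m + 1) + 1) + 1 := by omega
      rw [e2] at h
      rw [e1] at he
      refine ⟨a + b + 1, ?_, .loop_sym h (by rw [e1]; exact he) he'⟩
      rw [Nat.succ_mul]; omega
  have := key n le_rfl
  rwa [Nat.sub_self] at this

theorem runs_loop_revSegment {i n T : ℕ} {r : Fin 4} {f : Letter → Cmd} {g : Cmd} {L : ℕ → Letter}
    (I : ℕ → Store D) (hI : ∀ k ≤ n, (I k).stack i = revSegment D L k)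
    (hf : ∀ k < n, Runs (f (L k)) ((I (k + 1)).set i (revSegment D L k)) T (I k)) :
    Runs (loop i r f g) (I n) (n * (T + 1) + 1) (I 0) := by
  induction n with
  | zero => exact ⟨1, by omega, .loop_nil (hI 0 le_rfl)⟩
  | succ n ih =>
    obtain ⟨m, hm, he⟩ := hf n (Nat.lt_succ_self n)
    obtain ⟨m', hm', he'⟩ := ih (fun m h => hI m (by omega)) fun m h => hf m (by omega)
    refine ⟨m + m' + 1, ?_, .loop_sym (hI (n + 1) le_rfl) he he'⟩
    rw [Nat.succ_mul]; omega

theorem runs_clear_segment {i n : ℕ} {L : ℕ → Letter} {s : Store D}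
    (h : s.stack i = letterSegment D L 0 n) : Runs (clear i) s (2 * n + 1) (s.set i []) := by
  have := runs_loop_segment (i := i) (n := n) (T := 1) (r := 0) (f := fun _ => skip) (g := skip)
    (L := L) (fun k => s.set i (letterSegment D L k (n - k))) (fun k _ => by simp)
    (fun k _ => (runs_skip _).congr
      (Store.ext (fun j => by simp only [Store.set_stack]; split <;> rfl) rfl))
  refine ((this.mono (by omega)).congr_left ?_).congr ?_
  · exact Store.ext (fun j => by simp only [Store.set_stack, Nat.sub_zero]; split <;> simp_all) rfl
  · rw [Nat.sub_self]; rfl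

/-- Move the letters of stack `i` to stack `j`. -/
def unload (i j : ℕ) : Cmd := loop i 0 (fun a => push j a) skip

theorem runs_unload {i j n : ℕ} {L : ℕ → Letter} {s : Store D} (hij : i ≠ j)
    (h : s.stack i = revSegment D L n) (hj : s.stack j = []) :
    Runs (unload i j) s (2 * n + 1) ((s.set i []).set j (letterSegment D L 0 n)) := by
  have := runs_loop_revSegment (i := i) (n := n) (T := 1) (r := 0) (f := fun a => push j a)
    (g := skip) (L := L)
    (fun k => (s.set i (revSegment D L k)).set j (letterSegment D L k (n - k)))
    (fun k _ => by simp [Store.set_stack, hij]) (fun k hk => (runs_push _ _ _).congr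
      (Store.ext (fun l => by
        have e : letterSegment D L k (n - k) = Cell.sym (L k) :: letterSegment D L (k + 1) (n - (k + 1)) := by
          have : n - k = n - (k + 1) + 1 := by omega
          rw [this]; rfl
        simp only [Store.set_stack, e]
        grind) rfl))
  refine ((this.mono (by omega)).congr_left ?_).congr rfl
  exact Store.ext (fun l => by
    rw [Nat.sub_self]
    simp only [Store.set_stack, letterSegment]
    grind) rfl

end Cmd

open Classical in
/-- The array of the truth values of `A`. -/
noncomputable def truthBits (A : ℕ → Prop) (i : ℕ) : Letter := .bit (decide (A i))

/-! ### Searching an array -/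

/-- The number of entries below `n` with property `q` that are marked in `A`. -/
noncomputable def hits (A q : ℕ → Prop) : ℕ → ℕ
  | 0 => 0
  | n + 1 => hits A q n + truth (A n ∧ q n)

theorem hits_le (A q : ℕ → Prop) (n : ℕ) : hits A q n ≤ n := by
  induction n with
  | zero => exact le_rfl
  | succ n ih => have := truth_le_one (A n ∧ q n); rw [hits]; omega

theorem hits_pos (A q : ℕ → Prop) (n : ℕ) : 0 < hits A q n ↔ ∃ i < n, A i ∧ q i := by
  induction n with
  | zero => simp [hits]
  | succ n ih =>
    rw [hits]
    constructor
    · intro h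
      by_cases h' : A n ∧ q n
      · exact ⟨n, Nat.lt_succ_self n, h'⟩
      · rw [truth_of_not h', Nat.add_zero, ih] at h
        obtain ⟨i, hi, h⟩ := h
        exact ⟨i, by omega, h⟩
    · rintro ⟨i, hi, h⟩
      rcases Nat.lt_succ_iff_lt_or_eq.1 hi with h' | rfl
      · have := ih.2 ⟨i, h', h⟩; omega
      · rw [truth_of h]; omega

namespace Cmd

/-- Add to stack `b + 3` the number of marked entries of the array on stack `b` for which `P` yields
`1`. The program `P` computes a truth value from the tuple in the stacks `ins` and the index of the
entry. -/
def scan (P : (ℕ → ℕ) → ℕ → ℕ → Cmd) (a : ℕ) (ins : ℕ → ℕ) (b F : ℕ) : Cmd :=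
  seq (seq (loop b 0 (fun l => match l with
      | .bit true => seq (seq (push (b + 1) l)
          (seq (P (fun j => if j = a then b + 2 else ins j) (b + 4) F) (move (b + 4) (b + 3))))
          (push (b + 2) .sep)
      | _ => seq (push (b + 1) l) (push (b + 2) .sep)) skip)
    (unload (b + 1) b)) (clear (b + 2))

variable {D : Type u} [AddGroup D] [LinearOrder D]

/-- During the scan, `b` holds the entries still to be read, `b + 1` the entries already read in
reverse, `b + 2` the index, `b + 3` the count and `b + 4` the truth value just computed. At the end
the array is moved back, so that it can be scanned again. -/
theorem runs_scan {β : Type} [Ctx β] {q : β × ℕ → Prop} {P : (ℕ → ℕ) → ℕ → ℕ → Cmd}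
    {t : β × ℕ → ℕ} (hP : Computes.{u} P (fun p => truth (q p)) t) {ins : ℕ → ℕ} {b F : ℕ}
    (hF : b + 5 ≤ F) (hins : ∀ j < arity β, ins j < F ∧ (ins j < b ∨ b + 5 ≤ ins j)) {s : Store D}
    {y : β} (hy : Holds s ins y) {A : ℕ → Prop} {n T : ℕ}
    (hA : s.stack b = letterSegment D (truthBits A) 0 n)
    (h1 : s.stack (b + 1) = []) (h2 : s.stack (b + 2) = []) (h3 : s.stack (b + 3) = [])
    (h4 : s.stack (b + 4) = []) (h5 : ∀ i ≥ F, s.stack i = []) (hT : ∀ i < n, t (y, i) ≤ T) :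
    Runs (scan P (arity β) ins b F) s (n * (T + 10) + 10)
      (s.set (b + 3) (unary D (hits A (fun i => q (y, i)) n))) := by
  set H := hits A (fun i => q (y, i)) with hH
  let I : ℕ → Store D := fun k => (((s.set b (letterSegment D (truthBits A) k (n - k))).set (b + 1)
    (revSegment D (truthBits A) k)).set (b + 2) (unary D k)).set (b + 3) (unary D (H k))
  have r1 := runs_loop_segment (i := b) (n := n) (T := T + 5) (r := 0) (f := fun l => match l with
      | .bit true => seq (seq (push (b + 1) l)
          (seq (P (fun j => if j = arity β then b + 2 else ins j) (b + 4) F) (move (b + 4) (b + 3))))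
          (push (b + 2) .sep)
      | _ => seq (push (b + 1) l) (push (b + 2) .sep)) (g := skip) (L := truthBits A) I
    (fun k hk => by simp [I, Store.set_stack]) (fun k hk => by
      by_cases hAk : A k
      · have hbit : truthBits A k = .bit true := by simp [truthBits, hAk]
        have hHk : H (k + 1) = truth (q (y, k)) + H k := by
          rw [hH, hits, Nat.add_comm]
          congr 1
          by_cases hq : q (y, k) <;> simp [truth, hq, hAk]
        simp only [hbit]
        set s1 := ((I k).set b (letterSegment D (truthBits A) (k + 1) (n - (k + 1)))).set (b + 1)
          (Cell.sym (.bit true) :: revSegment D (truthBits A) k) with hs1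
        have q1 := runs_push (D := D) (b + 1) (.bit true)
          ((I k).set b (letterSegment D (truthBits A) (k + 1) (n - (k + 1))))
        have e1 : ((I k).set b (letterSegment D (truthBits A) (k + 1) (n - (k + 1)))).stack (b + 1) =
            revSegment D (truthBits A) k := by simp [I, Store.set_stack]
        rw [e1] at q1
        have q2 := hP (fun j => if j = arity β then b + 2 else ins j) (b + 4) F (fun j hj => by
          by_cases e : j = arity β
          · simp only [e, if_true]; omega
          · have hj' : j < arity β + 1 := hj
            have := hins j (by omega)
            simp only [e, if_false]; omega) (by omega) D s1 (y, k) (fun j hj => by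
          by_cases e : j = arity β
          · subst e
            rw [vec_prod_self]
            simp [hs1, I, Store.set_stack]
          · have hj' : j < arity β + 1 := hj
            have := hins j (by omega)
            rw [vec_prod_of_ne _ e, ← hy j (by omega)]
            simp only [e, if_false, hs1, I, Store.set_stack]
            rw [if_neg (by omega), if_neg (by omega), if_neg (by omega), if_neg (by omega),
              if_neg (by omega), if_neg (by omega)])
          (by simp [hs1, I, Store.set_stack, h4])
          (fun i hi => by
            simp only [hs1, I, Store.set_stack]
            rw [if_neg (by omega), if_neg (by omega), if_neg (by omega), if_neg (by omega),
              if_neg (by omega), if_neg (by omega), h5 i hi])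
        have q3 := runs_move (i := b + 4) (j := b + 3) (n := truth (q (y, k))) (m := H k)
          (s := s1.set (b + 4) (unary D (truth (q (y, k))))) (by omega) (by simp)
          (by simp [hs1, I, Store.set_stack])
        have ht := hT k hk
        have htr := truth_le_one (q (y, k))
        refine (((q1.seq (q2.seq q3)).seq (runs_push _ _ _)).mono (by omega)).congr
          (Store.ext (fun j => ?_) rfl)
        simp only [hs1, I, Store.set_stack, hHk, revSegment, hbit, unary_succ]
        grind
      · have hbit : truthBits A k = .bit false := by simp [truthBits, hAk]
        have hHk : H (k + 1) = H k := by
          rw [hH, hits, truth_of_not (fun h => hAk h.1)]; rfl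
        simp only [hbit]
        refine (((runs_push _ _ _).seq (runs_push _ _ _)).mono (by omega)).congr
          (Store.ext (fun j => ?_) rfl)
        simp only [I, Store.set_stack, hHk, revSegment, hbit, unary_succ]
        grind)
  have r2 := runs_unload (i := b + 1) (j := b) (n := n) (L := truthBits A) (s := I n) (by omega)
    (by simp [I, Store.set_stack]) (by simp [I, Store.set_stack, letterSegment])
  have r3 := runs_clear (i := b + 2) (n := n)
    (s := ((I n).set (b + 1) []).set b (letterSegment D (truthBits A) 0 n))
    (by simp [I, Store.set_stack])
  have r1' := r1.congr_left (s := s) (Store.ext (fun j => by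
    simp only [I, Store.set_stack, Nat.sub_zero, revSegment, unary_zero, hH, hits]
    grind) rfl)
  refine (((r1'.seq r2).seq r3).mono ?_).congr (Store.ext (fun j => ?_) rfl)
  · have : n * (T + 10) = n * (T + 5 + 1) + 4 * n := by ring
    omega
  · simp only [I, Store.set_stack]
    grind

/-- Replace the number in stack `b + 3` by a truth value that is pushed to stack `b + 5`. -/
def emit (P P' : (ℕ → ℕ) → ℕ → ℕ → Cmd) (b F : ℕ) : Cmd :=
  seq (seq (seq (seq (P (fun _ => b + 3) (b + 4) F) (each (b + 4) (push (b + 5) (.bit true))))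
    (P' (fun _ => b + 3) (b + 4) F)) (each (b + 4) (push (b + 5) (.bit false)))) (clear (b + 3))

open Classical in
-- A truth value in unary serves as a conditional: the loop over it runs its body once or not at
-- all.
theorem runs_each_truth {i j : ℕ} {a : Letter} {p : Prop} {s : Store D} (hij : i ≠ j)
    (h : s.stack i = unary D (truth p)) :
    Runs (each i (push j a)) s 3 (if p then (s.set i []).set j (Cell.sym a :: s.stack j)
      else s.set i []) := by
  by_cases hp : p
  · rw [truth_of hp] at h
    rw [if_pos hp]
    have h1 : Runs (each i (push j a)) s 3 _ :=
      ⟨1 + 1 + 1, le_rfl, .loop_sym h (.push j a _) (.loop_nil (by simp [Store.set_stack, hij]))⟩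
    exact h1.congr (Store.ext (fun k => by simp only [Store.set_stack]; grind) rfl)
  · rw [truth_of_not hp] at h
    rw [if_neg hp]
    have h1 : Runs (each i (push j a)) s 3 s := ⟨1, by omega, .loop_nil h⟩
    exact h1.congr (Store.ext (fun k => by simp only [Store.set_stack]; grind [unary_zero]) rfl)

/-- Exactly one of the two complementary tests succeeds, so exactly one letter is pushed. -/
theorem runs_emit {P P' : (ℕ → ℕ) → ℕ → ℕ → Cmd} {t t' : ℕ → ℕ}
    (hP : Computes.{u} P (fun n => truth (0 < n)) t)
    (hP' : Computes.{u} P' (fun n => truth (n = 0)) t') {b F : ℕ} (hF : b + 5 < F) {s : Store D}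
    {A : ℕ → Prop} {m c : ℕ} (hA : A c ↔ 0 < m)
    (h3 : s.stack (b + 3) = unary D m) (h4 : s.stack (b + 4) = [])
    (h5 : s.stack (b + 5) = revSegment D (truthBits A) c) (hs : ∀ i ≥ F, s.stack i = []) :
    Runs (emit P P' b F) s (t m + t' m + 2 * m + 7)
      ((s.set (b + 3) []).set (b + 5) (revSegment D (truthBits A) (c + 1))) := by
  have q1 := hP (fun _ => b + 3) (b + 4) F (fun _ _ => by omega) (by omega) D s m
    (fun j _ => h3) h4 hs
  have q2 := runs_each_truth (i := b + 4) (j := b + 5) (a := .bit true) (p := 0 < m)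
    (s := s.set (b + 4) (unary D (truth (0 < m)))) (by omega) (by simp)
  have q5 : ∀ l, Runs (clear (b + 3)) ((s.set (b + 4) []).set (b + 5) l) (2 * m + 1)
      (((s.set (b + 4) []).set (b + 5) l).set (b + 3) []) := fun l =>
    runs_clear (by simp [Store.set_stack, h3])
  have q3 : ∀ l, Runs (P' (fun _ => b + 3) (b + 4) F) ((s.set (b + 4) []).set (b + 5) l) (t' m)
      (((s.set (b + 4) []).set (b + 5) l).set (b + 4) (unary D (truth (m = 0)))) := fun l =>
    hP' (fun _ => b + 3) (b + 4) F (fun _ _ => by omega) (by omega) D _ m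
      (fun j _ => by simp only [Store.set_stack, vec_nat]; rw [if_neg (by omega), if_neg (by omega), h3])
      (by simp [Store.set_stack]) (fun i hi => by
        simp only [Store.set_stack]; rw [if_neg (by omega), if_neg (by omega), hs i hi])
  have q4 : ∀ l, Runs (each (b + 4) (push (b + 5) (.bit false)))
      (((s.set (b + 4) []).set (b + 5) l).set (b + 4) (unary D (truth (m = 0)))) 3
      ((s.set (b + 4) []).set (b + 5) (if m = 0 then Cell.sym (.bit false) :: l else l)) := fun l => by
    refine (runs_each_truth (p := m = 0) (by omega) (by simp)).congr ?_
    by_cases hm : m = 0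
    · simp only [if_pos hm]
      exact Store.ext (fun k => by simp only [Store.set_stack]; grind) rfl
    · simp only [if_neg hm]
      exact Store.ext (fun k => by simp only [Store.set_stack]; grind) rfl
  set l := if 0 < m then Cell.sym (.bit true) :: s.stack (b + 5) else s.stack (b + 5) with hl
  have q2' := q2.congr (s₂ := (s.set (b + 4) []).set (b + 5) l) (Store.ext (fun k => by
    by_cases hm : 0 < m
    · simp only [hl, if_pos hm, Store.set_stack]; grind
    · simp only [hl, if_neg hm, Store.set_stack]; grind) (by split <;> rfl))
  have hrev : revSegment D (truthBits A) (c + 1) =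
      if m = 0 then Cell.sym (.bit false) :: l else l := by
    rw [hl, h5, revSegment, truthBits]
    by_cases hm : m = 0
    · have : ¬ A c := by rw [hA]; omega
      simp [hm, this]
    · have h' : A c := by rw [hA]; omega
      have h'' : 0 < m := by omega
      simp [hm, h', h'']
  refine (((((q1.seq q2').seq (q3 l)).seq (q4 l)).seq (q5 _)).mono (by omega)).congr
    (Store.ext (fun k => ?_) rfl)
  rw [hrev]
  simp only [Store.set_stack]
  grind

/-- Replace the array on stack `b` by the array of those indices `c`, less than the number in stack
`i`, for which the program `C` writes a positive number to stack `b + 3`. The index is in stack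
`b + 6`. -/
def build (C : Cmd) (P P' : (ℕ → ℕ) → ℕ → ℕ → Cmd) (i b F : ℕ) : Cmd :=
  seq (seq (seq (seq (copy i (b + 7) F)
    (each (b + 7) (seq (seq C (emit P P' b F)) (push (b + 6) .sep))))
    (clear (b + 6))) (clear b)) (unload (b + 5) b)

/-- The new array grows in reverse on `b + 5`, with the index in `b + 6` and the countdown in `b +
7`, while the old array stays available on `b`. For this reason `C` must work on every store that
differs from `s` only in these three stacks. -/
theorem runs_build {P P' : (ℕ → ℕ) → ℕ → ℕ → Cmd} {t t' : ℕ → ℕ}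
    (hP : Computes.{u} P (fun n => truth (0 < n)) t)
    (hP' : Computes.{u} P' (fun n => truth (n = 0)) t') {b F i : ℕ} (hF : b + 7 < F) (hi : i < b)
    {s : Store D} {L : ℕ → Letter} {A : ℕ → Prop} {C : Cmd} {M N T T' : ℕ} {m : ℕ → ℕ}
    (hM : s.stack i = unary D M) (h0 : s.stack b = letterSegment D L 0 N)
    (h3 : s.stack (b + 3) = []) (h4 : s.stack (b + 4) = []) (h5 : s.stack (b + 5) = [])
    (h6 : s.stack (b + 6) = []) (h7 : s.stack (b + 7) = []) (hs : ∀ i ≥ F, s.stack i = [])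
    (hC : ∀ s' : Store D, s'.reg = s.reg → (∀ j, j ≠ b + 5 → j ≠ b + 6 → j ≠ b + 7 →
      s'.stack j = s.stack j) → ∀ c < M, s'.stack (b + 6) = unary D c →
      Runs C s' T (s'.set (b + 3) (unary D (m c))))
    (hA : ∀ c < M, A c ↔ 0 < m c) (hT : ∀ c < M, t (m c) + t' (m c) + 2 * m c + 7 ≤ T') :
    Runs (build C P P' i b F) s (M * (T + T' + 13) + 2 * N + 7)
      (s.set b (letterSegment D (truthBits A) 0 M)) := by
  let I : ℕ → Store D := fun l => ((s.set (b + 7) (unary D l)).set (b + 6) (unary D (M - l))).set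
    (b + 5) (revSegment D (truthBits A) (M - l))
  have r1 := runs_copy (i := i) (j := b + 7) (t := F) (n := M) (by omega) (by omega) (by omega) hM h7
    (hs F le_rfl)
  have r2 := runs_each (i := b + 7) (c := seq (seq C (emit P P' b F)) (push (b + 6) .sep))
    (n := M) (T := T + T' + 1) I (fun l _ => by simp [I, Store.set_stack]) (fun l hl => by
      have hc : M - (l + 1) < M := by omega
      have e : M - l = M - (l + 1) + 1 := by omega
      have c1 := hC ((I (l + 1)).set (b + 7) (unary D l)) rfl (fun j h1 h2 h3 => by
        simp only [I, Store.set_stack, if_neg h1, if_neg h2, if_neg h3]) _ hc (by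
        simp [I, Store.set_stack])
      have c2 := runs_emit hP hP' (b := b) (F := F) (by omega) (A := A) (hA _ hc)
        (s := ((I (l + 1)).set (b + 7) (unary D l)).set (b + 3) (unary D (m (M - (l + 1)))))
        (by simp) (by simp [I, Store.set_stack, h4]) (by simp [I, Store.set_stack])
        (fun j hj => by
          simp only [I, Store.set_stack]
          rw [if_neg (by omega), if_neg (by omega), if_neg (by omega), if_neg (by omega),
            if_neg (by omega), hs j hj])
      refine (((c1.seq (c2.mono (hT _ hc))).seq (runs_push _ _ _))).congr
        (Store.ext (fun j => ?_) rfl)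
      simp only [I, Store.set_stack, e, unary_succ]
      grind)
  have r2' := r2.congr_left (s := s.set (b + 7) (unary D M)) (Store.ext (fun j => by
    simp only [I, Store.set_stack, Nat.sub_self, unary_zero, revSegment]
    grind) rfl)
  have r3 := runs_clear (i := b + 6) (n := M) (s := I 0) (by simp [I, Store.set_stack])
  have r4 := runs_clear_segment (i := b) (n := N) (L := L) (s := (I 0).set (b + 6) [])
    (by simp [I, Store.set_stack, h0])
  have r5 := runs_unload (i := b + 5) (j := b) (n := M) (L := truthBits A)
    (s := ((I 0).set (b + 6) []).set b []) (by omega) (by simp [I, Store.set_stack])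
    (by simp)
  refine (((((r1.seq r2').seq r3).seq r4).seq r5).mono ?_).congr (Store.ext (fun j => ?_) rfl)
  · have : M * (T + T' + 13) = M * (T + T' + 1 + 1) + 11 * M := by ring
    omega
  · simp only [I, Store.set_stack, unary_zero]
    grind

end Cmd

/-! ### Reachability -/

/-- The indices below `M` that are reached from `init` in `t` steps. -/
def Reached (init : ℕ → Prop) (step : ℕ → ℕ → Prop) (M : ℕ) : ℕ → ℕ → Prop
  | 0, c => init c
  | t + 1, c' => ∃ c < M, Reached init step M t c ∧ step c c'

namespace Cmd

/-- Decide whether an index with property `B` is reached from the set decided by `I`, by as many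
steps, decided by `S`, as the number in stack `ins a` says. -/
def reach (I S B P P' : (ℕ → ℕ) → ℕ → ℕ → Cmd) (a : ℕ) (ins : ℕ → ℕ) (out b : ℕ) : Cmd :=
  seq (seq (seq (seq (seq (seq
    (build (I (fun j => if j = a then b + 6 else ins j) (b + 3) (b + 9)) P P' (ins a) b (b + 9))
    (copy (ins a) (b + 8) (b + 9)))
    (each (b + 8) (build (scan S (a + 1) (fun j => if j = a then b + 6 else ins j) b (b + 9))
      P P' (ins a) b (b + 9))))
    (scan B a ins b (b + 9)))
    (P (fun _ => b + 3) out (b + 9)))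
    (clear (b + 3))) (clear b)

variable {α : Type} [Ctx α] {init : α × ℕ → Prop} {step : (α × ℕ) × ℕ → Prop} {bad : α × ℕ → Prop}

/-- There are `M` rounds. Each builds an array of `M` entries, and each entry requires a scan of the
previous array of `M` entries, so the time is cubic in `M` up to the cost of the single tests. -/
theorem computes_reach {I S B P P' : (ℕ → ℕ) → ℕ → ℕ → Cmd} {tI tB : α × ℕ → ℕ}
    {tS : (α × ℕ) × ℕ → ℕ} {t t' : ℕ → ℕ} (hI : Computes.{u} I (fun p => truth (init p)) tI)
    (hS : Computes.{u} S (fun p => truth (step p)) tS)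
    (hB : Computes.{u} B (fun p => truth (bad p)) tB)
    (hP : Computes.{u} P (fun n => truth (0 < n)) t)
    (hP' : Computes.{u} P' (fun n => truth (n = 0)) t') {T T' : α × ℕ → ℕ}
    (hTI : ∀ x M, ∀ c < M, tI (x, c) ≤ T (x, M)) (hTB : ∀ x M, ∀ c < M, tB (x, c) ≤ T (x, M))
    (hTS : ∀ x M, ∀ c < M, ∀ c' < M, tS ((x, c'), c) ≤ T (x, M))
    (hT' : ∀ x M, ∀ m ≤ M, t m + t' m + 2 * m + 7 ≤ T' (x, M)) :
    Computes.{u} (reach I S B P P' (arity α)) (fun p : α × ℕ => truth (∃ c < p.2,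
      Reached (fun c => init (p.1, c)) (fun c c' => step ((p.1, c'), c)) p.2 p.2 c ∧ bad (p.1, c)))
      (fun p => p.2 * (T p + T' p + 13) + p.2 * (p.2 * (p.2 * (T p + 10) + T' p + 23) + 2 * p.2 + 8) +
        p.2 * (T p + 10) + T' p + 9 * p.2 + 30) := by
  intro ins out b h1 h2 D _ _ s p hy ho hb
  obtain ⟨x, M⟩ := p
  have ha : ∀ j < arity α + 1, ins j < b ∧ ins j ≠ out := h1
  have hx : Holds s ins x := fun j hj => by
    have := hy j (Nat.lt_succ_of_lt hj)
    rwa [vec_prod_of_ne _ (by omega)] at this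
  have hM : s.stack (ins (arity α)) = unary D M := by
    have := hy (arity α) (Nat.lt_succ_self _)
    rwa [vec_prod_self] at this
  have hi := (ha (arity α) (by omega)).1
  have hi' := (ha (arity α) (by omega)).2
  set A := Reached (fun c => init (x, c)) (fun c c' => step ((x, c'), c)) M with hA
  have r1 := runs_build hP hP' (b := b) (F := b + 9) (i := ins (arity α)) (by omega) hi (s := s)
    (L := truthBits (A 0)) (A := A 0) (C := I (fun j => if j = arity α then b + 6 else ins j) (b + 3)
      (b + 9)) (M := M) (N := 0) (T := T (x, M)) (T' := T' (x, M)) (m := fun c => truth (init (x, c)))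
    hM (hb b le_rfl) (hb _ (by omega)) (hb _ (by omega)) (hb _ (by omega)) (hb _ (by omega))
    (hb _ (by omega)) (fun i hi => hb i (by omega)) (fun s' _ hs' c hc h6 => by
      refine (hI (fun j => if j = arity α then b + 6 else ins j) (b + 3) (b + 9) (fun j hj => ?_)
        (by omega) D s' (x, c) (fun j hj => ?_) ?_ fun i hi => ?_).mono (hTI x M c hc)
      · have := ha j hj
        by_cases e : j = arity α
        · simp only [e, if_true]; omega
        · simp only [e, if_false]; omega
      · by_cases e : j = arity α
        · subst e
          rw [vec_prod_self]
          simpa using h6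
        · have hj' : j < arity α + 1 := hj
          have := (ha j hj').1
          rw [vec_prod_of_ne _ e, ← hx j (by omega)]
          simp only [e, if_false]
          exact hs' _ (by omega) (by omega) (by omega)
      · rw [hs' _ (by omega) (by omega) (by omega), hb _ (by omega)]
      · rw [hs' _ (by omega) (by omega) (by omega), hb _ (by omega)])
    (fun c _ => by
      rw [Nat.pos_iff_ne_zero]
      by_cases h : init (x, c) <;> simp [truth, hA, Reached, h])
    (fun c hc => hT' x M _ ((truth_le_one _).trans (by omega)))
  have r2 := runs_copy (i := ins (arity α)) (j := b + 8) (t := b + 9) (n := M)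
    (s := s.set b (letterSegment D (truthBits (A 0)) 0 M)) (by omega) (by omega) (by omega)
    (by rw [Store.set_stack_of_ne _ _ (by omega), hM])
    (by rw [Store.set_stack_of_ne _ _ (by omega), hb _ (by omega)])
    (by rw [Store.set_stack_of_ne _ _ (by omega), hb _ (by omega)])
  -- When `l` rounds remain, the array marks what is reached in `M - l` steps.
  let J : ℕ → Store D := fun l => (s.set b (letterSegment D (truthBits (A (M - l))) 0 M)).set (b + 8)
    (unary D l)
  have r3 := runs_each (i := b + 8) (c := build (scan S (arity α + 1)
    (fun j => if j = arity α then b + 6 else ins j) b (b + 9)) P P' (ins (arity α)) b (b + 9))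
    (n := M) (T := M * (M * (T (x, M) + 10) + 10 + T' (x, M) + 13) + 2 * M + 7) J
    (fun l _ => by simp [J]) (fun l hl => by
      have e : M - l = M - (l + 1) + 1 := by omega
      have hs : ∀ j, j ≠ b → j ≠ b + 8 →
          ((J (l + 1)).set (b + 8) (unary D l)).stack j = s.stack j := fun j h1 h2 => by
        simp only [J, Store.set_stack, if_neg h1, if_neg h2]
      have hs0 : ((J (l + 1)).set (b + 8) (unary D l)).stack b =
          letterSegment D (truthBits (A (M - (l + 1)))) 0 M := by
        simp [J, Store.set_stack]
      have q := runs_build hP hP' (b := b) (F := b + 9) (i := ins (arity α)) (by omega) hi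
        (s := (J (l + 1)).set (b + 8) (unary D l))
        (L := truthBits (A (M - (l + 1)))) (A := A (M - l)) (C := scan S (arity α + 1)
          (fun j => if j = arity α then b + 6 else ins j) b (b + 9)) (M := M) (N := M)
        (T := M * (T (x, M) + 10) + 10) (T' := T' (x, M))
        (m := fun c' => hits (A (M - (l + 1))) (fun c => step ((x, c'), c)) M)
        (by rw [hs _ (by omega) (by omega), hM]) hs0
        (by rw [hs _ (by omega) (by omega), hb _ (by omega)])
        (by rw [hs _ (by omega) (by omega), hb _ (by omega)])
        (by rw [hs _ (by omega) (by omega), hb _ (by omega)])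
        (by rw [hs _ (by omega) (by omega), hb _ (by omega)])
        (by rw [hs _ (by omega) (by omega), hb _ (by omega)])
        (fun i hi => by rw [hs _ (by omega) (by omega), hb _ (by omega)])
        (fun s' _ hs' c' hc' h6 => by
          have hs'' : ∀ j, j ≠ b → j ≠ b + 8 → j ≠ b + 5 → j ≠ b + 6 → j ≠ b + 7 →
              s'.stack j = s.stack j := fun j h1 h2 h3 h4 h5 => by rw [hs' j h3 h4 h5, hs j h1 h2]
          refine runs_scan (β := α × ℕ) hS (by omega) (fun j hj => ?_) (fun j hj => ?_)
            ((hs' b (by omega) (by omega) (by omega)).trans hs0) ?_ ?_ ?_ ?_ (fun i hi => ?_)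
            fun c hc => hTS x M c hc c' hc'
          · have := ha j hj
            by_cases e : j = arity α
            · simp only [e, if_true]; omega
            · simp only [e, if_false]; omega
          · by_cases e : j = arity α
            · subst e
              rw [vec_prod_self]
              simpa using h6
            · have hj' : j < arity α + 1 := hj
              have := (ha j hj').1
              rw [vec_prod_of_ne _ e, ← hx j (by omega)]
              simp only [e, if_false]
              exact hs'' _ (by omega) (by omega) (by omega) (by omega) (by omega)
          all_goals rw [hs'' _ (by omega) (by omega) (by omega) (by omega) (by omega),
            hb _ (by omega)])
        (fun c' _ => by rw [hits_pos, e]; rfl)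
        (fun c' hc' => hT' x M _ (hits_le _ _ _))
      refine q.congr (Store.ext (fun j => ?_) rfl)
      simp only [J, Store.set_stack]
      grind)
  have r3' := r3.congr_left (s := (s.set b (letterSegment D (truthBits (A 0)) 0 M)).set (b + 8)
    (unary D M)) (by simp only [J, Nat.sub_self])
  have hJ : J 0 = s.set b (letterSegment D (truthBits (A M)) 0 M) :=
    Store.ext (fun j => by
      have : s.stack (b + 8) = [] := hb _ (by omega)
      simp only [J, Store.set_stack, Nat.sub_zero, unary_zero]; grind) rfl
  rw [hJ] at r3'
  set s1 := s.set b (letterSegment D (truthBits (A M)) 0 M) with hs1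
  have hs : ∀ j, j ≠ b → s1.stack j = s.stack j := fun j h => Store.set_stack_of_ne _ _ h
  set H := hits (A M) (fun c => bad (x, c)) M with hH
  have r4 := runs_scan (β := α) hB (ins := ins) (b := b) (F := b + 9) (by omega)
    (fun j hj => by have := (ha j (by omega)).1; omega) (s := s1) (y := x)
    (fun j hj => by
      have := (ha j (by omega)).1
      rw [hs _ (by omega), hx j hj])
    (A := A M) (n := M) (T := T (x, M)) (by simp [hs1])
    (by rw [hs _ (by omega), hb _ (by omega)]) (by rw [hs _ (by omega), hb _ (by omega)])
    (by rw [hs _ (by omega), hb _ (by omega)]) (by rw [hs _ (by omega), hb _ (by omega)])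
    (fun i hi => by rw [hs _ (by omega), hb _ (by omega)]) (hTB x M)
  have hHM : H ≤ M := hits_le _ _ _
  have r5 := hP (fun _ => b + 3) out (b + 9) (fun _ _ => by omega) (by omega) D
    (s1.set (b + 3) (unary D H)) H (fun _ _ => by simp [vec_nat])
    (by rw [Store.set_stack_of_ne _ _ (by omega), hs _ (by omega), ho])
    (fun i hi => by rw [Store.set_stack_of_ne _ _ (by omega), hs _ (by omega), hb _ (by omega)])
  have r6 := runs_clear (i := b + 3) (n := H)
    (s := (s1.set (b + 3) (unary D H)).set out (unary D (truth (0 < H))))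
    (by rw [Store.set_stack_of_ne _ _ (by omega), Store.set_stack_self])
  have r7 := runs_clear_segment (i := b) (n := M) (L := truthBits (A M))
    (s := ((s1.set (b + 3) (unary D H)).set out (unary D (truth (0 < H)))).set (b + 3) [])
    (by simp only [Store.set_stack, hs1]; rw [if_neg (by omega), if_neg (by omega),
      if_neg (by omega)]; simp)
  refine (((((((r1.seq r2).seq r3').seq r4).seq r5).seq r6).seq r7).mono ?_).congr
    (Store.ext (fun k => ?_) rfl)
  · have := hT' x M H hHM
    have e : M * (M * (T (x, M) + 10) + 10 + T' (x, M) + 13) =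
      M * (M * (T (x, M) + 10) + T' (x, M) + 23) := by ring
    dsimp only
    rw [e]
    have e2 : M * (M * (M * (T (x, M) + 10) + T' (x, M) + 23) + 2 * M + 7 + 1) =
      M * (M * (M * (T (x, M) + 10) + T' (x, M) + 23) + 2 * M + 8) := by ring
    rw [e2]
    omega
  · have f0 : s.stack b = [] := hb _ le_rfl
    have f3 : s.stack (b + 3) = [] := hb _ (by omega)
    have f : truth (0 < H) = truth (∃ c < M, A M c ∧ bad (x, c)) := by rw [hH, hits_pos]
    change _ = (s.set out (unary D (truth (∃ c < M, A M c ∧ bad (x, c))))).stack k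
    rw [← f]
    simp only [hs1, Store.set_stack]
    grind

end Cmd

theorem FPred.reached {α : Type} [Ctx α] {init : α × ℕ → Prop} {step : (α × ℕ) × ℕ → Prop}
    {bad : α × ℕ → Prop} (hI : FPred.{u} init) (hS : FPred.{u} step) (hB : FPred.{u} bad) :
    FPred.{u} fun p : α × ℕ => ∃ c < p.2,
      Reached (fun c => init (p.1, c)) (fun c c' => step ((p.1, c'), c)) p.2 p.2 c ∧
        bad (p.1, c) := by
  refine ⟨(PolyBounded.const 1).mono fun p => truth_le_one _, ?_⟩
  obtain ⟨-, tI, ⟨cI, hcI⟩, I, hI⟩ := hI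
  obtain ⟨-, tS, ⟨cS, hcS⟩, S, hS⟩ := hS
  obtain ⟨-, tB, ⟨cB, hcB⟩, B, hB⟩ := hB
  obtain ⟨-, t, ⟨c, hc⟩, P, hP⟩ : FPred.{u} fun n : ℕ => 0 < n := FPred.lt (.const 0) .id
  obtain ⟨-, t', ⟨c', hc'⟩, P', hP'⟩ : FPred.{u} fun n : ℕ => n = 0 := FPred.eq .id (.const 0)
  -- Indices stay below `M`, so a tuple with up to two of them has size at most 2 * size (x, M).
  have hd : PolyBounded fun p : α × ℕ => 2 * size p + 2 :=
    ((PolyBounded.const 2).mul .size).add (.const 2)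
  have hT := ((hd.pow cI).add (hd.pow cB)).add (hd.pow cS)
  have hT' := (((hd.pow c).add (hd.pow c')).add (hd.pow 1)).add (.const 7)
  have hn := FP.polyBounded_snd (α := α)
  refine ⟨_, ?_, _, computes_reach hI hS hB hP hP'
    (T := fun p => (2 * size p + 2) ^ cI + (2 * size p + 2) ^ cB + (2 * size p + 2) ^ cS)
    (T' := fun p => (2 * size p + 2) ^ c + (2 * size p + 2) ^ c' + (2 * size p + 2) ^ 1 + 7)
    (fun x M k hk => ?_) (fun x M k hk => ?_) (fun x M k hk k' hk' => ?_) (fun x M m hm => ?_)⟩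
  · exact (((((hn.mul ((hT.add hT').add (.const 13))).add (hn.mul (((hn.mul (((hn.mul (hT.add
      (.const 10))).add hT').add (.const 23))).add ((PolyBounded.const 2).mul hn)).add
      (.const 8)))).add (hn.mul (hT.add (.const 10)))).add hT').add
      ((PolyBounded.const 9).mul hn)).add (.const 30)
  · have h := (hcI (x, k)).trans (Nat.pow_le_pow_left (m := 2 * size (x, M) + 2)
      (by rw [size_prod, size_prod]; dsimp only; omega) cI)
    omega
  · have h := (hcB (x, k)).trans (Nat.pow_le_pow_left (m := 2 * size (x, M) + 2)
      (by rw [size_prod, size_prod]; dsimp only; omega) cB)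
    omega
  · have h := (hcS ((x, k'), k)).trans (Nat.pow_le_pow_left (m := 2 * size (x, M) + 2)
      (by rw [size_prod, size_prod, size_prod]; dsimp only; omega) cS)
    omega
  · have h : m + 2 ≤ 2 * size (x, M) + 2 := by rw [size_prod]; dsimp only; omega
    have h1 := (hc m).trans (Nat.pow_le_pow_left h c)
    have h2 := (hc' m).trans (Nat.pow_le_pow_left h c')
    have h3 : M ≤ size (x, M) := by rw [size_prod]; dsimp only; omega
    rw [pow_one]
    omega

/-! ### Reading words that are coded as numbers -/

theorem digit_ofDigits {b : ℕ} {L : List ℕ} (hL : ∀ a ∈ L, a < b) (i : ℕ) :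
    digit b (Nat.ofDigits b L) i = L.getD i 0 := by
  induction L generalizing i with
  | nil => simp [digit]
  | cons a L ih =>
    have ha := hL a (by simp)
    have hb : 0 < b := by omega
    have ih := ih fun c hc => hL c (by simp [hc])
    cases i with
    | zero => simp [digit, Nat.ofDigits_cons, Nat.mod_eq_of_lt ha]
    | succ i =>
      rw [List.getD_cons_succ, ← ih i, digit, digit, Nat.ofDigits_cons, pow_succ',
        ← Nat.div_div_eq_div_mul, Nat.add_mul_div_left _ _ hb, Nat.div_eq_of_lt ha, Nat.zero_add]

theorem getD_of_prefix_drop {l L : List ℕ} {s : ℕ} (h : l <+: L.drop s) {i : ℕ} (hi : i < l.length) :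
    L.getD (s + i) 0 = l.getD i 0 := by
  obtain ⟨r, hr⟩ := h
  have : L.getD (s + i) 0 = (L.drop s).getD i 0 := by
    simp [List.getD_eq_getElem?_getD, List.getElem?_drop]
  rw [this, ← hr, List.getD_append _ _ _ _ hi]

theorem append_prefix_drop {l l' L : List ℕ} {s : ℕ} (h : l ++ l' <+: L.drop s) :
    l <+: L.drop s ∧ l' <+: L.drop (s + l.length) := by
  obtain ⟨r, hr⟩ := h
  refine ⟨⟨l' ++ r, by rw [← hr, List.append_assoc]⟩, r, ?_⟩
  rw [← List.drop_drop, ← hr, List.append_assoc, List.drop_left]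

/-- The code of a number in binary. -/
def natCode (x : ℕ) : List ℕ := Nat.digits 2 x ++ [2]

/-- The position after the number that starts at `s`. -/
noncomputable def endAt (W n s : ℕ) : ℕ := FP.search (fun j => s ≤ j ∧ digit 16 W j = 2) n + 1

/-- The number, at most `N`, that starts at `s`. -/
noncomputable def numAt (W n N s : ℕ) : ℕ :=
  FP.search (fun v => ∀ j < v + n, (s + j + 1 < endAt W n s → digit 2 v j = digit 16 W (s + j)) ∧
    (endAt W n s ≤ s + j + 1 → digit 2 v j = 0)) N

theorem endAt_le (W n s : ℕ) : endAt W n s ≤ n + 1 := Nat.succ_le_succ (FP.search_le _ _)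

theorem endAt_of_le {W n s : ℕ} (h : n ≤ s) : endAt W n s = n + 1 := by
  rw [endAt, FP.search_eq le_rfl (Or.inr rfl)]
  rintro j hj ⟨h', -⟩
  omega

theorem digit_two_eq_zero {x j : ℕ} (h : x < 2 ^ j) : digit 2 x j = 0 := by
  rw [digit, Nat.div_eq_of_lt h]

theorem eq_of_digit_two {x y : ℕ} (h : ∀ j, digit 2 x j = digit 2 y j) : x = y :=
  Nat.eq_of_testBit_eq fun j => by
    have := h j
    rw [Nat.testBit_eq_decide_div_mod_eq, Nat.testBit_eq_decide_div_mod_eq]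
    simp only [digit] at this
    rw [this]

section

variable {L : List ℕ} (hL : ∀ a ∈ L, a < 16) {N : ℕ} (hN : 2 ^ L.length ≤ N)
include hL

/-- The separator has code 2, which no binary digit has, so the first such code ends the number. -/
theorem endAt_of_prefix {s x : ℕ} (h : natCode x <+: L.drop s) :
    endAt (Nat.ofDigits 16 L) L.length s = s + (natCode x).length ∧
      s + (natCode x).length ≤ L.length := by
  have hlen := h.length_le
  simp only [natCode, List.length_append, List.length_singleton, List.length_drop] at hlen ⊢
  refine ⟨?_, by omega⟩
  rw [endAt, FP.search_eq (i := s + (Nat.digits 2 x).length) (by omega)]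
  · rfl
  · left
    refine ⟨by omega, ?_⟩
    rw [digit_ofDigits hL, getD_of_prefix_drop h (by simp [natCode]), natCode]
    simp [List.getD_eq_getElem?_getD]
  · rintro j hj ⟨h1, h2⟩
    obtain ⟨j, rfl⟩ := Nat.exists_eq_add_of_le h1
    have hj : j < (Nat.digits 2 x).length := by omega
    rw [digit_ofDigits hL, getD_of_prefix_drop h (by simp [natCode]; omega), natCode,
      List.getD_append _ _ _ _ hj, Nat.getD_digits _ _ le_rfl] at h2
    omega

include hN

/-- The number is found by searching for one with the right binary digits and zeros afterwards. The
bound 2 ^ |L| ≤ `N` ensures that it lies in the range of the search. -/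
theorem numAt_of_prefix {s x : ℕ} (h : natCode x <+: L.drop s) :
    numAt (Nat.ofDigits 16 L) L.length N s = x := by
  obtain ⟨he, hlen⟩ := endAt_of_prefix hL h
  simp only [natCode, List.length_append, List.length_singleton] at he hlen
  set m := (Nat.digits 2 x).length with hm
  have hx : x < 2 ^ m := Nat.lt_base_pow_length_digits (by omega)
  have hx' : ∀ j, m ≤ j → digit 2 x j = 0 := fun j hj =>
    digit_two_eq_zero (hx.trans_le (Nat.pow_le_pow_right (by omega) hj))
  have hd : ∀ j < m, digit 2 x j = digit 16 (Nat.ofDigits 16 L) (s + j) := fun j hj => by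
    rw [digit_ofDigits hL, getD_of_prefix_drop h (by simp [natCode]; omega), natCode,
      List.getD_append _ _ _ _ hj, Nat.getD_digits _ _ le_rfl, digit]
  have hxN : x ≤ N :=
    (hx.le.trans (Nat.pow_le_pow_right (by omega) (by omega : m ≤ L.length))).trans hN
  refine FP.search_eq hxN (Or.inl fun j _ => ?_) fun v hv hp => ?_
  · rw [he]
    exact ⟨fun h => hd j (by omega), fun h => hx' j (by omega)⟩
  · refine hv.ne (eq_of_digit_two fun j => ?_)
    by_cases hj : j < v + L.length
    · obtain ⟨h1, h2⟩ := hp j hj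
      rw [he] at h1 h2
      by_cases hjm : j < m
      · rw [h1 (by omega), hd j hjm]
      · rw [h2 (by omega), hx' j (by omega)]
    -- The search inspects only the digits below v + n. Beyond them both numbers have digit 0,
    -- because v < 2 ^ v.
    · rw [hx' j (by omega), digit_two_eq_zero]
      exact Nat.lt_two_pow_self.trans_le (Nat.pow_le_pow_right (by omega) (by omega))

end

namespace FP

variable {α : Type} [Ctx α] {W n N k s : α → ℕ}

theorem endAt (hW : FP.{u} W) (hn : FP.{u} n) (hs : FP.{u} s) :
    FP.{u} fun x => _root_.endAt (W x) (n x) (s x) :=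
  (search_lt (q := fun p : α × ℕ => s p.1 ≤ p.2 ∧ _root_.digit 16 (W p.1) p.2 = 2)
    ((FPred.le hs.weaken snd).and (FPred.eq (digit (const 16) hW.weaken snd) (const 2))) hn).succ

theorem numAt (hW : FP.{u} W) (hn : FP.{u} n) (hN : FP.{u} N) (hs : FP.{u} s) :
    FP.{u} fun x => _root_.numAt (W x) (n x) (N x) (s x) := by
  have he := (endAt hW hn hs).weaken.weaken
  have hj : FP.{u} fun p : (α × ℕ) × ℕ => s p.1.1 + p.2 := hs.weaken.weaken.add snd
  have hd : FP.{u} fun p : (α × ℕ) × ℕ => _root_.digit 2 p.1.2 p.2 :=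
    digit (const 2) snd.weaken snd
  exact search_lt (q := fun p : α × ℕ => ∀ j < p.2 + n p.1,
    (s p.1 + j + 1 < _root_.endAt (W p.1) (n p.1) (s p.1) →
      _root_.digit 2 p.2 j = _root_.digit 16 (W p.1) (s p.1 + j)) ∧
    (_root_.endAt (W p.1) (n p.1) (s p.1) ≤ s p.1 + j + 1 → _root_.digit 2 p.2 j = 0))
    (FPred.forall_lt (q := fun p : (α × ℕ) × ℕ =>
      (s p.1.1 + p.2 + 1 < _root_.endAt (W p.1.1) (n p.1.1) (s p.1.1) →
      _root_.digit 2 p.1.2 p.2 = _root_.digit 16 (W p.1.1) (s p.1.1 + p.2)) ∧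
      (_root_.endAt (W p.1.1) (n p.1.1) (s p.1.1) ≤ s p.1.1 + p.2 + 1 →
        _root_.digit 2 p.1.2 p.2 = 0))
      (((FPred.lt hj.succ he).imp (FPred.eq hd (digit (const 16) hW.weaken.weaken hj))).and
        ((FPred.le he hj.succ).imp (FPred.eq hd (const 0)))) (snd.add hn.weaken)) hN

end FP

/-! ### Reading transitions -/

/-- The code of a letter. -/
def Letter.code : Letter → ℕ
  | .bit b => b.toNat
  | .sep => 2
  | .cmp .lt => 3
  | .cmp .eq => 4
  | .cmp .gt => 5
  | .upd .old => 6
  | .upd .new => 7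
  | .upd .add => 8

/-- The code of a cell. -/
def Cell.code {D : Type*} : Cell D → ℕ
  | .sym a => a.code
  | .val _ => 9

theorem Letter.code_lt (a : Letter) : a.code < 10 := by
  rcases a with (_ | _) | _ | (_ | _ | _) | (_ | _ | _) <;> decide

theorem Cell.code_lt {D : Type*} (a : Cell D) : a.code < 16 := by
  rcases a with a | _
  · exact a.code_lt.trans (by norm_num)
  · norm_num [code]

/-- The codes of the letters of a transition. -/
def transCode {a b c k : ℕ} (τ : Transition (Fin a) (Fin b) (Fin c) k) : List ℕ :=
  natCode τ.src ++ (natCode τ.inLabel ++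
    (List.ofFn (fun i => (Letter.cmp (τ.guard i)).code) ++
      (List.ofFn (fun i => (Letter.upd (τ.update i)).code) ++
        (natCode τ.out ++ (natCode τ.outLabel ++ natCode τ.tgt)))))

theorem map_code_encodeNat (D : Type*) (x : ℕ) : (encodeNat D x).map Cell.code = natCode x := by
  rw [encodeNat, natCode, List.map_append, List.map_map, Nat.digits_two_eq_bits]
  congr 1

theorem map_code_encodeTransition (D : Type*) {a b c k : ℕ}
    (τ : Transition (Fin a) (Fin b) (Fin c) k) :
    (encodeTransition D τ).map Cell.code = transCode τ := by
  simp only [encodeTransition, transCode, List.map_append, map_code_encodeNat, List.map_ofFn,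
    List.append_assoc]
  rfl

/-- Positions of the components of the transition that starts at `p`. -/
noncomputable def inPos (W n p : ℕ) : ℕ := endAt W n p
noncomputable def guardPos (W n p : ℕ) : ℕ := endAt W n (inPos W n p)
noncomputable def updPos (W n k p : ℕ) : ℕ := guardPos W n p + k
noncomputable def outPos (W n k p : ℕ) : ℕ := updPos W n k p + k
noncomputable def outLabelPos (W n k p : ℕ) : ℕ := endAt W n (outPos W n k p)
noncomputable def tgtPos (W n k p : ℕ) : ℕ := endAt W n (outLabelPos W n k p)
noncomputable def nextPos (W n k p : ℕ) : ℕ := endAt W n (tgtPos W n k p)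

/-- The position of the initial register contents. -/
noncomputable def initPos (W n : ℕ) : ℕ := endAt W n (endAt W n (endAt W n (endAt W n 0)))

/-- The position of the `t`-th transition. -/
noncomputable def transPos (W n k : ℕ) : ℕ → ℕ
  | 0 => initPos W n + k
  | t + 1 => nextPos W n k (transPos W n k t)

/-- The word that is coded by `W` contains the transition `τ` at position `p`. -/
structure SpelledAt (W n k N p : ℕ) {a b c : ℕ} (τ : Transition (Fin a) (Fin b) (Fin c) k) :
    Prop where
  src : numAt W n N p = τ.src
  inLabel : numAt W n N (inPos W n p) = τ.inLabel
  guard : ∀ i : Fin k, digit 16 W (guardPos W n p + i) = (Letter.cmp (τ.guard i)).code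
  update : ∀ i : Fin k, digit 16 W (updPos W n k p + i) = (Letter.upd (τ.update i)).code
  out : numAt W n N (outPos W n k p) = τ.out
  outLabel : numAt W n N (outLabelPos W n k p) = τ.outLabel
  tgt : numAt W n N (tgtPos W n k p) = τ.tgt

theorem digit_of_prefix {L l : List ℕ} (hL : ∀ a ∈ L, a < 16) {s : ℕ} (h : l <+: L.drop s) {i : ℕ}
    (hi : i < l.length) : digit 16 (Nat.ofDigits 16 L) (s + i) = l.getD i 0 := by
  rw [digit_ofDigits hL, getD_of_prefix_drop h hi]

theorem spelledAt_of_prefix {L : List ℕ} (hL : ∀ a ∈ L, a < 16) {N : ℕ} (hN : 2 ^ L.length ≤ N)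
    {a b c k : ℕ} {τ : Transition (Fin a) (Fin b) (Fin c) k} {p : ℕ}
    (h : transCode τ <+: L.drop p) :
    SpelledAt (Nat.ofDigits 16 L) L.length k N p τ ∧
      nextPos (Nat.ofDigits 16 L) L.length k p = p + (transCode τ).length := by
  obtain ⟨h1, h⟩ := append_prefix_drop h
  have e1 := (endAt_of_prefix hL h1).1
  have n1 := numAt_of_prefix hL hN h1
  rw [← e1] at h
  obtain ⟨h2, h⟩ := append_prefix_drop h
  have e2 := (endAt_of_prefix hL h2).1
  have n2 := numAt_of_prefix hL hN h2
  rw [← e2] at h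
  obtain ⟨h3, h⟩ := append_prefix_drop h
  rw [List.length_ofFn] at h
  obtain ⟨h4, h⟩ := append_prefix_drop h
  rw [List.length_ofFn] at h
  obtain ⟨h5, h⟩ := append_prefix_drop h
  have e5 := (endAt_of_prefix hL h5).1
  have n5 := numAt_of_prefix hL hN h5
  rw [← e5] at h
  obtain ⟨h6, h7⟩ := append_prefix_drop h
  have e6 := (endAt_of_prefix hL h6).1
  have n6 := numAt_of_prefix hL hN h6
  rw [← e6] at h7
  have e7 := (endAt_of_prefix hL h7).1
  have n7 := numAt_of_prefix hL hN h7
  refine ⟨⟨n1, n2, fun i => ?_, fun i => ?_, n5, n6, n7⟩, ?_⟩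
  · have := digit_of_prefix hL h3 (i := i) (by simp)
    rw [List.getD_eq_getElem _ _ (by simp), List.getElem_ofFn] at this
    exact this
  · have := digit_of_prefix hL h4 (i := i) (by simp)
    rw [List.getD_eq_getElem _ _ (by simp), List.getElem_ofFn] at this
    exact this
  · simp only [nextPos, tgtPos, outLabelPos, outPos, updPos, guardPos, inPos]
    rw [e7, e6, e5, e2, e1]
    simp only [transCode, List.length_append, List.length_ofFn]
    omega

/-- Reading past the end of the word stays past the end, so positions after the last transition are
recognizable. -/
theorem le_nextPos {W n k p : ℕ} (h : n ≤ p) : n ≤ nextPos W n k p := by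
  have h1 : n ≤ inPos W n p := by rw [inPos, endAt_of_le h]; omega
  have h2 : n ≤ guardPos W n p := by rw [guardPos, endAt_of_le h1]; omega
  have h3 : n ≤ outPos W n k p := by rw [outPos, updPos]; omega
  have h4 : n ≤ outLabelPos W n k p := by rw [outLabelPos, endAt_of_le h3]; omega
  have h5 : n ≤ tgtPos W n k p := by rw [tgtPos, endAt_of_le h4]; omega
  rw [nextPos, endAt_of_le h5]; omega

/-- The words of transducers: the lists `L` of codes that describe `k` registers, the initial state
`q₀` and the transitions `ts`. -/
structure IsCode (L : List ℕ) {a b c k : ℕ} (q₀ : ℕ)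
    (ts : List (Transition (Fin a) (Fin b) (Fin c) k)) : Prop where
  lt : ∀ d ∈ L, d < 16
  eq : L = natCode a ++ (natCode b ++ (natCode c ++ (natCode q₀ ++ (List.replicate k 9 ++
    ts.flatMap transCode))))

namespace IsCode

variable {L : List ℕ} {a b c k q₀ : ℕ} {ts : List (Transition (Fin a) (Fin b) (Fin c) k)}
  (h : IsCode L q₀ ts) {N : ℕ} (hN : 2 ^ L.length ≤ N)
include h

theorem prefixes : natCode q₀ <+: L.drop (endAt (Nat.ofDigits 16 L) L.length (endAt
      (Nat.ofDigits 16 L) L.length (endAt (Nat.ofDigits 16 L) L.length 0))) ∧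
    L.drop (initPos (Nat.ofDigits 16 L) L.length + k) = ts.flatMap transCode := by
  have h0 : natCode a ++ (natCode b ++ (natCode c ++ (natCode q₀ ++ (List.replicate k 9 ++
    ts.flatMap transCode)))) <+: L.drop 0 := by rw [← h.eq]; exact List.prefix_refl _
  obtain ⟨h1, h0⟩ := append_prefix_drop h0
  rw [← (endAt_of_prefix h.lt h1).1] at h0
  obtain ⟨h2, h0⟩ := append_prefix_drop h0
  rw [← (endAt_of_prefix h.lt h2).1] at h0
  obtain ⟨h3, h0⟩ := append_prefix_drop h0
  rw [← (endAt_of_prefix h.lt h3).1] at h0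
  obtain ⟨h4, h0⟩ := append_prefix_drop h0
  have e1 := (endAt_of_prefix h.lt h1).1
  have e2 := (endAt_of_prefix h.lt h2).1
  have e3 := (endAt_of_prefix h.lt h3).1
  have e4 := (endAt_of_prefix h.lt h4).1
  refine ⟨h4, ?_⟩
  rw [initPos, e4, e3, e2, e1]
  rw [h.eq]
  simp only [← List.drop_drop]
  simp [List.drop_left']

theorem length_le : ts.length ≤ L.length := by
  have key : ∀ l : List (Transition (Fin a) (Fin b) (Fin c) k),
      l.length ≤ (l.flatMap transCode).length := by
    intro l
    induction l with
    | nil => simp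
    | cons τ l ih =>
      rw [List.flatMap_cons, List.length_append, List.length_cons]
      have : 1 ≤ (transCode τ).length := by simp [transCode, natCode]; omega
      omega
  have := congrArg List.length h.prefixes.2
  rw [List.length_drop] at this
  have := key ts
  omega

include hN

theorem numAt_start : numAt (Nat.ofDigits 16 L) L.length N (endAt (Nat.ofDigits 16 L) L.length
    (endAt (Nat.ofDigits 16 L) L.length (endAt (Nat.ofDigits 16 L) L.length 0))) = q₀ :=
  numAt_of_prefix h.lt hN h.prefixes.1

theorem drop_transPos (t : ℕ) (ht : t ≤ ts.length) :
    L.drop (transPos (Nat.ofDigits 16 L) L.length k t) = (ts.drop t).flatMap transCode := by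
  induction t with
  | zero => exact h.prefixes.2
  | succ t ih =>
    have ih := ih (by omega)
    rw [List.drop_eq_getElem_cons (by omega : t < ts.length), List.flatMap_cons] at ih
    rw [transPos, (spelledAt_of_prefix h.lt hN ⟨_, ih.symm⟩).2, ← List.drop_drop, ih,
      List.drop_left]

theorem spelledAt_transPos {t : ℕ} (ht : t < ts.length) :
    SpelledAt (Nat.ofDigits 16 L) L.length k N (transPos (Nat.ofDigits 16 L) L.length k t) ts[t] := by
  have := h.drop_transPos hN t ht.le
  rw [List.drop_eq_getElem_cons ht, List.flatMap_cons] at this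
  exact (spelledAt_of_prefix h.lt hN ⟨_, this.symm⟩).1

/-- The code of a transition is nonempty, so every genuine transition starts inside the word; after
the last one the position is at least the length and remains so. -/
theorem transPos_lt_iff (t : ℕ) :
    transPos (Nat.ofDigits 16 L) L.length k t < L.length ↔ t < ts.length := by
  constructor
  · intro hlt
    by_contra ht
    obtain ⟨d, rfl⟩ := Nat.exists_eq_add_of_le (not_lt.1 ht)
    have key : ∀ d, L.length ≤ transPos (Nat.ofDigits 16 L) L.length k (ts.length + d) := by
      intro d
      induction d with
      | zero =>
        have := h.drop_transPos hN ts.length le_rfl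
        simpa using this
      | succ d ih => exact le_nextPos ih
    exact absurd hlt (not_lt.2 (key d))
  · intro ht
    have := h.drop_transPos hN t ht.le
    rw [List.drop_eq_getElem_cons ht, List.flatMap_cons] at this
    by_contra hge
    rw [List.drop_eq_nil_of_le (not_lt.1 hge)] at this
    simp [transCode, natCode] at this

/-- Quantification over transitions by means of positions. -/
theorem exists_trans_iff {Q : Transition (Fin a) (Fin b) (Fin c) k → Prop} {Q' : ℕ → Prop}
    (hQ : ∀ p τ, SpelledAt (Nat.ofDigits 16 L) L.length k N p τ → (Q' p ↔ Q τ)) :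
    (∃ t < L.length, transPos (Nat.ofDigits 16 L) L.length k t < L.length ∧
      Q' (transPos (Nat.ofDigits 16 L) L.length k t)) ↔ ∃ τ ∈ ts, Q τ := by
  constructor
  · rintro ⟨t, -, ht, hq⟩
    rw [h.transPos_lt_iff hN] at ht
    exact ⟨ts[t], List.getElem_mem _, (hQ _ _ (h.spelledAt_transPos hN ht)).1 hq⟩
  · rintro ⟨τ, hτ, hq⟩
    obtain ⟨t, ht, rfl⟩ := List.getElem_of_mem hτ
    exact ⟨t, ht.trans_le h.length_le, (h.transPos_lt_iff hN t).2 ht,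
      (hQ _ _ (h.spelledAt_transPos hN ht)).2 hq⟩

end IsCode

namespace FP

variable {α : Type} [Ctx α] {W n k p : α → ℕ} (hW : FP.{u} W) (hn : FP.{u} n) (hk : FP.{u} k)
  (hp : FP.{u} p)
include hW hn hp

theorem inPos : FP.{u} fun x => _root_.inPos (W x) (n x) (p x) := endAt hW hn hp

theorem guardPos : FP.{u} fun x => _root_.guardPos (W x) (n x) (p x) :=
  endAt hW hn (inPos hW hn hp)

include hk

theorem updPos : FP.{u} fun x => _root_.updPos (W x) (n x) (k x) (p x) := (guardPos hW hn hp).add hk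

theorem outPos : FP.{u} fun x => _root_.outPos (W x) (n x) (k x) (p x) :=
  (updPos hW hn hk hp).add hk

theorem outLabelPos : FP.{u} fun x => _root_.outLabelPos (W x) (n x) (k x) (p x) :=
  endAt hW hn (outPos hW hn hk hp)

theorem tgtPos : FP.{u} fun x => _root_.tgtPos (W x) (n x) (k x) (p x) :=
  endAt hW hn (outLabelPos hW hn hk hp)

theorem nextPos : FP.{u} fun x => _root_.nextPos (W x) (n x) (k x) (p x) :=
  endAt hW hn (tgtPos hW hn hk hp)

theorem transPos : FP.{u} fun x => _root_.transPos (W x) (n x) (k x) (p x) := by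
  have h := primrec (g := fun x => initPos (W x) (n x) + k x)
    (h := fun p : (α × ℕ) × ℕ => _root_.nextPos (W p.1.1) (n p.1.1) (k p.1.1) p.2)
    ((endAt hW hn (endAt hW hn (endAt hW hn (endAt hW hn (const 0))))).add hk)
    (nextPos hW.weaken.weaken hn.weaken.weaken hk.weaken.weaken snd)
    (fun x t => _root_.transPos (W x) (n x) (k x) t) (fun _ => rfl) (fun _ _ => rfl)
    -- Every position after the first is one more than the result of a search bounded by n, so
    -- positions never exceed n + k + 1.
    (((hn.weaken (α := α)).1.add ((hk.weaken (α := α)).1.add (.const 1))).mono fun p => by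
      obtain ⟨x, t⟩ := p
      have h1 : initPos (W x) (n x) ≤ n x + 1 := endAt_le _ _ _
      cases t with
      | zero => simp only [_root_.transPos]; omega
      | succ t =>
        have := endAt_le (W x) (n x) (_root_.tgtPos (W x) (n x) (k x) (_root_.transPos (W x) (n x) (k x) t))
        simp only [_root_.transPos, _root_.nextPos]; omega)
  exact h.comp (h := fun x => (x, p x)) (.pair .id hp)

end FP

/-! ### Pairs of runs on configurations that are coded as numbers -/

/-- The comparison that stands at position `pos + i` is that of `d` with the digit `off + i`
of `c`. -/
def GuardHolds (W N pos off c d i : ℕ) : Prop :=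
  (digit 16 W (pos + i) = 3 ∧ d < digit N c (off + i)) ∨
    (digit 16 W (pos + i) = 4 ∧ d = digit N c (off + i)) ∨
      (digit 16 W (pos + i) = 5 ∧ digit N c (off + i) < d)

/-- The digit `off + i` of `c`, or `d` if the letter at position `pos + i` says so. -/
noncomputable def written (W N pos off c d i : ℕ) : ℕ :=
  if digit 16 W (pos + i) = 7 then d else digit N c (off + i)

/-- The transitions at the positions `p₁` and `p₂` can both read `d`. -/
def CodeEnabled (W n k N c d p₁ p₂ : ℕ) : Prop :=
  (numAt W n N (inPos W n p₁) = numAt W n N (inPos W n p₂) ∧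
    numAt W n N p₁ = digit N c 0 ∧ numAt W n N p₂ = digit N c 1) ∧
      (∀ i < k, GuardHolds W N (guardPos W n p₁) 2 c d i) ∧
        ∀ i < k, GuardHolds W N (guardPos W n p₂) (2 + k) c d i

/-- In base `N`, digits 0 and 1 of a configuration are the two states, the next `k` digits the
registers of the first copy, and the following `k` digits those of the second. -/
def CodeStep (W n k N c c' d p₁ p₂ : ℕ) : Prop :=
  CodeEnabled W n k N c d p₁ p₂ ∧
    (digit N c' 0 = numAt W n N (tgtPos W n k p₁) ∧
      digit N c' 1 = numAt W n N (tgtPos W n k p₂)) ∧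
        (∀ i < k, digit N c' (2 + i) = written W N (updPos W n k p₁) 2 c d i) ∧
          ∀ i < k, digit N c' (2 + k + i) = written W N (updPos W n k p₂) (2 + k) c d i

def CodeBad (W n k N c d p₁ p₂ : ℕ) : Prop :=
  CodeEnabled W n k N c d p₁ p₂ ∧
    (¬ numAt W n N (outLabelPos W n k p₁) = numAt W n N (outLabelPos W n k p₂) ∨
      ¬ written W N (updPos W n k p₁) 2 c d (numAt W n N (outPos W n k p₁)) =
        written W N (updPos W n k p₂) (2 + k) c d (numAt W n N (outPos W n k p₂)))

/-- There is a transition whose position satisfies `Q`. -/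
def ExistsTrans (W n k : ℕ) (Q : ℕ → Prop) : Prop :=
  ∃ t < n, transPos W n k t < n ∧ Q (transPos W n k t)

/-- The initial register contents are any numbers compatible with the gaps, the same in both copies.
The matrix of gaps is read from the base N + 1 digits of `G`, because a gap can be equal to `N`. -/
def InitCode (W n k N G c : ℕ) : Prop :=
  (digit N c 0 = numAt W n N (endAt W n (endAt W n (endAt W n 0))) ∧
    digit N c 1 = numAt W n N (endAt W n (endAt W n (endAt W n 0)))) ∧
      (∀ i < k, digit N c (2 + i) = digit N c (2 + k + i)) ∧
        ∀ i < k, ∀ j < k, GapCompatible (digit (N + 1) G (i * k + j)) (digit N c (2 + i))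
          (digit N c (2 + j))

/-- The stuttering step c = c' makes reachability in exactly `M` steps include reachability in
fewer. -/
def StepCode (W n k N c c' : ℕ) : Prop :=
  c = c' ∨ ∃ d < N, ExistsTrans W n k fun p₁ => ExistsTrans W n k fun p₂ =>
    CodeStep W n k N c c' d p₁ p₂

def BadCode (W n k N c : ℕ) : Prop :=
  ∃ d < N, ExistsTrans W n k fun p₁ => ExistsTrans W n k fun p₂ => CodeBad W n k N c d p₁ p₂

namespace FPred

variable {α : Type} [Ctx α] {W n k N G c c' d p₁ p₂ pos off i : α → ℕ} (hW : FP.{u} W)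
  (hn : FP.{u} n) (hk : FP.{u} k) (hN : FP.{u} N) (hG : FP.{u} G) (hc : FP.{u} c) (hc' : FP.{u} c')
  (hd : FP.{u} d) (hp₁ : FP.{u} p₁) (hp₂ : FP.{u} p₂) (hpos : FP.{u} pos) (hoff : FP.{u} off)
  (hi : FP.{u} i)

include hW hN hpos hoff hc hd hi in
theorem guardHolds : FPred.{u} fun x => GuardHolds (W x) (N x) (pos x) (off x) (c x) (d x) (i x) :=
  have h1 := FP.digit (.const 16) hW (hpos.add hi)
  have h2 := FP.digit hN hc (hoff.add hi)
  ((eq h1 (.const 3)).and (lt hd h2)).or (((eq h1 (.const 4)).and (eq hd h2)).or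
    ((eq h1 (.const 5)).and (lt h2 hd)))

include hW hN hpos hoff hc hd hi in
theorem _root_.FP.written :
    FP.{u} fun x => written (W x) (N x) (pos x) (off x) (c x) (d x) (i x) :=
  (FP.ite (eq (.digit (.const 16) hW (hpos.add hi)) (.const 7)) hd
    (.digit hN hc (hoff.add hi))).congr fun x => by unfold _root_.written; congr

include hW hn hk hN hc hd hp₁ hp₂ in
theorem codeEnabled :
    FPred.{u} fun x => CodeEnabled (W x) (n x) (k x) (N x) (c x) (d x) (p₁ x) (p₂ x) :=
  ((eq (.numAt hW hn hN (.inPos hW hn hp₁)) (.numAt hW hn hN (.inPos hW hn hp₂))).and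
    ((eq (.numAt hW hn hN hp₁) (.digit hN hc (.const 0))).and
      (eq (.numAt hW hn hN hp₂) (.digit hN hc (.const 1))))).and
  ((forall_lt (guardHolds hW.weaken hN.weaken hc.weaken hd.weaken (FP.guardPos hW hn hp₁).weaken
      (.const 2) .snd) hk).and
    (forall_lt (guardHolds hW.weaken hN.weaken hc.weaken hd.weaken (FP.guardPos hW hn hp₂).weaken
      (.add (.const 2) hk.weaken) .snd) hk))

include hW hn hk hN hc hc' hd hp₁ hp₂ in
theorem codeStep : FPred.{u} fun x =>
    CodeStep (W x) (n x) (k x) (N x) (c x) (c' x) (d x) (p₁ x) (p₂ x) :=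
  (codeEnabled hW hn hk hN hc hd hp₁ hp₂).and
    (((eq (.digit hN hc' (.const 0)) (.numAt hW hn hN (.tgtPos hW hn hk hp₁))).and
      (eq (.digit hN hc' (.const 1)) (.numAt hW hn hN (.tgtPos hW hn hk hp₂)))).and
    ((forall_lt (eq (.digit hN.weaken hc'.weaken (.add (.const 2) .snd)) (.written hW.weaken
        hN.weaken hc.weaken hd.weaken (FP.updPos hW hn hk hp₁).weaken (.const 2) .snd)) hk).and
      (forall_lt (eq (.digit hN.weaken hc'.weaken (.add (.add (.const 2) hk.weaken) .snd)) (.written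
        hW.weaken hN.weaken hc.weaken hd.weaken (FP.updPos hW hn hk hp₂).weaken
        (.add (.const 2) hk.weaken) .snd)) hk)))

include hW hn hk hN hc hd hp₁ hp₂ in
theorem codeBad :
    FPred.{u} fun x => CodeBad (W x) (n x) (k x) (N x) (c x) (d x) (p₁ x) (p₂ x) :=
  (codeEnabled hW hn hk hN hc hd hp₁ hp₂).and
    ((eq (.numAt hW hn hN (.outLabelPos hW hn hk hp₁))
        (.numAt hW hn hN (.outLabelPos hW hn hk hp₂))).not.or
      (eq (.written hW hN hc hd (.updPos hW hn hk hp₁) (.const 2)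
          (.numAt hW hn hN (.outPos hW hn hk hp₁)))
        (.written hW hN hc hd (.updPos hW hn hk hp₂) (.add (.const 2) hk)
          (.numAt hW hn hN (.outPos hW hn hk hp₂)))).not)

include hW hn hk in
theorem existsTrans {Q : α → ℕ → Prop} (hQ : FPred.{u} fun p : α × ℕ => Q p.1 p.2) :
    FPred.{u} fun x => ExistsTrans (W x) (n x) (k x) (Q x) :=
  have h := FP.transPos hW.weaken hn.weaken hk.weaken .snd
  exists_lt ((lt h hn.weaken).and (hQ.comp (.pair .fst h))) hn

include hW hn hk hN hG hc in
theorem initCode : FPred.{u} fun x => InitCode (W x) (n x) (k x) (N x) (G x) (c x) :=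
  have hs := FP.numAt hW hn hN (.endAt hW hn (.endAt hW hn (.endAt hW hn (.const 0))))
  have hg := FP.digit hN.weaken.weaken.succ hG.weaken.weaken
    (.add (.mul FP.snd.weaken hk.weaken.weaken) .snd)
  have h1 := FP.digit hN.weaken.weaken hc.weaken.weaken (.add (.const 2) FP.snd.weaken)
  have h2 := FP.digit hN.weaken.weaken hc.weaken.weaken (.add (.const 2) .snd)
  ((eq (.digit hN hc (.const 0)) hs).and (eq (.digit hN hc (.const 1)) hs)).and
    ((forall_lt (eq (.digit hN.weaken hc.weaken (.add (.const 2) .snd))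
      (.digit hN.weaken hc.weaken (.add (.add (.const 2) hk.weaken) .snd))) hk).and
    (forall_lt (forall_lt ((imp (eq hg (.const 0)) (le h2 h1)).and
      (imp (lt (.const 0) hg) ((lt h1 h2).and (le h2 (.add h1 hg))))) hk.weaken) hk))

include hW hn hk hN hc hc' in
theorem stepCode : FPred.{u} fun x => StepCode (W x) (n x) (k x) (N x) (c x) (c' x) := by
  have h2 := existsTrans (α := (α × ℕ) × ℕ) (Q := fun x p₂ =>
    CodeStep (W x.1.1) (n x.1.1) (k x.1.1) (N x.1.1) (c x.1.1) (c' x.1.1) x.1.2 x.2 p₂)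
    hW.weaken.weaken hn.weaken.weaken hk.weaken.weaken
    (codeStep hW.weaken.weaken.weaken hn.weaken.weaken.weaken hk.weaken.weaken.weaken
      hN.weaken.weaken.weaken hc.weaken.weaken.weaken hc'.weaken.weaken.weaken
      FP.snd.weaken.weaken FP.snd.weaken .snd)
  have h1 := existsTrans (α := α × ℕ) (Q := fun x p₁ => ExistsTrans (W x.1) (n x.1) (k x.1) fun p₂ =>
    CodeStep (W x.1) (n x.1) (k x.1) (N x.1) (c x.1) (c' x.1) x.2 p₁ p₂)
    hW.weaken hn.weaken hk.weaken h2
  exact (eq hc hc').or (exists_lt (q := fun x : α × ℕ => ExistsTrans (W x.1) (n x.1) (k x.1) fun p₁ =>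
    ExistsTrans (W x.1) (n x.1) (k x.1) fun p₂ =>
      CodeStep (W x.1) (n x.1) (k x.1) (N x.1) (c x.1) (c' x.1) x.2 p₁ p₂) h1 hN)

include hW hn hk hN hc in
theorem badCode : FPred.{u} fun x => BadCode (W x) (n x) (k x) (N x) (c x) := by
  have h2 := existsTrans (α := (α × ℕ) × ℕ) (Q := fun x p₂ =>
    CodeBad (W x.1.1) (n x.1.1) (k x.1.1) (N x.1.1) (c x.1.1) x.1.2 x.2 p₂)
    hW.weaken.weaken hn.weaken.weaken hk.weaken.weaken
    (codeBad hW.weaken.weaken.weaken hn.weaken.weaken.weaken hk.weaken.weaken.weaken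
      hN.weaken.weaken.weaken hc.weaken.weaken.weaken
      FP.snd.weaken.weaken FP.snd.weaken .snd)
  have h1 := existsTrans (α := α × ℕ) (Q := fun x p₁ => ExistsTrans (W x.1) (n x.1) (k x.1) fun p₂ =>
    CodeBad (W x.1) (n x.1) (k x.1) (N x.1) (c x.1) x.2 p₁ p₂)
    hW.weaken hn.weaken hk.weaken h2
  exact (exists_lt (q := fun x : α × ℕ => ExistsTrans (W x.1) (n x.1) (k x.1) fun p₁ =>
    ExistsTrans (W x.1) (n x.1) (k x.1) fun p₂ =>
      CodeBad (W x.1) (n x.1) (k x.1) (N x.1) (c x.1) x.2 p₁ p₂) h1 hN)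

end FPred

/-- The predicate that the machine decides, from the word, its length, the number of registers, the
number of values, the gaps, and the number of configurations. -/
theorem FPred.reachesBad : FPred.{u} fun p : ((((ℕ × ℕ) × ℕ) × ℕ) × ℕ) × ℕ => ∃ c < p.2,
    Reached (fun c => InitCode p.1.1.1.1.1 p.1.1.1.1.2 p.1.1.1.2 p.1.1.2 p.1.2 c)
      (fun c c' => StepCode p.1.1.1.1.1 p.1.1.1.1.2 p.1.1.1.2 p.1.1.2 c c') p.2 p.2 c ∧
        BadCode p.1.1.1.1.1 p.1.1.1.1.2 p.1.1.1.2 p.1.1.2 c := by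
  have hW : FP.{u} fun p : ((((ℕ × ℕ) × ℕ) × ℕ) × ℕ) × ℕ => p.1.1.1.1.1 :=
    FP.id.weaken.weaken.weaken.weaken.weaken
  have hn : FP.{u} fun p : ((((ℕ × ℕ) × ℕ) × ℕ) × ℕ) × ℕ => p.1.1.1.1.2 :=
    FP.snd.weaken.weaken.weaken.weaken
  have hk : FP.{u} fun p : ((((ℕ × ℕ) × ℕ) × ℕ) × ℕ) × ℕ => p.1.1.1.2 :=
    FP.snd.weaken.weaken.weaken
  have hN : FP.{u} fun p : ((((ℕ × ℕ) × ℕ) × ℕ) × ℕ) × ℕ => p.1.1.2 := FP.snd.weaken.weaken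
  have hG : FP.{u} fun p : ((((ℕ × ℕ) × ℕ) × ℕ) × ℕ) × ℕ => p.1.2 := FP.snd.weaken
  exact reached (initCode hW hn hk hN hG .snd) (stepCode (α := (((((ℕ × ℕ) × ℕ) × ℕ) × ℕ) × ℕ) × ℕ)
    hW.weaken hn.weaken hk.weaken hN.weaken .snd FP.snd.weaken) (badCode hW hn hk hN .snd)

/-! ### Correspondence of codes and configurations -/

/-- The digits of `c` are the two states in `p` and the register contents in `R`. -/
structure Represents (N k c : ℕ) {q : ℕ} (p : Fin q × Fin q) (R : Fin k ⊕ Fin k → ℕ) : Prop where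
  fst : digit N c 0 = p.1
  snd : digit N c 1 = p.2
  inl : ∀ i : Fin k, digit N c (2 + i) = R (.inl i)
  inr : ∀ i : Fin k, digit N c (2 + k + i) = R (.inr i)

theorem exists_represents {N k q : ℕ} (hq : q ≤ N) (p : Fin q × Fin q) {R : Fin k ⊕ Fin k → ℕ}
    (hR : ∀ j, R j < N) : ∃ c < N ^ (2 * k + 2), Represents N k c p R := by
  let L : List ℕ := p.1 :: p.2 :: (List.ofFn (fun i => R (.inl i)) ++ List.ofFn (fun i => R (.inr i)))
  have hL : ∀ a ∈ L, a < N := by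
    intro a ha
    simp only [L, List.mem_cons, List.mem_append, List.mem_ofFn] at ha
    rcases ha with rfl | rfl | ⟨i, rfl⟩ | ⟨i, rfl⟩
    exacts [p.1.2.trans_le hq, p.2.2.trans_le hq, hR _, hR _]
  have hlen : L.length = 2 * k + 2 := by simp [L]; omega
  have hN : 0 < N := p.1.pos.trans_le hq
  refine ⟨Nat.ofDigits N L, ?_, ?_, ?_, fun i => ?_, fun i => ?_⟩
  · rw [← hlen]
    rcases Nat.lt_or_ge 1 N with h1 | h1
    · exact Nat.ofDigits_lt_base_pow_length h1 hL
    -- In base 1 all digits are 0, and so is the code; the general bound on `Nat.ofDigits` requires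
    -- a base above 1.
    · obtain rfl : N = 1 := by omega
      have : ∀ l : List ℕ, (∀ a ∈ l, a < 1) → Nat.ofDigits 1 l = 0 := by
        intro l hl
        induction l with
        | nil => rfl
        | cons a l ih =>
          rw [Nat.ofDigits_cons, ih fun b hb => hl b (by simp [hb])]
          have := hl a (by simp); omega
      rw [this L hL]; simp
  · rw [digit_ofDigits hL]; rfl
  · rw [digit_ofDigits hL]; rfl
  · rw [digit_ofDigits hL, Nat.add_comm, List.getD_cons_succ, List.getD_cons_succ,
      List.getD_append _ _ _ _ (by simp), List.getD_eq_getElem _ _ (by simp), List.getElem_ofFn]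
  · rw [digit_ofDigits hL, show 2 + k + (i : ℕ) = k + i + 1 + 1 by omega, List.getD_cons_succ,
      List.getD_cons_succ, List.getD_append_right _ _ _ _ (by simp)]
    simp only [List.length_ofFn, Nat.add_sub_cancel_left]
    rw [List.getD_eq_getElem _ _ (by simp), List.getElem_ofFn]

section

variable {W n k N c c' d p₁ p₂ a b q : ℕ} {τ₁ τ₂ : Transition (Fin a) (Fin b) (Fin q) k}
  {p : Fin q × Fin q} {R : Fin k ⊕ Fin k → ℕ}

theorem guardHolds_iff {pos off i : ℕ} {o : Ordering} {r : ℕ}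
    (h : digit 16 W (pos + i) = (Letter.cmp o).code) (hr : digit N c (off + i) = r) :
    GuardHolds W N pos off c d i ↔ cmp d r = o := by
  rw [GuardHolds, h, hr]
  cases o
  · simp [Letter.code, cmp_eq_lt_iff]
  · simp [Letter.code, cmp_eq_eq_iff]
  · simp [Letter.code, cmp_eq_gt_iff]

theorem written_eq {pos off i : ℕ} {m : Update} {r : ℕ}
    (h : digit 16 W (pos + i) = (Letter.upd m).code) (hr : digit N c (off + i) = r) [Decidable (m = .new)] :
    written W N pos off c d i = if m = .new then d else r := by
  rw [written, h, hr]
  cases m <;> simp [Letter.code]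

variable (h₁ : SpelledAt W n k N p₁ τ₁) (h₂ : SpelledAt W n k N p₂ τ₂) (hc : Represents N k c p R)
include h₁ h₂ hc

theorem codeEnabled_iff :
    CodeEnabled W n k N c d p₁ p₂ ↔ Enabled₂ τ₁ τ₂ p (orderType (withInput R d)) := by
  rw [CodeEnabled, Enabled₂, h₁.inLabel, h₂.inLabel, h₁.src, h₂.src, hc.fst, hc.snd, Fin.val_inj,
    Fin.val_inj, Fin.val_inj, and_assoc, and_assoc]
  refine and_congr_right' (and_congr_right' (and_congr_right' (and_congr ?_ ?_)))
  · exact ⟨fun h i => (guardHolds_iff (h₁.guard i) (hc.inl i)).1 (h i i.2),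
      fun h i hi => (guardHolds_iff (h₁.guard ⟨i, hi⟩) (hc.inl ⟨i, hi⟩)).2 (h ⟨i, hi⟩)⟩
  · exact ⟨fun h i => (guardHolds_iff (h₂.guard i) (hc.inr i)).1 (h i i.2),
      fun h i hi => (guardHolds_iff (h₂.guard ⟨i, hi⟩) (hc.inr ⟨i, hi⟩)).2 (h ⟨i, hi⟩)⟩

omit h₁ h₂ hc in
theorem withInput_outPlace {α : Type*} [DecidableEq Update] (τ : Transition (Fin a) (Fin b) (Fin q) k)
    (emb : Fin k → α) (R : α → ℕ) :
    withInput R d (τ.outPlace emb) = if τ.update τ.out = .new then d else R (emb τ.out) := by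
  unfold Transition.outPlace
  cases h : τ.update τ.out <;> simp [withInput]

theorem codeBad_iff : CodeBad W n k N c d p₁ p₂ ↔
    Enabled₂ τ₁ τ₂ p (orderType (withInput R d)) ∧ (τ₁.outLabel ≠ τ₂.outLabel ∨
      orderType (withInput R d) (τ₁.outPlace .inl) (τ₂.outPlace .inr) ≠ .eq) := by
  classical
  rw [CodeBad, codeEnabled_iff h₁ h₂ hc, h₁.outLabel, h₂.outLabel, h₁.out, h₂.out,
    written_eq (h₁.update _) (hc.inl _), written_eq (h₂.update _) (hc.inr _), Fin.val_inj]
  refine and_congr_right' (or_congr Iff.rfl (not_congr ?_))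
  rw [orderType, cmp_eq_eq_iff, withInput_outPlace, withInput_outPlace]

theorem codeStep_iff : CodeStep W n k N c c' d p₁ p₂ ↔
    Enabled₂ τ₁ τ₂ p (orderType (withInput R d)) ∧ ∃ w : Fin k ⊕ Fin k → Bool,
      (∀ i, w (.inl i) = true ↔ τ₁.update i = .new) ∧ (∀ i, w (.inr i) = true ↔ τ₂.update i = .new) ∧
        Represents N k c' (τ₁.tgt, τ₂.tgt) (overwrite w R d) := by
  classical
  rw [CodeStep, codeEnabled_iff h₁ h₂ hc, h₁.tgt, h₂.tgt]
  refine and_congr_right' ⟨fun ⟨⟨e1, e2⟩, e3, e4⟩ => ?_, fun ⟨w, w1, w2, h⟩ =>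
    ⟨⟨h.fst, h.snd⟩, fun i hi => ?_, fun i hi => ?_⟩⟩
  · refine ⟨Sum.elim (fun i => decide (τ₁.update i = .new)) (fun i => decide (τ₂.update i = .new)),
      by simp, by simp, e1, e2, fun i => ?_, fun i => ?_⟩
    · rw [e3 i i.2, written_eq (h₁.update i) (hc.inl i)]
      simp [overwrite]
    · rw [e4 i i.2, written_eq (h₂.update i) (hc.inr i)]
      simp [overwrite]
  · have := h.inl ⟨i, hi⟩
    dsimp only at this
    rw [this, written_eq (h₁.update ⟨i, hi⟩) (hc.inl ⟨i, hi⟩), overwrite]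
    simp only [w1]
  · have := h.inr ⟨i, hi⟩
    dsimp only at this
    rw [this, written_eq (h₂.update ⟨i, hi⟩) (hc.inr ⟨i, hi⟩), overwrite]
    simp only [w2]

end

/-! ### Bad runs and reachable codes -/

namespace IsCode

variable {L : List ℕ} {a b q k : ℕ} {q₀ : Fin q} {ts : List (Transition (Fin a) (Fin b) (Fin q) k)}
  {N c : ℕ} {p : Fin q × Fin q} {R : Fin k ⊕ Fin k → ℕ}

local notation "W" => Nat.ofDigits 16 L

theorem states_le (h : IsCode L (q₀ : ℕ) ts) : q ≤ 2 ^ L.length ∧ k ≤ L.length := by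
  have hl := congrArg List.length h.eq
  simp only [List.length_append, List.length_replicate, natCode] at hl
  refine ⟨?_, by omega⟩
  have : q < 2 ^ (Nat.digits 2 q).length := Nat.lt_base_pow_length_digits (by omega)
  exact this.le.trans (Nat.pow_le_pow_right (by omega) (by omega))

variable (h : IsCode L (q₀ : ℕ) ts) (hN : 2 ^ L.length ≤ N) (hc : Represents N k c p R)
include h hN hc

theorem badCode_iff : BadCode W L.length k N c ↔
    ∃ d < N, (pairSys {τ | τ ∈ ts}).bad p (orderType (withInput R d)) := by
  refine exists_congr fun d => and_congr_right' ?_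
  exact h.exists_trans_iff hN fun p₁ τ₁ h₁ => h.exists_trans_iff hN fun p₂ τ₂ h₂ =>
    codeBad_iff h₁ h₂ hc

theorem stepCode_iff {c' : ℕ} : StepCode W L.length k N c c' ↔ c = c' ∨
    ∃ d < N, ∃ w p', (pairSys {τ | τ ∈ ts}).step p (orderType (withInput R d)) w p' ∧
      Represents N k c' p' (overwrite w R d) := by
  refine or_congr_right (exists_congr fun d => and_congr_right' ?_)
  refine (h.exists_trans_iff hN fun p₁ τ₁ h₁ => h.exists_trans_iff hN fun p₂ τ₂ h₂ =>
    codeStep_iff h₁ h₂ hc).trans ⟨?_, ?_⟩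
  · rintro ⟨τ₁, m₁, τ₂, m₂, he, w, w1, w2, hr⟩
    exact ⟨w, _, ⟨τ₁, m₁, τ₂, m₂, he, w1, w2, rfl⟩, hr⟩
  · rintro ⟨w, p', ⟨τ₁, m₁, τ₂, m₂, he, w1, w2, rfl⟩, hr⟩
    exact ⟨τ₁, m₁, τ₂, m₂, he, w, w1, w2, hr⟩

omit hc

/-- A path of codes gives a run after stuttering steps are dropped. A run gives a path of codes
below N ^ (2k + 2), which stuttering pads to length exactly `M`. -/
theorem reachesBad_iff {G M : ℕ} {g : Fin k → Fin k → ℕ}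
    (hG : ∀ i j : Fin k, digit (N + 1) G (i * k + j) = g i j) (hM : N ^ (2 * k + 2) ≤ M) :
    (∃ c < M, Reached (InitCode W L.length k N G) (StepCode W L.length k N) M M c ∧
      BadCode W L.length k N c) ↔
    ∃ f : Fin k → ℕ, (∀ i, f i < N) ∧ (∀ i j, GapCompatible (g i j) (f i) (f j)) ∧
      ∃ n ≤ M, (pairSys {τ | τ ∈ ts}).BadIn (Set.Iio N) n (q₀, q₀) (Sum.elim f f) := by
  have hq : q ≤ N := h.states_le.1.trans hN
  have hNpos : 0 < N := (Nat.two_pow_pos _).trans_le hN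
  constructor
  · rintro ⟨c, hcM, hc, hbad⟩
    -- The statement is phrased for arbitrary continuations: a bad run from the represented
    -- configuration extends backwards to one from an initial configuration. `BadIn` unfolds from
    -- its start, whereas `Reached` unfolds from its end.
    have key : ∀ t c, Reached (InitCode W L.length k N G) (StepCode W L.length k N) M t c →
        ∃ (p : Fin q × Fin q) (R : Fin k ⊕ Fin k → ℕ), Represents N k c p R ∧
          ∀ m, (pairSys {τ | τ ∈ ts}).BadIn (Set.Iio N) m p R →
          ∃ f : Fin k → ℕ, (∀ i, f i < N) ∧ (∀ i j, GapCompatible (g i j) (f i) (f j)) ∧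
            ∃ n ≤ t + m, (pairSys {τ | τ ∈ ts}).BadIn (Set.Iio N) n (q₀, q₀) (Sum.elim f f) := by
      intro t
      induction t with
      | zero =>
        rintro c ⟨⟨h1, h2⟩, h3, h4⟩
        rw [h.numAt_start hN] at h1 h2
        refine ⟨(q₀, q₀), Sum.elim (fun i => digit N c (2 + i)) (fun i => digit N c (2 + i)),
          ⟨h1, h2, fun i => rfl, fun i => (h3 i i.2).symm⟩, fun m hm =>
          ⟨_, fun i => Nat.mod_lt _ hNpos, fun i j => ?_, m, by omega, hm⟩⟩
        rw [← hG]
        exact h4 i i.2 j j.2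
      | succ t ih =>
        rintro c' ⟨c, -, hc, hs⟩
        obtain ⟨p, R, hr, hb⟩ := ih c hc
        rcases (h.stepCode_iff hN hr).1 hs with rfl | ⟨d, hd, w, p', hs, hr'⟩
        · refine ⟨p, R, hr, fun m hm => ?_⟩
          obtain ⟨f, h1, h2, n, hn, h3⟩ := hb m hm
          exact ⟨f, h1, h2, n, by omega, h3⟩
        · refine ⟨p', _, hr', fun m hm => ?_⟩
          obtain ⟨f, h1, h2, n, hn, h3⟩ := hb (m + 1) (.step hd hs hm)
          exact ⟨f, h1, h2, n, by omega, h3⟩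
    obtain ⟨p, R, hr, hb⟩ := key M c hc
    obtain ⟨d, hd, hbad⟩ := (h.badCode_iff hN hr).1 hbad
    exact hb 0 (.bad hd hbad)
  · rintro ⟨f, hf, hg, n, hn, hb⟩
    have key : ∀ {n p R}, (pairSys {τ | τ ∈ ts}).BadIn (Set.Iio N) n p R → (∀ j, R j < N) →
        ∀ t c, c < M → Represents N k c p R →
        Reached (InitCode W L.length k N G) (StepCode W L.length k N) M t c → ∃ c' < M,
          Reached (InitCode W L.length k N G) (StepCode W L.length k N) M (t + n) c' ∧
            BadCode W L.length k N c' := by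
      intro n p R hb
      induction hb with
      | bad hd hb => exact fun _ t c hcM hr hc => ⟨c, hcM, hc, (h.badCode_iff hN hr).2 ⟨_, hd, hb⟩⟩
      | @step n p R d w p' hd hs _ ih =>
        intro hR t c hcM hr hc
        have hR' : ∀ j, overwrite w R d j < N := fun j => by
          rw [overwrite]; split
          exacts [hd, hR j]
        obtain ⟨c', hc', hr'⟩ := exists_represents hq p' hR'
        have := ih hR' (t + 1) c' (hc'.trans_le hM) hr'
          ⟨c, hcM, hc, (h.stepCode_iff hN hr).2 (Or.inr ⟨d, hd, w, p', hs, hr'⟩)⟩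
        rwa [Nat.add_assoc, Nat.add_comm 1 n] at this
    -- Stuttering at the configuration reached fills the remaining steps.
    have pad : ∀ s t c, c < M →
        Reached (InitCode W L.length k N G) (StepCode W L.length k N) M t c →
        Reached (InitCode W L.length k N G) (StepCode W L.length k N) M (t + s) c := by
      intro s
      induction s with
      | zero => exact fun t c _ h => h
      | succ s ih => exact fun t c hcM hc => ⟨c, hcM, ih t c hcM hc, Or.inl rfl⟩
    have hR : ∀ j : Fin k ⊕ Fin k, Sum.elim f f j < N := by rintro (i | i) <;> exact hf i
    obtain ⟨c, hc, hr⟩ := exists_represents hq (q₀, q₀) hR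
    obtain ⟨c', hc', h1, h2⟩ := key hb hR 0 c (hc.trans_le hM) hr
      ⟨⟨by rw [h.numAt_start hN, hr.fst], by rw [h.numAt_start hN, hr.snd]⟩,
        fun i hi => (hr.inl ⟨i, hi⟩).trans (hr.inr ⟨i, hi⟩).symm, fun i hi j hj => by
          have e1 := hr.inl ⟨i, hi⟩
          have e2 := hr.inl ⟨j, hj⟩
          have e3 := hG ⟨i, hi⟩ ⟨j, hj⟩
          dsimp only at e1 e2 e3
          rw [e1, e2, e3]
          exact hg _ _⟩
    refine ⟨c', hc', ?_, h2⟩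
    have := pad (M - n) (0 + n) c' hc' h1
    rwa [Nat.zero_add, Nat.add_sub_cancel' hn] at this

end IsCode

/-! ### Stores with finitely many stacks in use -/

/-- The store whose first stacks are `l`. -/
def frame {D : Type u} (l : List (List (Cell D))) (ρ : Fin 4 → D) : Store D :=
  ⟨fun i => l.getD i [], ρ⟩

theorem frame_stack {D : Type u} (l : List (List (Cell D))) (ρ : Fin 4 → D) (i : ℕ) :
    (frame l ρ).stack i = l.getD i [] := rfl

theorem frame_set {D : Type u} (l : List (List (Cell D))) (ρ : Fin 4 → D) {i : ℕ} (h : i < l.length)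
    (x : List (Cell D)) : (frame l ρ).set i x = frame (l.set i x) ρ :=
  Store.ext (fun j => by
    rw [Store.set_stack, frame_stack, frame_stack, List.getD_eq_getElem?_getD,
      List.getD_eq_getElem?_getD, List.getElem?_set]
    by_cases e : i = j
    · subst e; simp [h]
    · rw [if_neg (Ne.symm e), if_neg e]) rfl

theorem frame_setReg {D : Type u} (l : List (List (Cell D))) (ρ : Fin 4 → D) (r : Fin 4) (d : D) :
    (frame l ρ).setReg r d = frame l (Function.update ρ r d) := rfl

theorem frame_stack_of_le {D : Type u} (l : List (List (Cell D))) (ρ : Fin 4 → D) {i : ℕ}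
    (h : l.length ≤ i) : (frame l ρ).stack i = [] := List.getD_eq_default _ _ h

/-- The stacks of the main program: the input, the reversed input, the code of the input, its length,
the number of data values in it, a buffer, the number of values, the number of configurations, two
copies of the data values, a counter, a gap, the code of all gaps, the result, and a buffer. -/
def mainStore {D : Type u} (w w' : List (Cell D)) (W n k : ℕ) (b : List (Cell D)) (N M : ℕ)
    (v v' : List (Cell D)) (c h G out : ℕ) (ρ : Fin 4 → D) : Store D :=
  frame [w, w', unary D W, unary D n, unary D k, b, unary D N, unary D M, v, v', unary D c, unary D h,
    unary D G, unary D out, []] ρ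

theorem mainStore_stack_of_le {D : Type u} {w w' : List (Cell D)} {W n k : ℕ} {b : List (Cell D)}
    {N M : ℕ} {v v' : List (Cell D)} {c h G out : ℕ} {ρ : Fin 4 → D} {j : ℕ} (hj : 15 ≤ j) :
    (mainStore w w' W n k b N M v v' c h G out ρ).stack j = [] := frame_stack_of_le _ _ hj

namespace Cmd

/-- Replace the number in stack `i` by a computed number, by means of the empty stack `t`. -/
def assign (P : (ℕ → ℕ) → ℕ → ℕ → Cmd) (ins : ℕ → ℕ) (i t F : ℕ) : Cmd :=
  seq (P ins t F) (seq (clear i) (move t i))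

/-- The time is expressed by a common bound `B` on the arguments and on the number that is
overwritten, so that it can be used uniformly in all rounds of a loop. -/
theorem runs_assign {α : Type} [Ctx α] {f : α → ℕ} (hf : FP.{u} f) :
    ∃ (P : (ℕ → ℕ) → ℕ → ℕ → Cmd) (T : ℕ → ℕ), PolyBounded T ∧ ∀ (ins : ℕ → ℕ) (i t F : ℕ),
      (∀ j < arity α, ins j < F ∧ ins j ≠ t) → i < F → i ≠ t → t < F →
      ∀ (D : Type u) [AddGroup D] [LinearOrder D] (s : Store D) (x : α) (v B : ℕ), Holds s ins x →
      s.stack i = unary D v → s.stack t = [] → (∀ j ≥ F, s.stack j = []) → size x ≤ B → v ≤ B →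
      Runs (assign P ins i t F) s (T B) (s.set i (unary D (f x))) := by
  obtain ⟨⟨d, hd⟩, t, ⟨c, hc⟩, P, hP⟩ := hf
  have hX : PolyBounded fun B : ℕ => B + 2 := (PolyBounded.size.mono fun B => by rw [size_nat]).add
    (.const 2)
  refine ⟨P, fun B => (B + 2) ^ c + 2 * B + 2 * (B + 2) ^ d + 2,
    (((hX.pow c).add ((PolyBounded.const 2).mul (PolyBounded.size.mono fun B => by
      rw [size_nat]))).add ((PolyBounded.const 2).mul (hX.pow d))).add (.const 2), ?_⟩
  intro ins i t F h1 hi hit ht D _ _ s x v B hx hv hs hF hxB hvB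
  have r1 := hP ins t F h1 ht D s x hx hs hF
  have r2 := runs_clear (i := i) (n := v) (s := s.set t (unary D (f x)))
    (by rw [Store.set_stack_of_ne _ _ hit, hv])
  have r3 := runs_move (i := t) (j := i) (n := f x) (m := 0)
    (s := (s.set t (unary D (f x))).set i []) hit.symm
    (by rw [Store.set_stack_of_ne _ _ hit.symm, Store.set_stack_self]) (by simp)
  have b1 := (hd x).trans (Nat.pow_le_pow_left (Nat.add_le_add_right hxB 2) d)
  have b2 := (hc x).trans (Nat.pow_le_pow_left (Nat.add_le_add_right hxB 2) c)
  refine ((r1.seq (r2.seq r3)).mono (by dsimp only; omega)).congr (Store.ext (fun k => ?_) rfl)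
  simp only [Store.set_stack]
  grind

/-- Push `n` separators to stack `i`. -/
def pushes (i n : ℕ) : Cmd := seqRange (fun _ => push i .sep) n

variable {D : Type u} [AddGroup D] [LinearOrder D]

theorem runs_pushes {i n m : ℕ} {s : Store D} (h : s.stack i = unary D m) :
    Runs (pushes i n) s (n + 1) (s.set i (unary D (m + n))) := by
  have := runs_seqRange (c := fun _ => push i .sep) (T := 1) (m := n)
    (fun j => s.set i (unary D (m + j))) fun j _ => (runs_push _ _ _).congr
      (Store.ext (fun l => by
        simp only [Store.set_stack, if_true, ← unary_succ]
        split <;> rfl) rfl)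
  refine (this.mono (by omega)).congr_left (Store.ext (fun l => ?_) rfl)
  simp only [Store.set_stack]
  grind

theorem runs_pushReg (i : ℕ) (r : Fin 4) (s : Store D) :
    Runs (pushReg i r) s 1 (s.set i (Cell.val (s.reg r) :: s.stack i)) := ⟨1, le_rfl, .pushReg i r s⟩

theorem runs_loop_nil {i : ℕ} {r : Fin 4} {f : Letter → Cmd} {g : Cmd} {s : Store D}
    (h : s.stack i = []) : Runs (loop i r f g) s 1 s := ⟨1, le_rfl, .loop_nil h⟩

theorem runs_loop_sym {i : ℕ} {r : Fin 4} {f : Letter → Cmd} {g : Cmd} {s s' s'' : Store D}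
    {a : Letter} {l : List (Cell D)} {T T' : ℕ} (h : s.stack i = Cell.sym a :: l)
    (h1 : Runs (f a) (s.set i l) T s') (h2 : Runs (loop i r f g) s' T' s'') :
    Runs (loop i r f g) s (T + T' + 1) s'' := by
  obtain ⟨n, hn, h1⟩ := h1
  obtain ⟨m, hm, h2⟩ := h2
  exact ⟨n + m + 1, by omega, .loop_sym h h1 h2⟩

theorem runs_loop_val {i : ℕ} {r : Fin 4} {f : Letter → Cmd} {g : Cmd} {s s' s'' : Store D}
    {d : D} {l : List (Cell D)} {T T' : ℕ} (h : s.stack i = Cell.val d :: l)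
    (h1 : Runs g ((s.set i l).setReg r d) T s') (h2 : Runs (loop i r f g) s' T' s'') :
    Runs (loop i r f g) s (T + T' + 1) s'' := by
  obtain ⟨n, hn, h1⟩ := h1
  obtain ⟨m, hm, h2⟩ := h2
  exact ⟨n + m + 1, by omega, .loop_val h h1 h2⟩

/-! ### Reading the input -/

/-- The data values in a word. -/
def _root_.dataValues (w : List (Cell D)) : List D :=
  w.filterMap fun a => match a with
    | .sym _ => none
    | .val d => some d

/-- Reverse the input and collect its data values. -/
def reverseInput : Cmd :=
  loop 0 1 (fun a => push 1 a) (seq (pushReg 1 1) (seq (pushReg 8 1) (pushReg 9 1)))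

/-- Reversal puts the last cell on top, so that the Horner scheme makes the first letter the least
significant digit. The data values are stored twice, for the two nested loops over pairs. -/
theorem runs_reverseInput (w w' v : List (Cell D)) (ρ : Fin 4 → D) :
    ∃ ρ', Runs reverseInput (mainStore w w' 0 0 0 [] 0 0 v v 0 0 0 0 ρ) (4 * w.length + 1)
      (mainStore [] (w.reverse ++ w') 0 0 0 [] 0 0 (((dataValues w).map Cell.val).reverse ++ v)
        (((dataValues w).map Cell.val).reverse ++ v) 0 0 0 0 ρ') := by
  induction w generalizing w' v ρ with
  | nil => exact ⟨ρ, (runs_loop_nil rfl).mono (by simp)⟩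
  | cons a w ih =>
    rcases a with a | d
    · obtain ⟨ρ', h⟩ := ih (Cell.sym a :: w') v ρ
      refine ⟨ρ', ((runs_loop_sym (l := w) (a := a) (T := 1) rfl ((runs_push _ _ _).congr ?_) h).mono
        (by simp only [List.length_cons]; omega)).congr ?_⟩
      · simp only [mainStore]
        rw [frame_set _ _ (by simp), frame_set _ _ (by simp)]
        rfl
      · simp [dataValues]
    · obtain ⟨ρ', h⟩ := ih (Cell.val d :: w') (Cell.val d :: v) (Function.update ρ 1 d)
      refine ⟨ρ', ((runs_loop_val (l := w) (d := d) (T := 3) rfl (((runs_pushReg _ _ _).seq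
        ((runs_pushReg _ _ _).seq (runs_pushReg _ _ _))).congr ?_) h).mono
        (by simp only [List.length_cons]; omega)).congr ?_⟩
      · simp only [mainStore]
        rw [frame_set _ _ (by simp), frame_setReg, frame_set _ _ (by simp), frame_set _ _ (by simp),
          frame_set _ _ (by simp)]
        rfl
      · simp [dataValues]

/-- Code the input, whose reversal is on stack `1`, and count its cells and data values. The program
`P` multiplies by 16. -/
def codeInput (P : (ℕ → ℕ) → ℕ → ℕ → Cmd) : Cmd :=
  loop 1 1 (fun a => seq (assign P (fun _ => 2) 2 14 15) (seq (pushes 2 a.code) (push 3 .sep)))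
    (seq (assign P (fun _ => 2) 2 14 15) (seq (pushes 2 9) (seq (push 3 .sep) (push 4 .sep))))

/-- The number with the base 16 digits `W` followed by the codes in `w`. -/
def _root_.hornerCode (W : ℕ) (w : List (Cell D)) : ℕ := w.foldl (fun W a => 16 * W + a.code) W

omit [AddGroup D] [LinearOrder D] in
theorem _root_.le_hornerCode (W : ℕ) (w : List (Cell D)) : W ≤ hornerCode W w := by
  induction w generalizing W with
  | nil => exact le_rfl
  | cons a w ih => exact le_trans (by omega) (ih (16 * W + a.code))

theorem runs_codeInput : ∃ (c : Cmd) (T : ℕ → ℕ), PolyBounded T ∧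
    ∀ (D : Type u) [AddGroup D] [LinearOrder D] (w : List (Cell D)) (W n k : ℕ) (v : List (Cell D))
      (ρ : Fin 4 → D) (B : ℕ), hornerCode W w ≤ B →
    ∃ ρ', Runs c (mainStore [] w W n k [] 0 0 v v 0 0 0 0 ρ) (w.length * T B + 1)
      (mainStore [] [] (hornerCode W w) (n + w.length) (k + (dataValues w).length) [] 0 0 v v 0 0 0 0
        ρ') := by
  obtain ⟨P, T, hT, h⟩ := runs_assign (f := fun W : ℕ => 16 * W) (.mul (.const 16) .id)
  refine ⟨codeInput P, fun B => T B + 20, hT.add (.const 20), ?_⟩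
  intro D _ _ w
  have step : ∀ (w : List (Cell D)) (W n k : ℕ) (v : List (Cell D)) (ρ : Fin 4 → D) (B : ℕ), W ≤ B →
      Runs (assign P (fun _ => 2) 2 14 15) (mainStore [] w W n k [] 0 0 v v 0 0 0 0 ρ) (T B)
        (mainStore [] w (16 * W) n k [] 0 0 v v 0 0 0 0 ρ) := fun w W n k v ρ B hB => by
    refine (h (fun _ => 2) 2 14 15 (fun _ _ => by omega) (by omega) (by omega) (by omega) D _ W W B
      (fun _ _ => rfl) rfl rfl (fun j hj => mainStore_stack_of_le hj)
      (by rwa [size_nat]) hB).congr ?_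
    simp only [mainStore]
    rw [frame_set _ _ (by simp)]
    rfl
  induction w with
  | nil => exact fun W n k v ρ B _ => ⟨ρ, (runs_loop_nil rfl).mono (by simp)⟩
  | cons a w ih =>
    intro W n k v ρ B hB
    have hB' : W ≤ B := (le_hornerCode W (a :: w)).trans hB
    rcases a with a | d
    · obtain ⟨ρ', h'⟩ := ih (16 * W + a.code) (n + 1) k v ρ B hB
      refine ⟨ρ', ((runs_loop_sym (l := w) (a := a) (T := T B + (a.code + 1 + 1)) rfl ((Runs.congr_left
        (step w W n k v ρ B hB') ?_).seq (((runs_pushes (m := 16 * W) rfl).seq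
          (runs_push _ _ _)).congr ?_)) h').mono ?_).congr ?_⟩
      · simp only [mainStore]
        rw [frame_set _ _ (by simp)]
        rfl
      · simp only [mainStore]
        rw [frame_set _ _ (by simp), frame_set _ _ (by simp)]
        rfl
      · have := a.code_lt
        rw [List.length_cons, Nat.succ_mul]; dsimp only; omega
      · simp only [dataValues, List.filterMap_cons, hornerCode, List.foldl_cons, Cell.code,
          List.length_cons]
        congr 1; omega
    · obtain ⟨ρ', h'⟩ := ih (16 * W + 9) (n + 1) (k + 1) v (Function.update ρ 1 d) B hB
      refine ⟨ρ', ((runs_loop_val (l := w) (d := d) (T := T B + (10 + (1 + 1))) rfl ((Runs.congr_left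
        (step w W n k v (Function.update ρ 1 d) B hB') ?_).seq (((runs_pushes (m := 16 * W) rfl).seq
          ((runs_push _ _ _).seq (runs_push _ _ _))).congr ?_)) h').mono ?_).congr ?_⟩
      · simp only [mainStore]
        rw [frame_set _ _ (by simp)]
        rfl
      · simp only [mainStore]
        rw [frame_set _ _ (by simp), frame_set _ _ (by simp), frame_set _ _ (by simp)]
        rfl
      · rw [List.length_cons, Nat.succ_mul]; dsimp only; omega
      · simp only [dataValues, List.filterMap_cons, hornerCode, List.foldl_cons, Cell.code,
          List.length_cons]
        congr 1 <;> omega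

end Cmd

namespace Cmd

variable {D : Type u} [AddGroup D] [LinearOrder D]

theorem _root_.PolyBounded.id : PolyBounded fun B : ℕ => B :=
  PolyBounded.size.mono fun B => by rw [size_nat]

/-! ### Computing the number of values and the number of configurations -/

/-- The number of values arises from 2 by (n + 3) ^ 6 squarings, and the number of configurations by
2n + 2 multiplications. All intermediate numbers are at most the final ones, which `B` bounds. -/
theorem runs_bounds : ∃ (c : Cmd) (T : ℕ → ℕ), PolyBounded T ∧
    ∀ (D : Type u) [AddGroup D] [LinearOrder D] (W n k : ℕ) (v : List (Cell D)) (ρ : Fin 4 → D)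
      (B : ℕ), (n + 3) ^ 6 ≤ B → 2 * n + 2 ≤ B → valueBound n ^ (2 * n + 2) + valueBound n ≤ B →
    Runs c (mainStore [] [] W n k [] 0 0 v v 0 0 0 0 ρ) (T B)
      (mainStore [] [] W n k [] (valueBound n) (valueBound n ^ (2 * n + 2)) v v 0 0 0 0 ρ) := by
  have h3 : FP.{u} fun n : ℕ => n + 3 := .add .id (.const 3)
  obtain ⟨P₁, T₁, hT₁, h₁⟩ := runs_assign (f := fun n : ℕ => (n + 3) ^ 6)
    ((FP.mul (.mul (.mul h3 h3) (.mul h3 h3)) (.mul h3 h3)).congr fun n => by ring)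
  obtain ⟨P₂, T₂, hT₂, h₂⟩ := runs_assign (f := fun n : ℕ => n * n) (FP.mul.{u} .id .id)
  obtain ⟨P₃, T₃, hT₃, h₃⟩ := runs_assign (f := fun n : ℕ => 2 * n + 2)
    (FP.add.{u} (.mul (.const 2) .id) (.const 2))
  obtain ⟨P₄, T₄, hT₄, h₄⟩ := runs_assign (f := fun p : ℕ × ℕ => p.1 * p.2)
    (FP.mul.{u} FP.id.weaken .snd)
  refine ⟨seq (seq (assign P₁ (fun _ => 3) 10 14 15) (seq (pushes 6 2)
      (each 10 (assign P₂ (fun _ => 6) 6 14 15))))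
    (seq (assign P₃ (fun _ => 3) 10 14 15) (seq (pushes 7 1)
      (each 10 (assign P₄ (fun j => if j = 1 then 6 else 7) 7 14 15)))),
    fun B => T₁ B + T₃ B + B * (T₂ B + 1) + B * (T₄ B + 1) + 7,
    (((hT₁.add hT₃).add (PolyBounded.id.mul (hT₂.add (.const 1)))).add
      (PolyBounded.id.mul (hT₄.add (.const 1)))).add (.const 7), ?_⟩
  intro D _ _ W n k v ρ B hE hn hB
  set E := (n + 3) ^ 6 with hE'
  set N := valueBound n with hN
  have hN2 : ∀ m, 2 ^ 2 ^ m * 2 ^ 2 ^ m = 2 ^ 2 ^ (m + 1) := fun m => by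
    rw [← pow_add]; congr 1; rw [pow_succ]; ring
  have hNE : ∀ m ≤ E, 2 ^ 2 ^ m ≤ N := fun m hm =>
    Nat.pow_le_pow_right (by omega) (Nat.pow_le_pow_right (by omega) hm)
  have hN1 : 1 ≤ N := Nat.one_le_two_pow
  have r1 : Runs (assign P₁ (fun _ => 3) 10 14 15) (mainStore [] [] W n k [] 0 0 v v 0 0 0 0 ρ) (T₁ B)
      (mainStore [] [] W n k [] 0 0 v v E 0 0 0 ρ) := by
    refine (h₁ (fun _ => 3) 10 14 15 (fun _ _ => by omega) (by omega) (by omega) (by omega) D _ n 0 B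
      (fun _ _ => rfl) rfl rfl (fun j hj => mainStore_stack_of_le hj) (by rw [size_nat]; omega)
      (by omega)).congr ?_
    simp only [mainStore]
    rw [frame_set _ _ (by simp)]
    rfl
  have r2 : Runs (pushes 6 2) (mainStore [] [] W n k [] 0 0 v v E 0 0 0 ρ) 3
      (mainStore [] [] W n k [] 2 0 v v E 0 0 0 ρ) := by
    refine (runs_pushes (m := 0) rfl).congr ?_
    simp only [mainStore]
    rw [frame_set _ _ (by simp)]
    rfl
  have r3 := runs_each (i := 10) (c := assign P₂ (fun _ => 6) 6 14 15) (n := E) (T := T₂ B)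
    (fun m => mainStore [] [] W n k [] (2 ^ 2 ^ (E - m)) 0 v v m 0 0 0 ρ) (fun m _ => rfl)
    (fun m hm => by
      have e : E - m = E - (m + 1) + 1 := by omega
      have hle := hNE (E - (m + 1)) (by omega)
      have hs : (mainStore [] [] W n k [] (2 ^ 2 ^ (E - (m + 1))) 0 v v (m + 1) 0 0 0 ρ).set 10
          (unary D m) = mainStore [] [] W n k [] (2 ^ 2 ^ (E - (m + 1))) 0 v v m 0 0 0 ρ := by
        simp only [mainStore]
        rw [frame_set _ _ (by simp)]
        rfl
      rw [hs]
      refine (h₂ (fun _ => 6) 6 14 15 (fun _ _ => by omega) (by omega) (by omega) (by omega) D _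
        (2 ^ 2 ^ (E - (m + 1))) (2 ^ 2 ^ (E - (m + 1))) B (fun _ _ => rfl) rfl rfl
        (fun j hj => mainStore_stack_of_le hj) (by rw [size_nat]; omega) (by omega)).congr ?_
      rw [hN2, ← e]
      simp only [mainStore]
      rw [frame_set _ _ (by simp)]
      rfl)
  simp only [Nat.sub_self, Nat.sub_zero, pow_zero, pow_one] at r3
  have r4 : Runs (assign P₃ (fun _ => 3) 10 14 15) (mainStore [] [] W n k [] N 0 v v 0 0 0 0 ρ) (T₃ B)
      (mainStore [] [] W n k [] N 0 v v (2 * n + 2) 0 0 0 ρ) := by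
    refine (h₃ (fun _ => 3) 10 14 15 (fun _ _ => by omega) (by omega) (by omega) (by omega) D _ n 0 B
      (fun _ _ => rfl) rfl rfl (fun j hj => mainStore_stack_of_le hj) (by rw [size_nat]; omega)
      (by omega)).congr ?_
    simp only [mainStore]
    rw [frame_set _ _ (by simp)]
    rfl
  have r5 : Runs (pushes 7 1) (mainStore [] [] W n k [] N 0 v v (2 * n + 2) 0 0 0 ρ) 2
      (mainStore [] [] W n k [] N 1 v v (2 * n + 2) 0 0 0 ρ) := by
    refine (runs_pushes (m := 0) rfl).congr ?_
    simp only [mainStore]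
    rw [frame_set _ _ (by simp)]
    rfl
  have r6 := runs_each (i := 10) (c := assign P₄ (fun j => if j = 1 then 6 else 7) 7 14 15)
    (n := 2 * n + 2) (T := T₄ B)
    (fun m => mainStore [] [] W n k [] N (N ^ (2 * n + 2 - m)) v v m 0 0 0 ρ) (fun m _ => rfl)
    (fun m hm => by
      have e : 2 * n + 2 - m = 2 * n + 2 - (m + 1) + 1 := by omega
      have hle : N ^ (2 * n + 2 - (m + 1)) ≤ N ^ (2 * n + 2) := Nat.pow_le_pow_right hN1 (by omega)
      have hs : (mainStore [] [] W n k [] N (N ^ (2 * n + 2 - (m + 1))) v v (m + 1) 0 0 0 ρ).set 10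
          (unary D m) = mainStore [] [] W n k [] N (N ^ (2 * n + 2 - (m + 1))) v v m 0 0 0 ρ := by
        simp only [mainStore]
        rw [frame_set _ _ (by simp)]
        rfl
      rw [hs]
      refine (h₄ (fun j => if j = 1 then 6 else 7) 7 14 15 (fun j _ => by split <;> omega) (by omega)
        (by omega) (by omega) D _ (N ^ (2 * n + 2 - (m + 1)), N) (N ^ (2 * n + 2 - (m + 1))) B
        (fun j hj => ?_) rfl rfl
        (fun j hj => mainStore_stack_of_le hj) (by rw [size_prod, size_nat]; dsimp only; omega)
        (by omega)).congr ?_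
      · have hj : j < 2 := hj
        interval_cases j <;> rfl
      · dsimp only
        rw [← pow_succ, ← e]
        simp only [mainStore]
        rw [frame_set _ _ (by simp)]
        rfl)
  simp only [Nat.sub_self, Nat.sub_zero, pow_zero] at r6
  refine ((r1.seq (r2.seq r3)).seq (r4.seq (r5.seq r6))).mono ?_
  have b1 : E * (T₂ B + 1) ≤ B * (T₂ B + 1) := Nat.mul_le_mul_right _ hE
  have b2 : (2 * n + 2) * (T₄ B + 1) ≤ B * (T₄ B + 1) := Nat.mul_le_mul_right _ hn
  dsimp only
  omega

/-! ### Computing the gaps between the initial values -/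

theorem runs_test {x y : Fin 4} {f : Ordering → Cmd} {s s' : Store D} {T : ℕ}
    (h : Runs (f (cmp (s.reg x) (s.reg y))) s T s') : Runs (test x y f) s (T + 1) s' := by
  obtain ⟨n, hn, h⟩ := h
  exact ⟨n + 1, by omega, .test h⟩

/-- Add to stack `11` the gap between the contents of registers `0` and `1`. -/
def countGap : Cmd :=
  test 0 1 fun o => match o with
    | .lt => seq (seq (setZero 2) (seq (sum 2 0 2) (setUnit 3))) (seq (copy 6 10 14)
        (each 10 (seq (sum 2 2 3) (test 2 1 fun o => match o with
          | .gt => skip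
          | _ => push 11 .sep))))
    | _ => skip

/-- Repeatedly adding the unit on the right produces x + t • e and each sum is compared with `y`.
Register 0 must survive, because the same `x` is used for a whole row. -/
theorem runs_countGap {W n k : ℕ} {b : List (Cell D)} {N M : ℕ} {v v' : List (Cell D)} {G : ℕ}
    {ρ : Fin 4 → D} {x y : D} (hx : ρ 0 = x) (hy : ρ 1 = y) :
    ∃ ρ', ρ' 0 = x ∧ Runs countGap (mainStore [] [] W n k b N M v v' 0 0 G 0 ρ) (9 * N + 8)
      (mainStore [] [] W n k b N M v v' 0 (gap N x y) G 0 ρ') := by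
  by_cases hxy : x < y
  · set e := unitElement D with he
    -- After `t` rounds, register 2 holds x + t • e and register 3 the unit.
    let ρt : ℕ → Fin 4 → D := fun t => Function.update (Function.update ρ 2 (x + t • e)) 3 e
    let cnt : ℕ → ℕ := fun m => ((Finset.range m).filter fun t => x + (t + 1) • e ≤ y).card
    refine ⟨ρt N, by simp [ρt, hx], ?_⟩
    have r1 : Runs (seq (setZero 2) (seq (sum 2 0 2) (setUnit 3)))
        (mainStore [] [] W n k b N M v v' 0 0 G 0 ρ) (1 + (1 + 1))
        (mainStore [] [] W n k b N M v v' 0 0 G 0 (ρt 0)) := by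
      refine Runs.congr (Runs.seq ⟨1, le_rfl, .setZero _ _⟩ (Runs.seq ⟨1, le_rfl, .sum _ _ _ _⟩
        ⟨1, le_rfl, .setUnit _ _⟩)) ?_
      simp only [mainStore, frame_setReg]
      congr 1
      have h0 : (frame [[], [], unary D W, unary D n, unary D k, b, unary D N, unary D M, v, v',
        unary D 0, unary D 0, unary D G, unary D 0, []] (Function.update ρ 2 0)).reg =
          Function.update ρ 2 0 := rfl
      rw [h0]
      funext j
      fin_cases j <;> simp [ρt, hx, he]
    have r2 : Runs (copy 6 10 14) (mainStore [] [] W n k b N M v v' 0 0 G 0 (ρt 0)) (5 * N + 2)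
        (mainStore [] [] W n k b N M v v' N 0 G 0 (ρt 0)) := by
      refine (runs_copy (n := N) (by omega) (by omega) (by omega) rfl rfl rfl).congr ?_
      simp only [mainStore]
      rw [frame_set _ _ (by simp)]
      rfl
    have r3 := runs_each (i := 10) (c := seq (sum 2 2 3) (test 2 1 fun o => match o with
          | .gt => skip
          | _ => push 11 .sep)) (n := N) (T := 1 + (1 + 1))
      (fun m => mainStore [] [] W n k b N M v v' m (cnt (N - m)) G 0 (ρt (N - m))) (fun m _ => rfl)
      (fun m hm => by
        have e1 : N - m = N - (m + 1) + 1 := by omega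
        rw [e1]
        set t := N - (m + 1)
        have hs : (mainStore [] [] W n k b N M v v' (m + 1) (cnt t) G 0 (ρt t)).set 10 (unary D m) =
            mainStore [] [] W n k b N M v v' m (cnt t) G 0 (ρt t) := by
          simp only [mainStore]
          rw [frame_set _ _ (by simp)]
          rfl
        rw [hs]
        have q1 : Runs (sum 2 2 3) (mainStore [] [] W n k b N M v v' m (cnt t) G 0 (ρt t)) 1
            (mainStore [] [] W n k b N M v v' m (cnt t) G 0 (ρt (t + 1))) := by
          refine Runs.congr ⟨1, le_rfl, .sum _ _ _ _⟩ ?_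
          simp only [mainStore, frame_setReg]
          congr 1
          have h0 : (frame [[], [], unary D W, unary D n, unary D k, b, unary D N, unary D M, v, v',
            unary D m, unary D (cnt t), unary D G, unary D 0, []] (ρt t)).reg = ρt t := rfl
          rw [h0]
          funext j
          fin_cases j <;> simp [ρt, succ_nsmul, add_assoc]
        refine q1.seq (runs_test ?_)
        have h2 : (mainStore [] [] W n k b N M v v' m (cnt t) G 0 (ρt (t + 1))).reg 2 =
            x + (t + 1) • e := by
          change ρt (t + 1) 2 = _
          simp [ρt]
        have h1 : (mainStore [] [] W n k b N M v v' m (cnt t) G 0 (ρt (t + 1))).reg 1 = y := by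
          change ρt (t + 1) 1 = _
          simp [ρt, hy]
        rw [h2, h1]
        have hc : cnt (t + 1) = if x + (t + 1) • e ≤ y then cnt t + 1 else cnt t := by
          simp only [cnt, Finset.range_add_one, Finset.filter_insert]
          split
          · rw [Finset.card_insert_of_notMem (by simp)]
          · rfl
        have hpush : Runs (push 11 .sep) (mainStore [] [] W n k b N M v v' m (cnt t) G 0 (ρt (t + 1))) 1
            (mainStore [] [] W n k b N M v v' m (cnt t + 1) G 0 (ρt (t + 1))) := by
          refine (runs_push _ _ _).congr ?_
          simp only [mainStore]
          rw [frame_set _ _ (by simp)]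
          rfl
        rcases lt_trichotomy (x + (t + 1) • e) y with h | h | h
        · rw [hc, if_pos h.le, cmp_eq_lt_iff _ _ |>.2 h]
          exact hpush
        · rw [hc, if_pos h.le, cmp_eq_eq_iff _ _ |>.2 h]
          exact hpush
        · rw [hc, if_neg (not_le.2 h), cmp_eq_gt_iff _ _ |>.2 h]
          exact runs_skip _)
    simp only [Nat.sub_self, Nat.sub_zero] at r3
    have hg : gap N x y = cnt N := by rw [gap, if_pos hxy]
    rw [hg]
    refine (runs_test ?_).mono (by omega : 1 + (1 + 1) + (5 * N + 2 + (N * (1 + (1 + 1) + 1) + 1)) + 1 ≤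
      9 * N + 8)
    have : cmp ((mainStore [] [] W n k b N M v v' 0 0 G 0 ρ).reg 0)
        ((mainStore [] [] W n k b N M v v' 0 0 G 0 ρ).reg 1) = .lt := by
      rw [cmp_eq_lt_iff]
      change ρ 0 < ρ 1
      rwa [hx, hy]
    rw [this]
    exact r1.seq (r2.seq r3)
  · refine ⟨ρ, hx, ?_⟩
    rw [gap, if_neg hxy]
    refine (runs_test ?_).mono (by omega : 1 + 1 ≤ 9 * N + 8)
    have h : ¬ cmp ((mainStore [] [] W n k b N M v v' 0 0 G 0 ρ).reg 0)
        ((mainStore [] [] W n k b N M v v' 0 0 G 0 ρ).reg 1) = .lt := by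
      rw [cmp_eq_lt_iff]
      change ¬ ρ 0 < ρ 1
      rwa [hx, hy]
    generalize cmp ((mainStore [] [] W n k b N M v v' 0 0 G 0 ρ).reg 0)
      ((mainStore [] [] W n k b N M v v' 0 0 G 0 ρ).reg 1) = o at h ⊢
    cases o
    · exact absurd rfl h
    · exact runs_skip _
    · exact runs_skip _

end Cmd

/-! ### The matrix of gaps as a number -/

section

variable {D : Type u} [AddGroup D] [LinearOrder D]

/-- Append the gaps between `x` and the elements of `u` as digits to `G`. -/
noncomputable def gapRow (N : ℕ) (x : D) (u : List D) (G : ℕ) : ℕ :=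
  u.foldl (fun G y => G * (N + 1) + gap N x y) G

/-- Append the gaps between the elements of `u'` and `u` as digits to `G`. -/
noncomputable def gapRows (N : ℕ) (u u' : List D) (G : ℕ) : ℕ :=
  u'.foldl (fun G x => gapRow N x u G) G

theorem le_gapRow (N : ℕ) (x : D) (u : List D) (G : ℕ) : G ≤ gapRow N x u G := by
  induction u generalizing G with
  | nil => exact le_rfl
  | cons y u ih => exact le_trans (by rw [Nat.mul_succ]; omega) (ih (G * (N + 1) + gap N x y))

theorem le_gapRows (N : ℕ) (u u' : List D) (G : ℕ) : G ≤ gapRows N u u' G := by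
  induction u' generalizing G with
  | nil => exact le_rfl
  | cons x u' ih => exact (le_gapRow N x u G).trans (ih (gapRow N x u G))

theorem gap_le (N : ℕ) (x y : D) : gap N x y ≤ N := by
  rw [gap]
  split
  · exact (Finset.card_filter_le _ _).trans (by simp)
  · exact Nat.zero_le _

theorem foldl_flatMap {α β γ : Type*} (f : γ → β → γ) (g : α → List β) (l : List α) (c : γ) :
    (l.flatMap g).foldl f c = l.foldl (fun c a => (g a).foldl f c) c := by
  induction l generalizing c with
  | nil => rfl
  | cons a l ih => rw [List.flatMap_cons, List.foldl_append, ih, List.foldl_cons]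

/-- The Horner scheme takes the most significant digit first, so running it over the reversed lists
yields the digits in their natural order. -/
theorem gapRows_reverse (N : ℕ) (v : List D) : gapRows N v.reverse v.reverse 0 =
    Nat.ofDigits (N + 1) (v.flatMap fun x => v.map (gap N x)) := by
  have h1 : gapRows N v.reverse v.reverse 0 = (v.reverse.flatMap fun x => v.reverse.map (gap N x)).foldl
      (fun G h => G * (N + 1) + h) 0 := by
    rw [foldl_flatMap, gapRows]
    congr 1
    funext G x
    rw [gapRow, List.foldl_map]
  have h2 : (v.reverse.flatMap fun x => v.reverse.map (gap N x)) =
      (v.flatMap fun x => v.map (gap N x)).reverse := by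
    rw [List.reverse_flatMap]
    congr 1
    funext x
    simp [Function.comp]
  rw [h1, h2, List.foldl_reverse]
  generalize (v.flatMap fun x => v.map (gap N x)) = l
  induction l with
  | nil => rfl
  | cons a l ih => rw [List.foldr_cons, ih, Nat.ofDigits_cons]; ring

theorem getD_flatMap_map {α : Type*} (g : α → α → ℕ) (l m : List α) {i j : ℕ} (hi : i < l.length)
    (hj : j < m.length) :
    (l.flatMap fun x => m.map (g x)).getD (i * m.length + j) 0 = g l[i] m[j] := by
  induction l generalizing i with
  | nil => simp at hi
  | cons a l ih =>
    rw [List.flatMap_cons]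
    cases i with
    | zero =>
      rw [List.getD_append _ _ _ _ (by simp; omega), List.getD_eq_getElem _ _ (by simp; omega)]
      simp
    | succ i =>
      rw [List.getD_append_right _ _ _ _ (by simp [Nat.succ_mul]; omega), List.length_map,
        show (i + 1) * m.length + j - m.length = i * m.length + j by rw [Nat.succ_mul]; omega,
        ih (by simpa using hi), List.getElem_cons_succ]

theorem digit_gapRows {N k : ℕ} (r : Fin k → D) (i j : Fin k) :
    digit (N + 1) (gapRows N (List.ofFn r).reverse (List.ofFn r).reverse 0) (i * k + j) =
      gap N (r i) (r j) := by
  rw [gapRows_reverse, digit_ofDigits]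
  · have := getD_flatMap_map (fun x y => gap N x y) (List.ofFn r) (List.ofFn r) (i := i) (j := j)
      (by simp) (by simp)
    rw [List.getElem_ofFn, List.getElem_ofFn] at this
    simpa using this
  · simp only [List.mem_flatMap, List.mem_map]
    rintro _ ⟨x, -, y, -, rfl⟩
    exact Nat.lt_succ_of_le (gap_le N x y)

end

namespace Cmd

/-- Popping is the only way to read, so the inner loop consumes its list of values, saves them on a
buffer and restores them after each row. The partial results of the Horner scheme never decrease, so
the final value bounds them all. -/
theorem runs_gapRows : ∃ (c : Cmd) (T : ℕ → ℕ), PolyBounded T ∧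
    ∀ (D : Type u) [AddGroup D] [LinearOrder D] (W n k N M : ℕ) (u u' : List D) (G : ℕ)
      (ρ : Fin 4 → D) (B : ℕ), gapRows N u u' G + N + N ≤ B → u.length ≤ B → u'.length ≤ B →
    ∃ ρ', Runs c (mainStore [] [] W n k [] N M (u'.map Cell.val) (u.map Cell.val) 0 0 G 0 ρ) (T B)
      (mainStore [] [] W n k [] N M [] (u.map Cell.val) 0 0 (gapRows N u u' G) 0 ρ') := by
  obtain ⟨P, T, hT, h⟩ := runs_assign (f := fun p : (ℕ × ℕ) × ℕ => p.2 * (p.1.1 + 1) + p.1.2)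
    (.add (.mul .snd FP.id.weaken.weaken.succ) FP.snd.weaken)
  let row : Cmd := loop 9 1 (fun _ => skip) (seq (pushReg 5 1) (seq countGap (seq
    (assign P (fun j => if j = 0 then 6 else if j = 1 then 11 else 12) 12 14 15) (clear 11))))
  let restore : Cmd := loop 5 1 (fun _ => skip) (pushReg 9 1)
  have hrow : ∀ (D : Type u) [AddGroup D] [LinearOrder D] (W n k N M : ℕ) (u : List D)
      (b v : List (Cell D)) (G : ℕ) (ρ : Fin 4 → D) (x : D) (B : ℕ), ρ 0 = x →
      gapRow N x u G + N + N ≤ B →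
      ∃ ρ', ρ' 0 = x ∧ Runs row (mainStore [] [] W n k b N M v (u.map Cell.val) 0 0 G 0 ρ)
        (u.length * (T B + 11 * B + 11) + 1)
        (mainStore [] [] W n k ((u.map Cell.val).reverse ++ b) N M v [] 0 0 (gapRow N x u G) 0 ρ') := by
    intro D _ _ W n k N M u
    induction u with
    | nil => exact fun b v G ρ x B hx _ => ⟨ρ, hx, (runs_loop_nil rfl).mono (by simp)⟩
    | cons y u ih =>
      intro b v G ρ x B hx hB
      have hB' : G * (N + 1) + gap N x y + N + N ≤ B := by
        have := le_gapRow N x u (G * (N + 1) + gap N x y)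
        change gapRow N x u (G * (N + 1) + gap N x y) + N + N ≤ B at hB
        omega
      have hg := gap_le N x y
      have hGB : G ≤ G * (N + 1) := by rw [Nat.mul_succ]; omega
      obtain ⟨ρ₁, h0, r2⟩ := runs_countGap (W := W) (n := n) (k := k) (b := Cell.val y :: b) (N := N)
        (M := M) (v := v) (v' := u.map Cell.val) (G := G) (ρ := Function.update ρ 1 y) (x := x) (y := y)
        (by simpa using hx) (by simp)
      obtain ⟨ρ', h0', r5⟩ := ih (Cell.val y :: b) v (G * (N + 1) + gap N x y) ρ₁ x B h0 hB
      have r1 : Runs (pushReg 5 1)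
          (((mainStore [] [] W n k b N M v ((y :: u).map Cell.val) 0 0 G 0 ρ).set 9
            (u.map Cell.val)).setReg 1 y) 1
          (mainStore [] [] W n k (Cell.val y :: b) N M v (u.map Cell.val) 0 0 G 0
            (Function.update ρ 1 y)) := by
        refine (runs_pushReg _ _ _).congr ?_
        simp only [mainStore]
        rw [frame_set _ _ (by simp), frame_setReg, frame_set _ _ (by simp)]
        rfl
      have r3 : Runs (assign P (fun j => if j = 0 then 6 else if j = 1 then 11 else 12) 12 14 15)
          (mainStore [] [] W n k (Cell.val y :: b) N M v (u.map Cell.val) 0 (gap N x y) G 0 ρ₁) (T B)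
          (mainStore [] [] W n k (Cell.val y :: b) N M v (u.map Cell.val) 0 (gap N x y)
            (G * (N + 1) + gap N x y) 0 ρ₁) := by
        refine (h (fun j => if j = 0 then 6 else if j = 1 then 11 else 12) 12 14 15 (fun j _ => by
          split
          · omega
          · split <;> omega) (by omega) (by omega) (by omega) D _ ((N, gap N x y), G) G B
          (fun j hj => ?_) rfl rfl (fun j hj => mainStore_stack_of_le hj)
          (by rw [size_prod, size_prod, size_nat]; dsimp only; omega) (by omega)).congr ?_
        · have hj : j < 3 := hj
          interval_cases j <;> rfl
        · simp only [mainStore]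
          rw [frame_set _ _ (by simp)]
          rfl
      have r4 : Runs (clear 11) (mainStore [] [] W n k (Cell.val y :: b) N M v (u.map Cell.val) 0
          (gap N x y) (G * (N + 1) + gap N x y) 0 ρ₁) (2 * N + 1)
          (mainStore [] [] W n k (Cell.val y :: b) N M v (u.map Cell.val) 0 0
            (G * (N + 1) + gap N x y) 0 ρ₁) := by
        refine ((runs_clear (n := gap N x y) rfl).mono (by omega)).congr ?_
        simp only [mainStore]
        rw [frame_set _ _ (by simp)]
        rfl
      refine ⟨ρ', h0', ((runs_loop_val (l := u.map Cell.val) (d := y) rfl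
        (r1.seq (r2.seq (r3.seq r4))) r5).mono ?_).congr ?_⟩
      · rw [List.length_cons, Nat.succ_mul u.length]; omega
      · rw [List.map_cons, List.reverse_cons, List.append_assoc]
        rfl
  have hrestore : ∀ (D : Type u) [AddGroup D] [LinearOrder D] (W n k N M : ℕ) (u : List D)
      (v v' : List (Cell D)) (G : ℕ) (ρ : Fin 4 → D),
      ∃ ρ', Runs restore (mainStore [] [] W n k (u.map Cell.val) N M v v' 0 0 G 0 ρ)
        (2 * u.length + 1)
        (mainStore [] [] W n k [] N M v ((u.map Cell.val).reverse ++ v') 0 0 G 0 ρ') := by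
    intro D _ _ W n k N M u
    induction u with
    | nil => exact fun v v' G ρ => ⟨ρ, (runs_loop_nil rfl).mono (by simp)⟩
    | cons y u ih =>
      intro v v' G ρ
      obtain ⟨ρ', r2⟩ := ih v (Cell.val y :: v') G (Function.update ρ 1 y)
      refine ⟨ρ', ((runs_loop_val (l := u.map Cell.val) (d := y) (T := 1) rfl
        ((runs_pushReg _ _ _).congr ?_) r2).mono ?_).congr ?_⟩
      · simp only [mainStore]
        rw [frame_set _ _ (by simp), frame_setReg, frame_set _ _ (by simp)]
        rfl
      · rw [List.length_cons]; omega
      · rw [List.map_cons, List.reverse_cons, List.append_assoc]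
        rfl
  refine ⟨loop 8 0 (fun _ => skip) (seq row restore),
    fun B => B * (B * (T B + 11 * B + 11) + 2 * B + 3) + 1,
    (PolyBounded.id.mul (((PolyBounded.id.mul ((hT.add ((PolyBounded.const 11).mul .id)).add
      (.const 11))).add ((PolyBounded.const 2).mul .id)).add (.const 3))).add (.const 1), ?_⟩
  intro D _ _ W n k N M u u' G ρ B hB hu hu'
  suffices hs : ∃ ρ', Runs (loop 8 0 (fun _ => skip) (seq row restore))
      (mainStore [] [] W n k [] N M (u'.map Cell.val) (u.map Cell.val) 0 0 G 0 ρ)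
      (u'.length * (B * (T B + 11 * B + 11) + 2 * B + 3) + 1)
      (mainStore [] [] W n k [] N M [] (u.map Cell.val) 0 0 (gapRows N u u' G) 0 ρ') by
    obtain ⟨ρ', hs⟩ := hs
    exact ⟨ρ', hs.mono (Nat.add_le_add_right (Nat.mul_le_mul_right _ hu') 1)⟩
  clear hu'
  induction u' generalizing G ρ with
  | nil => exact ⟨ρ, (runs_loop_nil rfl).mono (by simp)⟩
  | cons x u' ih =>
    have hB' : gapRow N x u G + N + N ≤ B := by
      have := le_gapRows N u u' (gapRow N x u G)
      change gapRows N u u' (gapRow N x u G) + N + N ≤ B at hB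
      omega
    obtain ⟨ρ₁, -, r1⟩ := hrow D W n k N M u [] (u'.map Cell.val) G (Function.update ρ 0 x) x B
      (by simp) hB'
    obtain ⟨ρ₂, r2⟩ := hrestore D W n k N M u.reverse (u'.map Cell.val) [] (gapRow N x u G) ρ₁
    obtain ⟨ρ', r3⟩ := ih (gapRow N x u G) ρ₂ hB
    rw [List.append_nil, ← List.map_reverse] at r1
    rw [List.append_nil, ← List.map_reverse, List.reverse_reverse] at r2
    refine ⟨ρ', (runs_loop_val (l := u'.map Cell.val) (d := x) rfl
      ((r1.congr_left ?_).seq r2) r3).mono ?_⟩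
    · simp only [mainStore]
      rw [frame_set _ _ (by simp), frame_setReg]
      rfl
    · have := Nat.mul_le_mul_right (T B + 11 * B + 11) hu
      rw [List.length_cons, Nat.succ_mul u'.length, List.length_reverse]; omega

end Cmd

/-- The bad configurations can be reached, according to the numbers that the machine computes. -/
def ReachesBad (W n k N G M : ℕ) : Prop :=
  ∃ c < M, Reached (InitCode W n k N G) (StepCode W n k N) M M c ∧ BadCode W n k N c

/-! ### The complete decision program -/

namespace Cmd

theorem runs_reachesBad : ∃ (c : Cmd) (T : ℕ → ℕ), PolyBounded T ∧
    ∀ (D : Type u) [AddGroup D] [LinearOrder D] (W n k N M : ℕ) (v : List (Cell D)) (G : ℕ)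
      (ρ : Fin 4 → D) (B : ℕ), W ≤ B → n ≤ B → k ≤ B → N ≤ B → G ≤ B → M ≤ B →
    Runs c (mainStore [] [] W n k [] N M [] v 0 0 G 0 ρ) (T B)
      (mainStore [] [] W n k [] N M [] v 0 0 G (truth (ReachesBad W n k N G M)) ρ) := by
  obtain ⟨-, t, ⟨e, he⟩, P, hP⟩ := FPred.reachesBad.{u}
  -- These stacks hold the six arguments W, n, k, N, G and M in this order; the result goes to stack
  -- 13, and stacks from 14 on are empty.
  refine ⟨P (fun j => [2, 3, 4, 6, 12, 7].getD j 0) 13 14, fun B => (6 * B + 2) ^ e,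
    (((PolyBounded.const 6).mul .id).add (.const 2)).pow e, ?_⟩
  intro D _ _ W n k N M v G ρ B h1 h2 h3 h4 h5 h6
  refine ((hP (fun j => [2, 3, 4, 6, 12, 7].getD j 0) 13 14 (fun j hj => ?_) (by omega) D _
    (((((W, n), k), N), G), M) (fun j hj => ?_) rfl (fun i hi => ?_)).mono ?_).congr ?_
  · have hj : j < 6 := hj
    interval_cases j <;> exact ⟨by decide, by decide⟩
  · have hj : j < 6 := hj
    interval_cases j <;> rfl
  · rcases Nat.eq_or_lt_of_le hi with rfl | hi
    · rfl
    · exact mainStore_stack_of_le hi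
  · refine (he _).trans (Nat.pow_le_pow_left ?_ e)
    rw [size_prod, size_prod, size_prod, size_prod, size_prod, size_nat]
    dsimp only
    omega
  · simp only [mainStore]
    rw [frame_set _ _ (by simp)]
    rfl

theorem initStore_eq {D : Type u} [AddGroup D] (w : List (Cell D)) :
    initStore w = mainStore w [] 0 0 0 [] 0 0 [] [] 0 0 0 0 (fun _ => 0) :=
  Store.ext (fun j => by
    rcases Nat.lt_or_ge j 15 with hj | hj
    · interval_cases j <;> rfl
    · rw [mainStore_stack_of_le hj]
      have h0 : j ≠ 0 := by omega
      simp [initStore, Function.update_of_ne h0]) rfl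

/-- The complete program. -/
theorem runs_main : ∃ (c : Cmd) (T : ℕ → ℕ), PolyBounded T ∧
    ∀ (D : Type u) [AddGroup D] [LinearOrder D] (w : List (Cell D)) (W n k N G M B : ℕ),
      W = hornerCode 0 w.reverse → n = w.length → k = (dataValues w).length → N = valueBound n →
      M = N ^ (2 * n + 2) → G = gapRows N (dataValues w).reverse (dataValues w).reverse 0 →
      k ≤ n → W ≤ B → (n + 3) ^ 6 ≤ B → 2 * n + 2 ≤ B → M + N ≤ B → G + N + N ≤ B →
    ∃ s, Runs c (initStore w) (T B) s ∧ s.stack 13 = unary D (truth (ReachesBad W n k N G M)) := by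
  obtain ⟨c₁, T₁, hT₁, h₁⟩ := runs_codeInput.{u}
  obtain ⟨c₂, T₂, hT₂, h₂⟩ := runs_bounds.{u}
  obtain ⟨c₃, T₃, hT₃, h₃⟩ := runs_gapRows.{u}
  obtain ⟨c₄, T₄, hT₄, h₄⟩ := runs_reachesBad.{u}
  refine ⟨seq reverseInput (seq c₁ (seq c₂ (seq c₃ c₄))),
    fun B => 4 * B + (B * T₁ B + 1) + T₂ B + T₃ B + T₄ B + 1,
    ((((((PolyBounded.const 4).mul .id).add ((PolyBounded.id.mul hT₁).add (.const 1))).add hT₂).add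
      hT₃).add hT₄).add (.const 1), ?_⟩
  intro D _ _ w W n k N G M B hW hn hk hN hM hG hkn b1 b2 b3 b4 b5
  set u := (dataValues w).reverse with hu
  have hv : ((dataValues w).map Cell.val).reverse ++ [] = u.map Cell.val := by
    rw [List.append_nil, ← List.map_reverse]
  obtain ⟨ρ₁, r1⟩ := runs_reverseInput w [] [] (fun _ => 0)
  rw [hv, List.append_nil, ← initStore_eq] at r1
  obtain ⟨ρ₂, r2⟩ := h₁ D w.reverse 0 0 0 (u.map Cell.val) ρ₁ B (by rwa [← hW])
  have hk' : (dataValues w.reverse).length = k := by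
    rw [hk, dataValues, dataValues, List.filterMap_reverse, List.length_reverse]
  rw [List.length_reverse, ← hn, hk', ← hW, Nat.zero_add, Nat.zero_add] at r2
  have r3 := h₂ D W n k (u.map Cell.val) ρ₂ B b2 b3 (by rwa [← hN, ← hM])
  rw [← hN, ← hM] at r3
  have hul : u.length ≤ B := by rw [hu, List.length_reverse]; omega
  obtain ⟨ρ₃, r4⟩ := h₃ D W n k N M u u 0 ρ₂ B (by rwa [← hG]) hul hul
  rw [← hG] at r4
  have r5 := h₄ D W n k N M (u.map Cell.val) G ρ₃ B b1 (by omega) (by omega) (by omega) (by omega)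
    (by omega)
  refine ⟨_, (r1.seq (r2.seq (r3.seq (r4.seq r5)))).mono ?_, rfl⟩
  have : n * T₁ B ≤ B * T₁ B := Nat.mul_le_mul_right _ (by omega)
  dsimp only
  omega

end Cmd

/-! ### Words that describe transducers -/

section

variable {D : Type u}

theorem hornerCode_reverse (w : List (Cell D)) :
    hornerCode 0 w.reverse = Nat.ofDigits 16 (w.map Cell.code) := by
  rw [hornerCode, List.foldl_reverse]
  induction w with
  | nil => rfl
  | cons a w ih => rw [List.foldr_cons, ih, List.map_cons, Nat.ofDigits_cons, Nat.add_comm]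

theorem dataValues_append (w w' : List (Cell D)) :
    dataValues (w ++ w') = dataValues w ++ dataValues w' := List.filterMap_append

theorem dataValues_eq_nil {w : List (Cell D)} (h : ∀ a ∈ w, ∃ l, a = Cell.sym l) :
    dataValues w = [] := by
  rw [dataValues, List.filterMap_eq_nil_iff]
  intro a ha
  obtain ⟨l, rfl⟩ := h a ha
  rfl

theorem encodeNat_sym {n : ℕ} : ∀ a ∈ encodeNat D n, ∃ l, a = Cell.sym l := by
  intro a ha
  simp only [encodeNat, List.mem_append, List.mem_map, List.mem_singleton] at ha
  rcases ha with ⟨b, -, rfl⟩ | rfl <;> exact ⟨_, rfl⟩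

theorem encodeTransition_sym {a b q k : ℕ} {τ : Transition (Fin a) (Fin b) (Fin q) k} :
    ∀ c ∈ encodeTransition D τ, ∃ l, c = Cell.sym l := by
  intro c hc
  simp only [encodeTransition, List.mem_append, List.mem_ofFn] at hc
  rcases hc with (((((h | h) | ⟨i, rfl⟩) | ⟨i, rfl⟩) | h) | h) | h
  exacts [encodeNat_sym _ h, encodeNat_sym _ h, ⟨_, rfl⟩, ⟨_, rfl⟩, encodeNat_sym _ h,
    encodeNat_sym _ h, encodeNat_sym _ h]

/-- All data values have the same code 9, so the coded word forgets them. They are extracted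
separately, and only their gaps enter the search. -/
theorem FinSRT.Describes.spec {S : FinSRT D} {w : List (Cell D)} (h : S.Describes w) :
    dataValues w = List.ofFn S.srt.init ∧
      ∃ ts, {τ | τ ∈ ts} = S.srt.trans ∧ IsCode (w.map Cell.code) (S.srt.start : ℕ) ts := by
  obtain ⟨ts, hts, rfl⟩ := h
  constructor
  · simp only [dataValues_append]
    rw [dataValues_eq_nil encodeNat_sym, dataValues_eq_nil encodeNat_sym,
      dataValues_eq_nil encodeNat_sym, dataValues_eq_nil encodeNat_sym,
      dataValues_eq_nil (w := ts.flatMap _) fun c hc => by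
        obtain ⟨τ, -, hc⟩ := List.mem_flatMap.1 hc
        exact encodeTransition_sym c hc]
    simp only [List.nil_append, List.append_nil]
    have : (List.ofFn fun i => Cell.val (S.srt.init i)) = (List.ofFn S.srt.init).map Cell.val := by
      rw [List.map_ofFn]; rfl
    rw [this, dataValues, List.filterMap_map]
    exact List.filterMap_some
  · refine ⟨ts, Set.ext hts, ⟨?_, ?_⟩⟩
    · intro d hd
      obtain ⟨a, -, rfl⟩ := List.mem_map.1 hd
      exact a.code_lt
    · simp only [List.map_append, map_code_encodeNat, List.append_assoc, List.map_ofFn,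
        List.map_flatMap, map_code_encodeTransition]
      congr
      exact List.ofFn_const _ _

end

/-! ### The time bound -/

theorem two_mul_add_le_two_pow (n : ℕ) : 2 * n + 2 ≤ 2 ^ (2 * n + 1) := Nat.lt_two_pow_self

/-- A bound on all numbers that occur in a computation on a word of length `n`. -/
def numberBound (n : ℕ) : ℕ := 2 ^ 2 ^ ((n + 3) ^ 6 + 2 * n + 1)

theorem le_numberBound {n x : ℕ} (h : x ≤ (n + 3) ^ 6 + 2 * n + 2) : x ≤ numberBound n :=
  h.trans ((Nat.lt_two_pow_self (n := (n + 3) ^ 6 + 2 * n + 1)).trans Nat.lt_two_pow_self)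

/-- An exponent that is singly exponential in `n` only adds to the upper exponent of the tower. -/
theorem valueBound_pow_le {n m : ℕ} (h : m ≤ 2 ^ (2 * n + 1)) :
    valueBound n ^ m ≤ numberBound n := by
  rw [valueBound, numberBound, ← pow_mul, Nat.add_assoc, pow_add]
  exact Nat.pow_le_pow_right (by omega) (Nat.mul_le_mul_left _ h)

theorem sixteen_pow_le_numberBound (n : ℕ) : 16 ^ n ≤ numberBound n := by
  have h1 : 4 * n ≤ 2 ^ ((n + 3) ^ 6 + 2 * n + 1) := by
    have h1 := Nat.lt_two_pow_self (n := n)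
    have h2 : 2 ^ (2 + n) ≤ 2 ^ ((n + 3) ^ 6 + 2 * n + 1) := by
      refine Nat.pow_le_pow_right (by omega) ?_
      have : 3 ≤ (n + 3) ^ 6 := (by omega : 3 ≤ n + 3).trans (Nat.le_self_pow (by norm_num) _)
      omega
    rw [pow_add] at h2
    omega
  calc 16 ^ n = 2 ^ (4 * n) := by rw [pow_mul]; norm_num
    _ ≤ _ := Nat.pow_le_pow_right (by omega) h1

/-- Doubly exponential bounds are closed under polynomials: raising 2 ^ 2 ^ E to a constant power
adds a constant to `E`. -/
theorem exists_time_bound {T : ℕ → ℕ} (hT : PolyBounded T) :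
    ∃ p : Polynomial ℕ, ∀ n, T (4 * numberBound n) + 1 ≤ 2 ^ 2 ^ p.eval n := by
  obtain ⟨c, hc⟩ := hT
  refine ⟨(Polynomial.X + Polynomial.C 3) ^ 6 + Polynomial.C 2 * Polynomial.X +
    Polynomial.C (3 * c + 2), fun n => ?_⟩
  have he : ((Polynomial.X + Polynomial.C 3) ^ 6 + Polynomial.C 2 * Polynomial.X +
      Polynomial.C (3 * c + 2)).eval n = (n + 3) ^ 6 + 2 * n + 1 + (3 * c + 1) := by
    simp only [Polynomial.eval_add, Polynomial.eval_pow, Polynomial.eval_mul, Polynomial.eval_X,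
      Polynomial.eval_C]
    omega
  rw [he]
  have h := hc (4 * numberBound n)
  rw [size_nat] at h
  set E := (n + 3) ^ 6 + 2 * n + 1 with hE
  set Z := numberBound n with hZ
  have hZ4 : 4 ≤ Z := by
    have : 2 ≤ 2 ^ E := by
      calc 2 = 2 ^ 1 := rfl
        _ ≤ 2 ^ E := Nat.pow_le_pow_right (by omega) (by omega)
    calc 4 = 2 ^ 2 := rfl
      _ ≤ Z := Nat.pow_le_pow_right (by omega) this
  have h1 : 4 * Z + 2 ≤ Z ^ 3 := by
    have h16 : 4 * 4 ≤ Z * Z := Nat.mul_le_mul hZ4 hZ4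
    calc 4 * Z + 2 ≤ (4 * 4) * Z := by omega
      _ ≤ (Z * Z) * Z := Nat.mul_le_mul_right _ h16
      _ = Z ^ 3 := by ring
  have h2 : (4 * Z + 2) ^ c ≤ Z ^ (3 * c) := by
    rw [pow_mul]; exact Nat.pow_le_pow_left h1 c
  have h3 : 1 ≤ Z ^ (3 * c) := Nat.one_le_pow _ _ (by omega)
  calc T (4 * Z) + 1 ≤ Z ^ (3 * c) * 4 := by omega
    _ ≤ Z ^ (3 * c) * Z := Nat.mul_le_mul_left _ hZ4
    _ = Z ^ (3 * c + 1) := (pow_succ _ _).symm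
    _ = 2 ^ (2 ^ E * (3 * c + 1)) := by rw [hZ, numberBound, ← pow_mul]
    _ ≤ 2 ^ (2 ^ E * 2 ^ (3 * c + 1)) := Nat.pow_le_pow_right (by omega)
        (Nat.mul_le_mul_left _ Nat.lt_two_pow_self.le)
    _ = 2 ^ 2 ^ (E + (3 * c + 1)) := by rw [← pow_add]

/-! ### Deciding functionality -/

/-- A program that decides non-functionality by whether stack `13` is nonempty in the end. -/
theorem exists_program : ∃ (c : Cmd) (p : Polynomial ℕ),
    ∀ (D : Type u) [AddGroup D] [LinearOrder D] [AddLeftMono D] [AddRightMono D] [Infinite D]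
      (S : FinSRT D), S.srt.AddFree → ∀ w : List (Cell D), S.Describes w →
      ∃ n s, Exec c (initStore w) n s ∧ n + 1 ≤ 2 ^ 2 ^ p.eval w.length ∧
        (s.stack 13 ≠ [] ↔ ¬ FunctionalTransformation S.srt.transformation) := by
  obtain ⟨c, T, hT, h⟩ := runs_main.{u}
  obtain ⟨p, hp⟩ := exists_time_bound hT
  refine ⟨c, p, fun D _ _ _ _ _ S hS w hw => ?_⟩
  obtain ⟨hv, ts, hts, hcode⟩ := hw.spec
  obtain ⟨hq, hk⟩ := hcode.states_le
  rw [List.length_map] at hq hk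
  set n := w.length with hn
  set N := valueBound n with hN
  set M := N ^ (2 * n + 2) with hM
  set L := w.map Cell.code with hL
  set G := gapRows N (dataValues w).reverse (dataValues w).reverse 0 with hG
  have hlen : L.length = n := List.length_map _
  have hk' : (dataValues w).length = S.k := by rw [hv, List.length_ofFn]
  have hN1 : 1 ≤ N := Nat.one_le_two_pow
  have hMB : M ≤ numberBound n := valueBound_pow_le (two_mul_add_le_two_pow n)
  have hNM : N ≤ M := Nat.le_self_pow (by omega) _
  have hGB : G ≤ numberBound n := by
    -- `G` has k² digits in base N + 1.
    have hlt : G < (N + 1) ^ (S.k * S.k) := by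
      rw [hG, gapRows_reverse]
      refine (Nat.ofDigits_lt_base_pow_length (by omega) ?_).trans_eq ?_
      · simp only [List.mem_flatMap, List.mem_map]
        rintro _ ⟨x, -, y, -, rfl⟩
        exact Nat.lt_succ_of_le (gap_le N x y)
      · simp [List.length_flatMap, hk']
    have h2 : N + 1 ≤ N ^ 2 := by
      have : 2 ≤ N := by
        calc 2 = 2 ^ 1 := rfl
          _ ≤ N := Nat.pow_le_pow_right (by omega) Nat.one_le_two_pow
      nlinarith
    have h3 : 2 * (S.k * S.k) ≤ 2 ^ (2 * n + 1) := by
      have h1 : S.k ≤ 2 ^ n := hk.trans Nat.lt_two_pow_self.le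
      have h2 := Nat.mul_le_mul h1 h1
      have : 2 ^ (2 * n + 1) = 2 * (2 ^ n * 2 ^ n) := by rw [← pow_add]; ring
      omega
    calc G ≤ (N + 1) ^ (S.k * S.k) := hlt.le
      _ ≤ (N ^ 2) ^ (S.k * S.k) := Nat.pow_le_pow_left h2 _
      _ = N ^ (2 * (S.k * S.k)) := (pow_mul _ _ _).symm
      _ ≤ numberBound n := valueBound_pow_le h3
  have hWB : hornerCode 0 w.reverse ≤ numberBound n := by
    rw [hornerCode_reverse]
    refine le_trans ?_ (sixteen_pow_le_numberBound n)
    rw [← hlen]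
    exact (Nat.ofDigits_lt_base_pow_length (by norm_num) hcode.lt).le
  -- The factor 4 covers the sums M + N and G + N + N, all of whose terms are at most `numberBound
  -- n`.
  obtain ⟨s, ⟨m, hm, hs⟩, hout⟩ := h D w _ n S.k N G M (4 * numberBound n) rfl rfl hk'.symm rfl rfl rfl
    hk (by omega) ((le_numberBound (n := n) (by omega)).trans (by omega))
    ((le_numberBound (n := n) (by omega)).trans (by omega)) (by omega) (by omega)
  refine ⟨m, s, hs, (Nat.succ_le_succ hm).trans (hp n), ?_⟩
  have h2N : 2 ^ L.length ≤ N := by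
    rw [hlen]
    refine Nat.pow_le_pow_right (by omega) (Nat.lt_two_pow_self.le.trans
      (Nat.pow_le_pow_right (by omega) ?_))
    exact (by omega : n ≤ n + 3).trans (Nat.le_self_pow (by norm_num) _)
  have hNk : N ^ (2 * S.k + 2) ≤ M := Nat.pow_le_pow_right hN1 (by omega)
  -- The chain of equivalences: not functional, bad pair of runs over the group, bad pair over
  -- numbers below `N` compatible with the gaps, reachable bad code.
  have key : ReachesBad (hornerCode 0 w.reverse) n S.k N G M ↔
      ¬ FunctionalTransformation S.srt.transformation := by
    rw [SRT.not_functional_iff hS, RegSys.exists_badIn_iff (N := N) (pairSys S.srt.trans) _ hNM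
      (fillBound_add_le_valueBound hq hk), hornerCode_reverse, ← hL, ← hlen, ← hts]
    exact hcode.reachesBad_iff h2N (fun i j => by
      rw [hG, hv]; exact digit_gapRows S.srt.init i j) hNk
  rw [hout, ← key]
  by_cases hr : ReachesBad (hornerCode 0 w.reverse) n S.k N G M
  · rw [truth_of hr]
    simp [hr, unary_succ]
  · rw [truth_of_not hr]
    simp [hr]

/-- Both machines run the same deterministic program and differ only in whether a nonempty stack 13
means acceptance. -/
theorem mainTheorem1 :
    InTwoNEXPTIME.{u} (fun _ _ _ S => S.srt.AddFree)
        (fun _ _ _ S => FunctionalTransformation S.srt.transformation) ∧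
      InTwoNEXPTIME.{u} (fun _ _ _ S => S.srt.AddFree)
        (fun _ _ _ S => ¬ FunctionalTransformation S.srt.transformation) := by
  obtain ⟨c, p, h⟩ := exists_program.{u}
  obtain ⟨m, hm⟩ := c.exists_below
  -- The number of stacks is enlarged so that the output stack 13 certainly exists.
  have hc : c.Below (m + 13 + 1) := hm.mono (by omega)
  constructor
  · refine ⟨machine c (m + 13) 13 false, p, fun D _ _ _ _ _ S hS w hw => ?_⟩
    obtain ⟨n, s, hs, hn, ho⟩ := h D S hS w hw
    obtain ⟨h1, h2⟩ := machine_spec hc (by omega : 13 < m + 13 + 1) false hs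
    refine ⟨fun n' c' h' => (h1 n' c' h').trans hn, h2.trans ?_⟩
    simp only [ho]
    simp
  · refine ⟨machine c (m + 13) 13 true, p, fun D _ _ _ _ _ S hS w hw => ?_⟩
    obtain ⟨n, s, hs, hn, ho⟩ := h D S hS w hw
    obtain ⟨h1, h2⟩ := machine_spec hc (by omega : 13 < m + 13 + 1) true hs
    refine ⟨fun n' c' h' => (h1 n' c' h').trans hn, h2.trans ?_⟩
    simp only [ho]
    simp
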